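/- Let $q$ be a power of $2$, let $d\ge 4$, let $V$ be a $d$-dimensional vector space over $\mathbb{F}_q$, and let $Q$ be a quadratic form on $V$ whose polar form is non-degenerate (so $d$ is even and $Q$ is of hyperbolic type $+$ or of elliptic type $-$). Let $\Omega_d^{\pm}(q)=\Omega(V,Q)$ be the group of all linear isometries $g$ of $(V,Q)$ such that $g-1$ has even rank (the kernel of the Dickson invariant). Let $\mathrm{NS}_1$ be the set of non-singular $1$-dimensional subspaces of $V$, that is, the subspaces $\langle v\rangle$ with $Q(v)\neq 0$, and regard $\Omega_d^{\pm}(q)$ as a permutation group on $\mathrm{NS}_1$. Let $G$ be a permutation group on $\mathrm{NS}_1$ whose socle (the subgroup generated by all minimal normal subgroups of $G$) is $\Omega_d^{\pm}(q)$. An irredundant base for $G$ is a finite sequence of points whose pointwise stabilizer in $G$ is trivial and in which no point is fixed by the pointwise stabilizer of its predecessors; $G$ is IBIS if all its irredundant bases have the same size. Then $G$ is IBIS if and only if $G=\Omega_d^{\pm}(q)$ and $q\ge 4$. Moreover, if $G$ is IBIS, then every irredundant base for $G$ has size $d-1$. -/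

import Mathlib

/-! ### Permutation groups: socle, irredundant bases, IBIS -/

section PermutationGroups

/-- `N` is a minimal normal subgroup of `G`. -/
def IsMinimalNormal {G : Type*} [Group G] (N : Subgroup G) : Prop :=
  N.Normal ∧ N ≠ ⊥ ∧ ∀ M : Subgroup G, M.Normal → M ≤ N → M = ⊥ ∨ M = N

/-- The socle of a group: the subgroup generated by all its minimal normal subgroups. -/
def socle (G : Type*) [Group G] : Subgroup G :=
  sSup {N : Subgroup G | IsMinimalNormal N}

variable {α : Type*}

/-- The pointwise stabilizer in the permutation group `G` of the points of the sequence `l`. -/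
def pointwiseStabilizer (G : Subgroup (Equiv.Perm α)) (l : List α) :
    Subgroup (Equiv.Perm α) where
  carrier := {g | g ∈ G ∧ ∀ x ∈ l, g x = x}
  mul_mem' := by
    rintro a b ⟨ha, ha'⟩ ⟨hb, hb'⟩
    exact ⟨G.mul_mem ha hb, fun x hx => by rw [Equiv.Perm.mul_apply, hb' x hx, ha' x hx]⟩
  one_mem' := ⟨G.one_mem, fun _ _ => rfl⟩
  inv_mem' := by
    rintro a ⟨ha, ha'⟩
    exact ⟨G.inv_mem ha, fun x hx => by rw [Equiv.Perm.inv_eq_iff_eq, ha' x hx]⟩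

/-- A sequence of points is an irredundant base for `G` if its pointwise stabilizer is trivial
and no point of the sequence is fixed by the pointwise stabilizer of its predecessors. -/
def IsIrredundantBase (G : Subgroup (Equiv.Perm α)) (l : List α) : Prop :=
  pointwiseStabilizer G l = ⊥ ∧
    ∀ (i : ℕ) (hi : i < l.length), ∃ g ∈ pointwiseStabilizer G (l.take i), g l[i] ≠ l[i]

/-- A permutation group is IBIS if all its irredundant bases have the same size. -/
def IsIBIS (G : Subgroup (Equiv.Perm α)) : Prop :=
  ∀ l l' : List α, IsIrredundantBase G l → IsIrredundantBase G l' → l.length = l'.length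

end PermutationGroups

/-! ### Orthogonal groups in characteristic two and their action on non-singular points -/

section OrthogonalGroups

variable {F V : Type*} [Field F] [AddCommGroup V] [Module F V]

/-- The group of all linear isometries of the quadratic space `(V, Q)`. -/
def isometryGroup (Q : QuadraticForm F V) : Subgroup (V ≃ₗ[F] V) where
  carrier := {g | ∀ v, Q (g v) = Q v}
  mul_mem' := by
    intro a b ha hb v
    rw [LinearEquiv.mul_apply, ha, hb]
  one_mem' := fun _ => rfl
  inv_mem' := by
    intro a ha v
    have h : a (a⁻¹ v) = v := a.apply_symm_apply v
    rw [← ha (a⁻¹ v), h]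

/-- The group `Ω(V, Q)` for a non-degenerate quadratic form over a finite field of characteristic
two: the kernel of the Dickson invariant (quasideterminant) `g ↦ rank (g - 1) mod 2` of the isometry
group. The isometries with `rank (g - 1)` even form a subgroup of index two, so that the generated
subgroup taken here consists of exactly these isometries. -/
def omegaGroup (Q : QuadraticForm F V) : Subgroup (isometryGroup Q) :=
  Subgroup.closure {g | Even (Module.finrank F
    (LinearMap.range (((g : V ≃ₗ[F] V) : V →ₗ[F] V) - LinearMap.id)))}

/-- The set of non-singular `1`-dimensional subspaces of `(V, Q)`. -/
def NS₁ (Q : QuadraticForm F V) : Type _ :=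
  {U : Submodule F V // Module.finrank F U = 1 ∧ ∃ v ∈ U, Q v ≠ 0}

/-- The natural action of the isometry group on the non-singular `1`-dimensional subspaces. -/
instance (Q : QuadraticForm F V) : MulAction (isometryGroup Q) (NS₁ Q) where
  smul g U := ⟨U.1.map ((g : V ≃ₗ[F] V) : V →ₗ[F] V), by
    refine ⟨((g : V ≃ₗ[F] V).finrank_map_eq U.1).trans U.2.1, ?_⟩
    obtain ⟨v, hv, hQ⟩ := U.2.2
    exact ⟨(g : V ≃ₗ[F] V) v, Submodule.mem_map_of_mem hv, by rwa [g.2 v]⟩⟩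
  one_smul U := Subtype.ext (Submodule.map_id U.1)
  mul_smul g h U := Subtype.ext
    (Submodule.map_comp ((h : V ≃ₗ[F] V) : V →ₗ[F] V) ((g : V ≃ₗ[F] V) : V →ₗ[F] V) U.1)

/-- The permutation group induced by `Ω(V, Q)` on the non-singular `1`-dimensional subspaces. -/
def omegaPerm (Q : QuadraticForm F V) : Subgroup (Equiv.Perm (NS₁ Q)) :=
  (omegaGroup Q).map (MulAction.toPermHom (isometryGroup Q) (NS₁ Q))

end OrthogonalGroups

/-! Squaring is bijective on `F`, so each non-singular point contains exactly one vector with `Q v =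
1` (`normVec`). An isometry fixes a point if and only if it fixes that vector. Pointwise stabilizers
are therefore fixers of subspaces, and a pair of points has a Gram value `nsGram` in `F`. The parity
of the rank of `g - 1` is shown to be additive through an explicit Dickson invariant
(`dickson_eq_residualRank`), so `Ω` is its kernel. Every reflection lies outside `Ω`, and every
product of two reflections lies inside.

For `q ≥ 4` the fixer in `Ω` of a subspace is trivial exactly when the codimension is at most one
(`exists_mem_omegaGroup_ne_one`, `pointwiseStabilizer_omegaPerm_eq_bot`). Irredundant sequences for
`Ω` are linearly independent, so every irredundant base has size `d - 1`.

All negative results use one criterion, `not_isIBIS_of_length_le`: a sequence with trivial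
stabilizer that is no longer than an irredundant sequence with non-trivial stabilizer. The long
sequences come from `IsOrthoSeq`: `d - 1` independent points in the hyperplane orthogonal to `p₀`,
including `p₀`, irredundant already for `Ω` and all fixed by the reflection in `p₀`. Since `G`
normalizes its socle, it remains to understand the normalizer of `Ω`.

For `q ≥ 4` the normalizer permutes the point reflections (`apply_nsRefl_of_mem_normalizer`), and
the reflection formula then makes it act on Gram values by a field endomorphism `σ`
(`exists_ringHom_of_mem_normalizer`). If `σ` is always the identity, then `G` consists of
isometries. In that case, when `G ≠ Ω`, points spanning the hyperplane orthogonal to a singular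
vector give the short base. If some `σ` is non-trivial, two points whose Gram value generates the
multiplicative group of `F` eliminate all field endomorphisms at once, while an orthogonal sequence
with Gram entries `0` and `1` eliminates none.

For `q = 2` the parity of suborbit lengths distinguishes orthogonal from non-orthogonal pairs, so
the normalizer consists of isometries. A hyperbolic plane contains a single non-singular vector, so
fixing its orthogonal complement already fixes a hyperplane; this shortens a base. The argument
needs the complement to be spanned by non-singular vectors. That fails only for `d = 4` of plus
type, where `Ω` is not a socle: it contains an odd permutation, while its centralizer in the
symmetric group is trivial. -/

set_option linter.unusedSectionVars false

/-! ### Polar form, isometries and their fixed spaces -/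

section OrthogonalBasics

variable {F V : Type*} [Field F] [AddCommGroup V] [Module F V] {Q : QuadraticForm F V}

theorem polarBilin_comm (x y : V) : Q.polarBilin x y = Q.polarBilin y x :=
  QuadraticMap.polar_comm Q x y

theorem quadraticForm_add (x y : V) : Q (x + y) = Q x + Q y + Q.polarBilin x y :=
  QuadraticMap.map_add Q x y

theorem quadraticForm_smul (c : F) (x : V) : Q (c • x) = c * c * Q x := by
  rw [QuadraticMap.map_smul, smul_eq_mul]

theorem isRefl_polarBilin : LinearMap.BilinForm.IsRefl Q.polarBilin := fun x y h => by
  rw [polarBilin_comm, h]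

theorem isometry_polarBilin (g : isometryGroup Q) (x y : V) :
    Q.polarBilin (g.1 x) (g.1 y) = Q.polarBilin x y := by
  have h := g.2 (x + y)
  rw [map_add, quadraticForm_add, quadraticForm_add, g.2, g.2] at h
  exact add_left_cancel h

theorem isometry_inv_apply (g : isometryGroup Q) (x : V) : g.1 ((g⁻¹).1 x) = x :=
  g.1.apply_symm_apply x

theorem isometry_mul_apply (g h : isometryGroup Q) (x : V) : (g * h).1 x = g.1 (h.1 x) := rfl

theorem isometry_ext {g h : isometryGroup Q} (H : ∀ x, g.1 x = h.1 x) : g = h :=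
  Subtype.ext (LinearEquiv.ext H)

theorem exists_polarBilin_ne_zero (hQ : Q.polarBilin.Nondegenerate) {x : V} (hx : x ≠ 0) :
    ∃ y, Q.polarBilin x y ≠ 0 := by
  by_contra! h
  exact hx (hQ.1 x h)

theorem exists_mem_orthogonal_polarBilin_ne_zero [FiniteDimensional F V]
    (hQ : Q.polarBilin.Nondegenerate) {W : Submodule F V} {x : V} (hx : x ∉ W) :
    ∃ u ∈ LinearMap.BilinForm.orthogonal Q.polarBilin W, Q.polarBilin u x ≠ 0 := by
  by_contra! h
  apply hx
  rw [← LinearMap.BilinForm.orthogonal_orthogonal hQ isRefl_polarBilin W,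
    LinearMap.BilinForm.mem_orthogonal_iff]
  exact h

theorem mem_orthogonal_polarBilin {W : Submodule F V} {x : V} :
    x ∈ LinearMap.BilinForm.orthogonal Q.polarBilin W ↔ ∀ w ∈ W, Q.polarBilin w x = 0 :=
  LinearMap.BilinForm.mem_orthogonal_iff

theorem mem_orthogonal_span_polarBilin {s : Set V} {x : V} :
    x ∈ LinearMap.BilinForm.orthogonal Q.polarBilin (Submodule.span F s) ↔
      ∀ w ∈ s, Q.polarBilin w x = 0 := by
  rw [mem_orthogonal_polarBilin]
  refine ⟨fun h w hw => h w (Submodule.subset_span hw), fun h w hw => ?_⟩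
  induction hw using Submodule.span_induction with
  | mem w hw => exact h w hw
  | zero => simp
  | add a b _ _ ha hb => simp [ha, hb] 
  | smul c a _ ha => simp [ha]

/-- The dimension of the image of `g - 1`. -/
noncomputable def residualRank (g : isometryGroup Q) : ℕ :=
  Module.finrank F (LinearMap.range (((g : V ≃ₗ[F] V) : V →ₗ[F] V) - LinearMap.id))

/-- The subspace of vectors fixed by `g`. -/
def fixedSpace (g : isometryGroup Q) : Submodule F V :=
  LinearMap.ker (((g : V ≃ₗ[F] V) : V →ₗ[F] V) - LinearMap.id)

theorem mem_fixedSpace {g : isometryGroup Q} {x : V} : x ∈ fixedSpace g ↔ g.1 x = x := by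
  simp [fixedSpace, sub_eq_zero]

theorem residualRank_add_finrank_fixedSpace [FiniteDimensional F V] (g : isometryGroup Q) :
    residualRank g + Module.finrank F (fixedSpace g) = Module.finrank F V :=
  LinearMap.finrank_range_add_finrank_ker _

theorem eq_one_of_residualRank_eq_zero [FiniteDimensional F V] {g : isometryGroup Q}
    (h : residualRank g = 0) : g = 1 := by
  rw [residualRank, Submodule.finrank_eq_zero, LinearMap.range_eq_bot, sub_eq_zero] at h
  exact isometry_ext fun x => LinearMap.congr_fun h x

theorem polarBilin_sub_eq_zero_of_fixed {g : isometryGroup Q} {w : V} (hw : g.1 w = w) (u : V) :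
    Q.polarBilin (g.1 u - u) w = 0 := by
  have := isometry_polarBilin g u w
  rw [hw] at this
  rw [map_sub, LinearMap.sub_apply, this, sub_self]

theorem finrank_sup_span_singleton_of_notMem [FiniteDimensional F V] {W : Submodule F V} {x : V}
    (hx : x ∉ W) : Module.finrank F ↥(W ⊔ Submodule.span F {x}) = Module.finrank F W + 1 := by
  have h := Submodule.finrank_sup_add_finrank_inf_eq W (Submodule.span F {x})
  have hx0 : x ≠ 0 := fun h => hx (h ▸ W.zero_mem)
  have h2 : W ⊓ Submodule.span F {x} = ⊥ := by
    exact disjoint_iff.1 ((Submodule.disjoint_span_singleton' hx0).2 hx)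
  rw [h2, finrank_bot, finrank_span_singleton hx0] at h
  omega

end OrthogonalBasics

/-! ### Reflections and Siegel transformations in characteristic two -/

section CharTwoOrthogonal

variable {F V : Type*} [Field F] [CharP F 2] [AddCommGroup V] [Module F V] {Q : QuadraticForm F V}

theorem two_eq_zero_of_charP_two (F : Type*) [Field F] [CharP F 2] : (2 : F) = 0 :=
  CharTwo.two_eq_zero

theorem polarBilin_self (x : V) : Q.polarBilin x x = 0 := by
  rw [QuadraticMap.polarBilin_apply_apply, QuadraticMap.polar_self, two_smul,
    CharTwo.add_self_eq_zero]

theorem module_add_self (F : Type*) [Field F] [CharP F 2] {V : Type*} [AddCommGroup V]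
    [Module F V] (x : V) : x + x = 0 := by
  rw [← two_smul F x, CharTwo.two_eq_zero, zero_smul]

theorem module_sub_eq_add (F : Type*) [Field F] [CharP F 2] {V : Type*} [AddCommGroup V]
    [Module F V] (x y : V) : x - y = x + y := by
  rw [sub_eq_iff_eq_add, add_assoc, module_add_self F, add_zero]

/-- The reflection in the non-singular vector `a`, as a linear map. -/
noncomputable def reflectionMap (Q : QuadraticForm F V) (a : V) : V →ₗ[F] V :=
  LinearMap.id + ((Q a)⁻¹ • Q.polarBilin a).smulRight a

theorem reflectionMap_apply (a x : V) :
    reflectionMap Q a x = x + ((Q a)⁻¹ * Q.polarBilin a x) • a := by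
  simp [reflectionMap]

theorem reflectionMap_involutive (a : V) : Function.Involutive (reflectionMap Q a) := fun x => by
  simp only [reflectionMap_apply, map_add, map_smul, polarBilin_self, mul_zero, zero_smul, add_zero]
  rw [add_assoc, module_add_self F, add_zero]

/-- The reflection in the non-singular vector `a`. -/
noncomputable def reflIsom (a : V) (ha : Q a ≠ 0) : isometryGroup Q :=
  ⟨LinearEquiv.ofInvolutive (reflectionMap Q a) (reflectionMap_involutive a), fun v => by
    change Q (reflectionMap Q a v) = Q v
    rw [reflectionMap_apply, quadraticForm_add, quadraticForm_smul, map_smul, smul_eq_mul,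
      polarBilin_comm v a]
    field_simp
    linear_combination (Q.polarBilin a v) ^ 2 * two_eq_zero_of_charP_two F⟩

theorem reflIsom_apply (a : V) (ha : Q a ≠ 0) (x : V) :
    (reflIsom a ha).1 x = x + ((Q a)⁻¹ * Q.polarBilin a x) • a := reflectionMap_apply a x

theorem reflIsom_mul_self (a : V) (ha : Q a ≠ 0) : reflIsom a ha * reflIsom a ha = 1 :=
  isometry_ext fun x => reflectionMap_involutive (Q := Q) a x

theorem reflIsom_apply_of_orthogonal {a : V} (ha : Q a ≠ 0) {x : V} (h : Q.polarBilin a x = 0) :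
    (reflIsom a ha).1 x = x := by
  rw [reflIsom_apply, h, mul_zero, zero_smul, add_zero]

theorem reflIsom_apply_eq_self_iff {a : V} (ha : Q a ≠ 0) {x : V} :
    (reflIsom a ha).1 x = x ↔ Q.polarBilin a x = 0 := by
  refine ⟨fun h => ?_, reflIsom_apply_of_orthogonal ha⟩
  have ha0 : a ≠ 0 := fun h => ha (by rw [h, QuadraticMap.map_zero])
  rw [reflIsom_apply, add_eq_left, smul_eq_zero, or_iff_left ha0, mul_eq_zero] at h
  exact h.resolve_left (inv_ne_zero ha)

/-- The linear map `w ↦ w + B(w, x) y + B(w, y) x`. -/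
def siegelMap (Q : QuadraticForm F V) (x y : V) : V →ₗ[F] V :=
  LinearMap.id + (Q.polarBilin x).smulRight y + (Q.polarBilin y).smulRight x

theorem siegelMap_apply (x y w : V) :
    siegelMap Q x y w = w + Q.polarBilin x w • y + Q.polarBilin y w • x := by
  simp [siegelMap]

theorem siegelMap_involutive {x y : V} (h : Q.polarBilin x y = 0) :
    Function.Involutive (siegelMap Q x y) := fun w => by
  have h' : Q.polarBilin y x = 0 := by rw [polarBilin_comm, h]
  simp only [siegelMap_apply, map_add, map_smul, polarBilin_self, h, h', zero_smul, add_zero]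
  have : ∀ a b c : V, a + b + c + b + c = a + (b + b) + (c + c) := fun a b c => by abel
  rw [this, module_add_self F, module_add_self F, add_zero, add_zero]

/-- The Siegel transformation attached to a totally singular pair of vectors. -/
def siegel (x y : V) (hx : Q x = 0) (hy : Q y = 0) (h : Q.polarBilin x y = 0) : isometryGroup Q :=
  ⟨LinearEquiv.ofInvolutive (siegelMap Q x y) (siegelMap_involutive h), fun v => by
    change Q (siegelMap Q x y v) = Q v
    simp only [siegelMap_apply, quadraticForm_add, quadraticForm_smul, map_add, map_smul,
      LinearMap.add_apply, LinearMap.smul_apply, smul_eq_mul, hx, hy, polarBilin_comm y x, h,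
      polarBilin_comm v]
    linear_combination (Q.polarBilin x v * Q.polarBilin y v) * two_eq_zero_of_charP_two F⟩

theorem siegel_apply {x y : V} (hx : Q x = 0) (hy : Q y = 0) (h : Q.polarBilin x y = 0) (w : V) :
    (siegel x y hx hy h).1 w = w + Q.polarBilin x w • y + Q.polarBilin y w • x :=
  siegelMap_apply x y w

theorem siegel_mul_self {x y : V} (hx : Q x = 0) (hy : Q y = 0) (h : Q.polarBilin x y = 0) :
    siegel x y hx hy h * siegel x y hx hy h = 1 :=
  isometry_ext fun w => siegelMap_involutive h w

end CharTwoOrthogonal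

/-! ### An additive Dickson invariant from alternating forms -/

section Dickson

variable {F V : Type*} [Field F] [AddCommGroup V] [Module F V] [FiniteDimensional F V]
  {Q : QuadraticForm F V}

/-- The dual, with respect to the polar form, of the standard basis of `V`. -/
noncomputable def polarDualBasis (hQ : Q.polarBilin.Nondegenerate) :
    Module.Basis (Fin (Module.finrank F V)) F V :=
  LinearMap.BilinForm.dualBasis Q.polarBilin hQ (Module.finBasis F V)

theorem polarBilin_polarDualBasis (hQ : Q.polarBilin.Nondegenerate)
    (i j : Fin (Module.finrank F V)) :
    Q.polarBilin (polarDualBasis hQ i) (Module.finBasis F V j) = if j = i then 1 else 0 :=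
  LinearMap.BilinForm.apply_dualBasis_left hQ _ i j

theorem sum_polarBilin_smul_finBasis (hQ : Q.polarBilin.Nondegenerate) (x : V) :
    ∑ i, Q.polarBilin (polarDualBasis hQ i) x • Module.finBasis F V i = x := by
  have h : ∀ i, Q.polarBilin (polarDualBasis hQ i) x = (Module.finBasis F V).repr x i := by
    intro i
    conv_lhs => rw [← (Module.finBasis F V).sum_repr x]
    simp only [map_sum, map_smul, smul_eq_mul, polarBilin_polarDualBasis, mul_ite, mul_one, mul_zero,
      Finset.sum_ite_eq', Finset.mem_univ, if_true]
  simp only [h, Module.Basis.sum_repr]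

theorem sum_polarBilin_smul_polarDualBasis (hQ : Q.polarBilin.Nondegenerate) (x : V) :
    ∑ i, Q.polarBilin x (Module.finBasis F V i) • polarDualBasis hQ i = x := by
  have h : ∀ i, Q.polarBilin x (Module.finBasis F V i) = (polarDualBasis hQ).repr x i := by
    intro i
    conv_lhs => rw [← (polarDualBasis hQ).sum_repr x]
    simp only [map_sum, map_smul, smul_eq_mul, polarBilin_polarDualBasis, mul_ite, mul_one, mul_zero,
      Finset.sum_ite_eq, Finset.mem_univ, if_true, LinearMap.sum_apply, LinearMap.smul_apply]
  simp only [h, Module.Basis.sum_repr]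

/-- The pairing of an alternating form with the bivector inverse to the polar form. -/
noncomputable def bivectorPairing (hQ : Q.polarBilin.Nondegenerate) (α : V → V → F) : F :=
  ∑ i, ∑ j, if i < j then α (Module.finBasis F V i) (Module.finBasis F V j) *
    Q.polarBilin (polarDualBasis hQ i) (polarDualBasis hQ j) else 0

theorem bivectorPairing_add (hQ : Q.polarBilin.Nondegenerate) (α β : V → V → F) :
    bivectorPairing hQ (fun u v => α u v + β u v) =
      bivectorPairing hQ α + bivectorPairing hQ β := by
  simp only [bivectorPairing, ← Finset.sum_add_distrib]
  refine Finset.sum_congr rfl fun i _ => Finset.sum_congr rfl fun j _ => ?_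
  split_ifs <;> ring

theorem bivectorPairing_mul_left (hQ : Q.polarBilin.Nondegenerate) (c : F) (α : V → V → F) :
    bivectorPairing hQ (fun u v => c * α u v) = c * bivectorPairing hQ α := by
  simp only [bivectorPairing, Finset.mul_sum]
  refine Finset.sum_congr rfl fun i _ => Finset.sum_congr rfl fun j _ => ?_
  split_ifs <;> ring

theorem bivectorPairing_sum (hQ : Q.polarBilin.Nondegenerate) {ι : Type*} (s : Finset ι)
    (α : ι → V → V → F) :
    bivectorPairing hQ (fun u v => ∑ k ∈ s, α k u v) = ∑ k ∈ s, bivectorPairing hQ (α k) := by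
  classical
  induction s using Finset.induction_on with
  | empty => simp [bivectorPairing]
  | insert a s ha ih => simp only [Finset.sum_insert ha, bivectorPairing_add, ih]

variable [CharP F 2]

/-- Expanding `z` over the basis and its dual writes `φ z` as a full double sum. The diagonal
vanishes because the polar form is alternating, and the lower triangle folds onto the upper one.
Summing over `i < j` is what avoids a division by two. -/
theorem bivectorPairing_wedge (hQ : Q.polarBilin.Nondegenerate) (φ : V →ₗ[F] F) (z : V) :
    bivectorPairing hQ (fun u v => φ u * Q.polarBilin z v + φ v * Q.polarBilin z u) = φ z := by
  set b := Module.finBasis F V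
  set c := polarDualBasis hQ
  have h1 : φ z = ∑ i, ∑ j, φ (b i) * Q.polarBilin z (b j) * Q.polarBilin (c i) (c j) := by
    conv_lhs => rw [← sum_polarBilin_smul_finBasis hQ z, map_sum]
    refine Finset.sum_congr rfl fun i _ => ?_
    conv_lhs => rw [← sum_polarBilin_smul_polarDualBasis hQ z]
    simp only [map_smul, map_sum, smul_eq_mul, Finset.sum_mul]
    refine Finset.sum_congr rfl fun j _ => ?_
    ring
  have h2 : ∀ i j, φ (b i) * Q.polarBilin z (b j) * Q.polarBilin (c i) (c j) =
      (if i < j then φ (b i) * Q.polarBilin z (b j) * Q.polarBilin (c i) (c j) else 0) +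
      (if j < i then φ (b i) * Q.polarBilin z (b j) * Q.polarBilin (c j) (c i) else 0) := by
    intro i j
    rcases lt_trichotomy i j with h | h | h
    · simp [h, h.not_gt]
    · subst h
      rw [polarBilin_self]
      simp
    · rw [if_neg h.not_gt, if_pos h, polarBilin_comm (c i)]
      ring
  have h3 : ∑ i, ∑ j, (if j < i then φ (b i) * Q.polarBilin z (b j) *
      Q.polarBilin (c j) (c i) else 0) = ∑ i, ∑ j, (if i < j then φ (b j) * Q.polarBilin z (b i) *
      Q.polarBilin (c i) (c j) else 0) := Finset.sum_comm
  rw [h1, Finset.sum_congr rfl fun i _ => Finset.sum_congr rfl fun j _ => h2 i j]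
  simp only [Finset.sum_add_distrib]
  rw [h3, bivectorPairing]
  simp only [← Finset.sum_add_distrib]
  refine Finset.sum_congr rfl fun i _ => Finset.sum_congr rfl fun j _ => ?_
  split_ifs <;> ring

/-- An alternating form is a sum of decomposable ones. -/
theorem alternating_eq_sum_wedge (hQ : Q.polarBilin.Nondegenerate) (α : LinearMap.BilinForm F V)
    (hα : ∀ x, α x x = 0) (u v : V) :
    α u v = ∑ k, ∑ l, (if k < l then α (Module.finBasis F V k) (Module.finBasis F V l) else 0) *
      (Q.polarBilin (polarDualBasis hQ k) u * Q.polarBilin (polarDualBasis hQ l) v +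
        Q.polarBilin (polarDualBasis hQ k) v * Q.polarBilin (polarDualBasis hQ l) u) := by
  set b := Module.finBasis F V
  set c := polarDualBasis hQ
  have hsymm : ∀ x y, α x y = α y x := by
    intro x y
    have h := hα (x + y)
    simp only [map_add, LinearMap.add_apply, hα] at h
    linear_combination h - α y x * two_eq_zero_of_charP_two F
  have h1 : α u v = ∑ k, ∑ l, Q.polarBilin (c k) u * Q.polarBilin (c l) v * α (b k) (b l) := by
    conv_lhs => rw [← sum_polarBilin_smul_finBasis hQ u, ← sum_polarBilin_smul_finBasis hQ v]
    simp only [map_sum, LinearMap.sum_apply, map_smul, LinearMap.smul_apply, smul_eq_mul,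
      Finset.mul_sum]
    rw [Finset.sum_comm]
    refine Finset.sum_congr rfl fun i _ => Finset.sum_congr rfl fun j _ => ?_
    ring
  have h2 : ∀ k l, Q.polarBilin (c k) u * Q.polarBilin (c l) v * α (b k) (b l) =
      (if k < l then α (b k) (b l) else 0) * (Q.polarBilin (c k) u * Q.polarBilin (c l) v) +
      (if l < k then α (b l) (b k) else 0) * (Q.polarBilin (c k) u * Q.polarBilin (c l) v) := by
    intro i j
    rcases lt_trichotomy i j with h | h | h
    · simp [h, h.not_gt]
      ring
    · subst h
      simp [hα]
    · rw [if_neg h.not_gt, if_pos h, hsymm (b i)]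
      ring
  have h3 : ∑ k, ∑ l, (if l < k then α (b l) (b k) else 0) *
      (Q.polarBilin (c k) u * Q.polarBilin (c l) v) = ∑ k, ∑ l, (if k < l then α (b k) (b l) else 0) *
      (Q.polarBilin (c l) u * Q.polarBilin (c k) v) := Finset.sum_comm
  rw [h1]
  simp only [h2, Finset.sum_add_distrib]
  rw [h3]
  simp only [← Finset.sum_add_distrib]
  refine Finset.sum_congr rfl fun i _ => Finset.sum_congr rfl fun j _ => ?_
  ring

/-- By `alternating_eq_sum_wedge` it suffices to treat wedges of two functionals `Q.polarBilin z`.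
On these the pairing is the polar form of the two representing vectors, which isometries preserve.
-/
theorem bivectorPairing_comp_isometry (hQ : Q.polarBilin.Nondegenerate)
    (α : LinearMap.BilinForm F V) (hα : ∀ x, α x x = 0) (g : isometryGroup Q) :
    bivectorPairing hQ (fun u v => α (g.1 u) (g.1 v)) = bivectorPairing hQ (fun u v => α u v) := by
  have key : ∀ h : isometryGroup Q, bivectorPairing hQ (fun u v => α (h.1 u) (h.1 v)) =
      ∑ k, ∑ l, (if k < l then α (Module.finBasis F V k) (Module.finBasis F V l) else 0) *
        Q.polarBilin (polarDualBasis hQ k) (polarDualBasis hQ l) := by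
    intro h
    have h1 : ∀ x y, Q.polarBilin x (h.1 y) = Q.polarBilin ((h⁻¹).1 x) y := by
      intro x y
      rw [← isometry_polarBilin h ((h⁻¹).1 x), isometry_inv_apply]
    have h2 := fun u v => alternating_eq_sum_wedge hQ α hα (h.1 u) (h.1 v)
    simp only [h2, bivectorPairing_sum, bivectorPairing_mul_left, h1, bivectorPairing_wedge]
    refine Finset.sum_congr rfl fun i _ => Finset.sum_congr rfl fun j _ => ?_
    rw [isometry_polarBilin]
  rw [key g, ← key 1]
  rfl

/-- A bilinear form with associated quadratic form `Q`. -/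
noncomputable def halfPolar (Q : QuadraticForm F V) : LinearMap.BilinForm F V :=
  (LinearMap.BilinMap.toQuadraticMap_surjective Q).choose

theorem halfPolar_self (x : V) : halfPolar Q x x = Q x :=
  DFunLike.congr_fun (LinearMap.BilinMap.toQuadraticMap_surjective Q).choose_spec x

theorem halfPolar_add_swap (x y : V) : halfPolar Q x y = halfPolar Q y x + Q.polarBilin x y := by
  have h := quadraticForm_add (Q := Q) x y
  simp only [← halfPolar_self, map_add, LinearMap.add_apply] at h
  linear_combination h - halfPolar Q y x * two_eq_zero_of_charP_two F

/-- The change of `halfPolar Q` under an isometry, an alternating form. -/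
noncomputable def halfPolarDefect (g : isometryGroup Q) : LinearMap.BilinForm F V :=
  (halfPolar Q).compl₁₂ (g.1 : V →ₗ[F] V) (g.1 : V →ₗ[F] V) + halfPolar Q

theorem halfPolarDefect_apply (g : isometryGroup Q) (u v : V) :
    halfPolarDefect g u v = halfPolar Q (g.1 u) (g.1 v) + halfPolar Q u v := rfl

theorem halfPolarDefect_self (g : isometryGroup Q) (u : V) : halfPolarDefect g u u = 0 := by
  rw [halfPolarDefect_apply, halfPolar_self, halfPolar_self, g.2, CharTwo.add_self_eq_zero]

/-- The Dickson invariant. -/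
noncomputable def dickson (hQ : Q.polarBilin.Nondegenerate) (g : isometryGroup Q) : F :=
  bivectorPairing hQ fun u v => halfPolarDefect g u v

/-- The defect of `g * h` is the defect of `g` pulled back along `h` plus the defect of `h`, since
the middle term occurs twice. Invariance of the pairing removes the pullback. -/
theorem dickson_mul (hQ : Q.polarBilin.Nondegenerate) (g h : isometryGroup Q) :
    dickson hQ (g * h) = dickson hQ g + dickson hQ h := by
  rw [dickson, dickson, dickson,
    ← bivectorPairing_comp_isometry hQ (halfPolarDefect g) (halfPolarDefect_self g) h,
    ← bivectorPairing_add]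
  congr 1
  funext u v
  simp only [halfPolarDefect_apply, isometry_mul_apply]
  linear_combination - halfPolar Q (h.1 u) (h.1 v) * two_eq_zero_of_charP_two F

theorem dickson_one (hQ : Q.polarBilin.Nondegenerate) :
    dickson hQ (1 : isometryGroup Q) = 0 := by
  have h := dickson_mul hQ (1 : isometryGroup Q) 1
  rw [one_mul] at h
  exact left_eq_add.1 h

theorem dickson_inv (hQ : Q.polarBilin.Nondegenerate) (g : isometryGroup Q) :
    dickson hQ g⁻¹ = dickson hQ g := by
  have h := dickson_mul hQ g⁻¹ g
  rw [inv_mul_cancel, dickson_one] at h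
  linear_combination - h - dickson hQ g * two_eq_zero_of_charP_two F

/-- The defect is `(Q a)⁻¹` times the wedge of `halfPolar Q · a` with `Q.polarBilin a`, so it pairs
to `(Q a)⁻¹ * halfPolar Q a a`. -/
theorem dickson_reflIsom (hQ : Q.polarBilin.Nondegenerate) (a : V) (ha : Q a ≠ 0) :
    dickson hQ (reflIsom a ha) = 1 := by
  have h := bivectorPairing_wedge hQ ((halfPolar Q).flip a) a
  replace h := h.trans (halfPolar_self a)
  rw [dickson, ← inv_mul_cancel₀ ha]
  conv_rhs => arg 2; rw [← h]
  rw [← bivectorPairing_mul_left]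
  congr 1
  funext u v
  have h2 := halfPolar_add_swap (Q := Q) a v
  have h3 : ∀ z, (halfPolar Q).flip a z = halfPolar Q z a := fun _ => rfl
  simp only [halfPolarDefect_apply, reflIsom_apply, map_add, map_smul, LinearMap.add_apply,
    LinearMap.smul_apply, smul_eq_mul, h3, halfPolar_self, h2]
  field_simp
  linear_combination (Q.polarBilin a u * Q.polarBilin a v +
    halfPolar Q u v * Q a ) * two_eq_zero_of_charP_two F

/-- The defect is a sum of three wedges. Two of them pair to `halfPolar Q y x` and `halfPolar Q x
y`, which agree and so cancel, and the third pairs to a multiple of `Q.polarBilin x y = 0`. -/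
theorem dickson_siegel (hQ : Q.polarBilin.Nondegenerate) {x y : V} (hx : Q x = 0) (hy : Q y = 0)
    (hxy : Q.polarBilin x y = 0) : dickson hQ (siegel x y hx hy hxy) = 0 := by
  have h1 := bivectorPairing_wedge hQ ((halfPolar Q).flip x) y
  have h2 := bivectorPairing_wedge hQ ((halfPolar Q).flip y) x
  have h3 := bivectorPairing_wedge hQ (Q.polarBilin x) y
  have h4 := halfPolar_add_swap (Q := Q) y x
  rw [polarBilin_comm, hxy, add_zero] at h4
  -- Naming the coefficient `m` shields it from the rewriting of `halfPolar Q x y` into a pairing.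
  have h5 : ∀ m, m = halfPolar Q x y → dickson hQ (siegel x y hx hy hxy) =
      halfPolar Q y x + halfPolar Q x y + (1 + m) * Q.polarBilin x y := by
    intro m hm
    rw [← h3, show halfPolar Q y x = _ from h1.symm, show halfPolar Q x y = _ from h2.symm,
      ← bivectorPairing_mul_left, dickson, ← bivectorPairing_add, ← bivectorPairing_add]
    congr 1
    funext u v
    have h6 := halfPolar_add_swap (Q := Q) x v
    have h7 := halfPolar_add_swap (Q := Q) y v
    have h8 : ∀ w z, (halfPolar Q).flip w z = halfPolar Q z w := fun _ _ => rfl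
    simp only [halfPolarDefect_apply, siegel_apply, map_add, map_smul, LinearMap.add_apply,
      LinearMap.smul_apply, smul_eq_mul, h8, halfPolar_self, hx, hy, h4, h6, h7,
      hm]
    linear_combination (halfPolar Q u v) * two_eq_zero_of_charP_two F
  rw [h5 _ rfl, h4, hxy, mul_zero, add_zero, CharTwo.add_self_eq_zero]

end Dickson

/-! ### The Dickson invariant is the parity of the residual rank -/

section ResidualRank

variable {F V : Type*} [Field F] [CharP F 2] [AddCommGroup V] [Module F V] [FiniteDimensional F V]
  {Q : QuadraticForm F V}

theorem quadraticForm_isometry_sub (g : isometryGroup Q) (u : V) :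
    Q (g.1 u - u) = Q.polarBilin (g.1 u) u := by
  rw [module_sub_eq_add F, quadraticForm_add, g.2]
  linear_combination Q u * two_eq_zero_of_charP_two F

/-- Multiplying by a suitable reflection lowers the residual rank by one. -/
theorem residualRank_reflIsom_mul (g : isometryGroup Q) (u a : V) (ha : Q a ≠ 0)
    (ha' : a = g.1 u - u) : residualRank (reflIsom a ha * g) + 1 = residualRank g := by
  have hgu : g.1 u = u + a := by rw [ha']; abel
  have h1 : Q.polarBilin a (g.1 u) = Q a := by
    have h2 := quadraticForm_isometry_sub g u
    rw [← ha'] at h2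
    rw [h2, ha', map_sub, LinearMap.sub_apply, polarBilin_self, zero_sub, polarBilin_comm u]
    exact CharTwo.neg_eq _
  have hu : (reflIsom a ha * g).1 u = u := by
    rw [isometry_mul_apply, reflIsom_apply, h1, inv_mul_cancel₀ ha, one_smul, hgu, add_assoc,
      module_add_self F, add_zero]
  have hfix : fixedSpace (reflIsom a ha * g) = fixedSpace g ⊔ Submodule.span F {u} := by
    apply le_antisymm
    · intro v hv
      rw [mem_fixedSpace] at hv
      have h3 : g.1 v = (reflIsom a ha).1 v := by
        conv_rhs => rw [← hv]
        rw [isometry_mul_apply, ← isometry_mul_apply (reflIsom a ha), reflIsom_mul_self]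
        rfl
      -- Here `g v = v + c • a` and `g u = u + a`, so `v - c • u` is fixed by `g`: the fixed space
      -- grows by the line of `u` only.
      set c := (Q a)⁻¹ * Q.polarBilin a v with hc
      have h4 : v - c • u ∈ fixedSpace g := by
        rw [mem_fixedSpace, map_sub, map_smul, h3, reflIsom_apply, hgu, ← hc, smul_add]
        abel
      rw [← sub_add_cancel v (c • u)]
      exact Submodule.add_mem_sup h4 (Submodule.smul_mem _ _ (Submodule.mem_span_singleton_self u))
    · refine sup_le (fun v hv => ?_) ((Submodule.span_singleton_le_iff_mem _ _).2
        (mem_fixedSpace.2 hu))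
      rw [mem_fixedSpace] at hv ⊢
      rw [isometry_mul_apply, hv]
      exact reflIsom_apply_of_orthogonal ha (ha' ▸ polarBilin_sub_eq_zero_of_fixed hv u)
  have hnot : u ∉ fixedSpace g := by
    rw [mem_fixedSpace]
    intro h
    apply ha
    rw [ha', h, sub_self, QuadraticMap.map_zero]
  have h5 := residualRank_add_finrank_fixedSpace (reflIsom a ha * g)
  have h6 := residualRank_add_finrank_fixedSpace g
  rw [hfix, finrank_sup_span_singleton_of_notMem hnot] at h5
  omega

/-- If the image of `g - 1` is totally singular and `g ≠ 1`, multiplying by a suitable Siegel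
transformation lowers the residual rank by two. -/
theorem exists_residualRank_siegel_mul (hQ : Q.polarBilin.Nondegenerate) (g : isometryGroup Q)
    (hg : g ≠ 1) (hs : ∀ u, Q (g.1 u - u) = 0) :
    ∃ (x y : V) (hx : Q x = 0) (hy : Q y = 0) (hxy : Q.polarBilin x y = 0),
      residualRank (siegel x y hx hy hxy * g) + 2 = residualRank g := by
  obtain ⟨u, hu⟩ : ∃ u, g.1 u ≠ u := by
    by_contra! h
    exact hg (isometry_ext h)
  obtain ⟨v', hv'⟩ := exists_polarBilin_ne_zero hQ (sub_ne_zero.2 hu)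
  obtain ⟨v, huv⟩ : ∃ v, Q.polarBilin (g.1 u - u) v = 1 := ⟨(Q.polarBilin (g.1 u - u) v')⁻¹ • v', by
    rw [map_smul, smul_eq_mul, inv_mul_cancel₀ hv']⟩
  -- Polarizing the hypothesis that the image of `g - 1` is totally singular.
  have hxy : Q.polarBilin (g.1 u - u) (g.1 v - v) = 0 := by
    have h := hs (u + v)
    rw [map_add, add_sub_add_comm, quadraticForm_add, hs, hs] at h
    simpa using h
  have e1 : Q.polarBilin (g.1 u) u = 0 := by rw [← quadraticForm_isometry_sub, hs]
  have e2 : Q.polarBilin (g.1 v) v = 0 := by rw [← quadraticForm_isometry_sub, hs]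
  have e3 : Q.polarBilin u (g.1 u) = 0 := by rw [polarBilin_comm, e1]
  have e4 : Q.polarBilin v (g.1 v) = 0 := by rw [polarBilin_comm, e2]
  have hyu : Q.polarBilin (g.1 v - v) u = 1 := by
    have h2 := isometry_polarBilin g u v
    simp only [map_sub, LinearMap.sub_apply] at hxy huv ⊢
    rw [polarBilin_comm _ u, polarBilin_comm _ u]
    linear_combination (-hxy) + h2 - huv - two_eq_zero_of_charP_two F
  have hgu : g.1 u = u + (g.1 u - u) := by abel
  have hgv : g.1 v = v + (g.1 v - v) := by abel
  refine ⟨g.1 u - u, g.1 v - v, hs u, hs v, hxy, ?_⟩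
  set x := g.1 u - u with hx'
  set y := g.1 v - v with hy'
  set s := siegel x y (hs u) (hs v) hxy with hs'
  have hyx : Q.polarBilin y x = 0 := by rw [polarBilin_comm, hxy]
  have hxu : Q.polarBilin x u = 0 := by
    rw [hx', map_sub, LinearMap.sub_apply, e1, polarBilin_self, sub_zero]
  have hyv : Q.polarBilin y v = 0 := by
    rw [hy', map_sub, LinearMap.sub_apply, e2, polarBilin_self, sub_zero]
  -- The products are now `B(x, v) = B(y, u) = 1` and `B(x, u) = B(y, v) = 0`, so `s` cancels the
  -- displacements of both `u` and `v`.
  have su : (s * g).1 u = u := by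
    rw [isometry_mul_apply, hgu, siegel_apply, map_add, map_add, hxu, hyu, polarBilin_self, hyx]
    simp only [add_zero, zero_smul, one_smul, add_assoc, module_add_self F]
  have sv : (s * g).1 v = v := by
    rw [isometry_mul_apply, hgv, siegel_apply, map_add, map_add, huv, hyv, polarBilin_self, hxy]
    simp only [add_zero, zero_smul, one_smul, add_assoc, module_add_self F]
  have hfix : fixedSpace (s * g) =
      fixedSpace g ⊔ Submodule.span F {u} ⊔ Submodule.span F {v} := by
    apply le_antisymm
    · intro w hw
      rw [mem_fixedSpace] at hw
      have h3 : g.1 w = s.1 w := by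
        conv_rhs => rw [← hw]
        rw [isometry_mul_apply, ← isometry_mul_apply s s, hs', siegel_mul_self]
        rfl
      have h4 : w - Q.polarBilin x w • v - Q.polarBilin y w • u ∈ fixedSpace g := by
        rw [mem_fixedSpace, map_sub, map_sub, map_smul, map_smul, h3, siegel_apply, hgu, hgv,
          smul_add, smul_add]
        abel
      have h5 : w = (w - Q.polarBilin x w • v - Q.polarBilin y w • u) + Q.polarBilin y w • u +
        Q.polarBilin x w • v := by abel
      rw [h5]
      exact Submodule.add_mem_sup (Submodule.add_mem_sup h4
        (Submodule.smul_mem _ _ (Submodule.mem_span_singleton_self u)))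
        (Submodule.smul_mem _ _ (Submodule.mem_span_singleton_self v))
    · refine sup_le (sup_le (fun w hw => ?_) ((Submodule.span_singleton_le_iff_mem _ _).2
        (mem_fixedSpace.2 su))) ((Submodule.span_singleton_le_iff_mem _ _).2
        (mem_fixedSpace.2 sv))
      rw [mem_fixedSpace] at hw ⊢
      rw [isometry_mul_apply, hw, siegel_apply, polarBilin_sub_eq_zero_of_fixed hw u,
        polarBilin_sub_eq_zero_of_fixed hw v]
      simp
  have hnot : u ∉ fixedSpace g := by
    rwa [mem_fixedSpace]
  have hnot2 : v ∉ fixedSpace g ⊔ Submodule.span F {u} := by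
    intro h
    obtain ⟨w, hw, z, hz, hwz⟩ := Submodule.mem_sup.1 h
    obtain ⟨c, rfl⟩ := Submodule.mem_span_singleton.1 hz
    rw [mem_fixedSpace] at hw
    rw [← hwz, map_add, map_smul, hxu, polarBilin_sub_eq_zero_of_fixed hw u] at huv
    simp at huv
  have h5 := residualRank_add_finrank_fixedSpace (s * g)
  have h6 := residualRank_add_finrank_fixedSpace g
  rw [hfix, finrank_sup_span_singleton_of_notMem hnot2,
    finrank_sup_span_singleton_of_notMem hnot] at h5
  omega

/-- The Dickson invariant is the parity of the residual rank. -/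
theorem dickson_eq_residualRank (hQ : Q.polarBilin.Nondegenerate) (g : isometryGroup Q) :
    dickson hQ g = residualRank g := by
  induction hn : residualRank g using Nat.strong_induction_on generalizing g with
  | _ n ih =>
    by_cases hs : ∀ u, Q (g.1 u - u) = 0
    · by_cases hg : g = 1
      · subst hg
        rw [dickson_one, ← hn]
        have : residualRank (1 : isometryGroup Q) = 0 := by
          have h : (((1 : isometryGroup Q) : V ≃ₗ[F] V) : V →ₗ[F] V) - LinearMap.id = 0 :=
            sub_self _
          rw [residualRank, h, LinearMap.range_zero, finrank_bot]
        rw [this, Nat.cast_zero]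
      · obtain ⟨x, y, hx, hy, hxy, h⟩ := exists_residualRank_siegel_mul hQ g hg hs
        have h2 := ih _ (by omega) (siegel x y hx hy hxy * g) rfl
        rw [dickson_mul, dickson_siegel, zero_add] at h2
        rw [h2, ← hn, ← h]
        push_cast
        linear_combination - two_eq_zero_of_charP_two F
    · push Not at hs
      obtain ⟨u, hu⟩ := hs
      have h := residualRank_reflIsom_mul g u _ hu rfl
      have h2 := ih _ (by omega) (reflIsom _ hu * g) rfl
      rw [dickson_mul, dickson_reflIsom] at h2
      rw [← hn, ← h]
      push_cast
      linear_combination h2 - two_eq_zero_of_charP_two F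

theorem dickson_eq_zero_iff (hQ : Q.polarBilin.Nondegenerate) (g : isometryGroup Q) :
    dickson hQ g = 0 ↔ Even (residualRank g) := by
  rw [dickson_eq_residualRank, CharP.cast_eq_zero_iff F 2, even_iff_two_dvd]

theorem dickson_eq_zero_or_one (hQ : Q.polarBilin.Nondegenerate) (g : isometryGroup Q) :
    dickson hQ g = 0 ∨ dickson hQ g = 1 := by
  rcases Nat.even_or_odd (residualRank g) with h | h
  · exact Or.inl ((dickson_eq_zero_iff hQ g).2 h)
  · right
    obtain ⟨k, hk⟩ := h
    rw [dickson_eq_residualRank, hk]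
    push_cast
    rw [CharTwo.two_eq_zero, zero_mul, zero_add]

theorem mem_omegaGroup_iff_dickson (hQ : Q.polarBilin.Nondegenerate) (g : isometryGroup Q) :
    g ∈ omegaGroup Q ↔ dickson hQ g = 0 := by
  refine ⟨fun h => ?_, fun h => Subgroup.subset_closure ((dickson_eq_zero_iff hQ g).1 h)⟩
  induction h using Subgroup.closure_induction with
  | mem x hx => exact (dickson_eq_zero_iff hQ x).2 hx
  | one => exact dickson_one hQ
  | mul x y _ _ hx hy => rw [dickson_mul, hx, hy, add_zero]
  | inv x _ hx => rw [dickson_inv, hx]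

theorem mem_omegaGroup_iff (hQ : Q.polarBilin.Nondegenerate) (g : isometryGroup Q) :
    g ∈ omegaGroup Q ↔ Even (residualRank g) := by
  rw [mem_omegaGroup_iff_dickson hQ, dickson_eq_zero_iff]

theorem reflIsom_mul_reflIsom_mem_omegaGroup (hQ : Q.polarBilin.Nondegenerate) {a b : V}
    (ha : Q a ≠ 0) (hb : Q b ≠ 0) : reflIsom a ha * reflIsom b hb ∈ omegaGroup Q := by
  rw [mem_omegaGroup_iff_dickson hQ, dickson_mul, dickson_reflIsom, dickson_reflIsom,
    CharTwo.add_self_eq_zero]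

theorem reflIsom_notMem_omegaGroup (hQ : Q.polarBilin.Nondegenerate) {a : V} (ha : Q a ≠ 0) :
    reflIsom a ha ∉ omegaGroup Q := by
  rw [mem_omegaGroup_iff_dickson hQ, dickson_reflIsom]
  exact one_ne_zero

theorem siegel_mem_omegaGroup (hQ : Q.polarBilin.Nondegenerate) {x y : V} (hx : Q x = 0)
    (hy : Q y = 0) (hxy : Q.polarBilin x y = 0) : siegel x y hx hy hxy ∈ omegaGroup Q := by
  rw [mem_omegaGroup_iff_dickson hQ, dickson_siegel]

theorem mul_mem_omegaGroup_of_notMem (hQ : Q.polarBilin.Nondegenerate) {g h : isometryGroup Q}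
    (hg : g ∉ omegaGroup Q) (hh : h ∉ omegaGroup Q) : g * h ∈ omegaGroup Q := by
  rw [mem_omegaGroup_iff_dickson hQ] at hg hh ⊢
  rw [dickson_mul, (dickson_eq_zero_or_one hQ g).resolve_left hg,
    (dickson_eq_zero_or_one hQ h).resolve_left hh, CharTwo.add_self_eq_zero]

/-- An element of `Ω` fixing a hyperplane pointwise is trivial. -/
theorem eq_one_of_mem_omegaGroup_of_finrank_fixedSpace (hQ : Q.polarBilin.Nondegenerate)
    {g : isometryGroup Q} (hg : g ∈ omegaGroup Q)
    (h : Module.finrank F V ≤ Module.finrank F (fixedSpace g) + 1) : g = 1 := by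
  rw [mem_omegaGroup_iff hQ] at hg
  have h6 := residualRank_add_finrank_fixedSpace g
  obtain ⟨k, hk⟩ := hg
  exact eq_one_of_residualRank_eq_zero (by omega)

end ResidualRank

/-! ### Irredundant sequences and a criterion for failing to be IBIS -/

section IrredundantSequences

variable {α : Type*} {G : Subgroup (Equiv.Perm α)}

/-- No point of the sequence is fixed by the pointwise stabilizer of its predecessors. -/
def IsIrredundant (G : Subgroup (Equiv.Perm α)) (l : List α) : Prop :=
  ∀ (i : ℕ) (hi : i < l.length), ∃ g ∈ pointwiseStabilizer G (l.take i), g l[i] ≠ l[i]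

theorem mem_pointwiseStabilizer {l : List α} {g : Equiv.Perm α} :
    g ∈ pointwiseStabilizer G l ↔ g ∈ G ∧ ∀ x ∈ l, g x = x := Iff.rfl

theorem mem_pointwiseStabilizer_append_singleton {l : List α} {x : α} {g : Equiv.Perm α} :
    g ∈ pointwiseStabilizer G (l ++ [x]) ↔ g ∈ pointwiseStabilizer G l ∧ g x = x := by
  simp only [mem_pointwiseStabilizer, List.mem_append, List.mem_singleton]
  constructor
  · rintro ⟨h1, h2⟩
    exact ⟨⟨h1, fun y hy => h2 y (Or.inl hy)⟩, h2 x (Or.inr rfl)⟩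
  · rintro ⟨⟨h1, h2⟩, h3⟩
    refine ⟨h1, fun y hy => ?_⟩
    rcases hy with hy | rfl
    · exact h2 y hy
    · exact h3

theorem isIrredundant_nil : IsIrredundant G [] := fun i hi => absurd hi (Nat.not_lt_zero i)

theorem IsIrredundant.append_singleton {l : List α} (hl : IsIrredundant G l) {x : α}
    (hx : ∃ g ∈ pointwiseStabilizer G l, g x ≠ x) : IsIrredundant G (l ++ [x]) := by
  intro i hi
  rw [List.length_append, List.length_singleton] at hi
  rcases Nat.lt_succ_iff_lt_or_eq.1 hi with h | rfl
  · rw [List.take_append_of_le_length h.le, List.getElem_append_left h]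
    exact hl i h
  · simpa using hx

theorem IsIrredundant.take {l : List α} (hl : IsIrredundant G l) (n : ℕ) :
    IsIrredundant G (l.take n) := by
  intro i hi
  rw [List.length_take] at hi
  have h := hl i (lt_of_lt_of_le hi (min_le_right _ _))
  rw [List.take_take, List.getElem_take, min_eq_left (hi.le.trans (min_le_left _ _))]
  exact h

theorem IsIrredundant.mono {H : Subgroup (Equiv.Perm α)} {l : List α} (hl : IsIrredundant H l)
    (h : H ≤ G) : IsIrredundant G l := by
  intro i hi
  obtain ⟨g, hg, hne⟩ := hl i hi
  exact ⟨g, ⟨h hg.1, hg.2⟩, hne⟩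

/-- Dropping each point already fixed by the stabilizer of its predecessors does not change the
stabilizer. -/
theorem exists_isIrredundantBase_length_le {l : List α} (hl : pointwiseStabilizer G l = ⊥) :
    ∃ l', IsIrredundantBase G l' ∧ l'.length ≤ l.length := by
  have key : ∀ l : List α, ∃ l', IsIrredundant G l' ∧
      pointwiseStabilizer G l' = pointwiseStabilizer G l ∧ l'.length ≤ l.length := by
    intro l
    induction l using List.reverseRecOn with
    | nil => exact ⟨[], isIrredundant_nil, rfl, le_rfl⟩
    | append_singleton l x ih =>
      obtain ⟨l', h1, h2, h3⟩ := ih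
      by_cases hx : ∃ g ∈ pointwiseStabilizer G l', g x ≠ x
      · refine ⟨l' ++ [x], h1.append_singleton hx, ?_, by simpa using h3⟩
        ext g
        rw [mem_pointwiseStabilizer_append_singleton, mem_pointwiseStabilizer_append_singleton, h2]
      · push Not at hx
        refine ⟨l', h1, ?_, by rw [List.length_append]; omega⟩
        ext g
        rw [mem_pointwiseStabilizer_append_singleton, ← h2]
        exact ⟨fun h => ⟨h, hx g h⟩, fun h => h.1⟩
  obtain ⟨l', h1, h2, h3⟩ := key l
  exact ⟨l', ⟨h2.trans hl, h1⟩, h3⟩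

/-- Appending moved points strictly shrinks the finite stabilizer until it is trivial. -/
theorem IsIrredundant.exists_isIrredundantBase [Finite α] {l : List α} (hl : IsIrredundant G l) :
    ∃ l', IsIrredundantBase G (l ++ l') := by
  induction hn : Nat.card (pointwiseStabilizer G l) using Nat.strong_induction_on generalizing l with
  | _ n ih =>
    by_cases h : pointwiseStabilizer G l = ⊥
    · exact ⟨[], by rw [List.append_nil]; exact ⟨h, hl⟩⟩
    · obtain ⟨g, hg, hg1⟩ := (Subgroup.bot_or_exists_ne_one _).resolve_left h
      obtain ⟨x, hx⟩ : ∃ x, g x ≠ x := by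
        by_contra! h
        exact hg1 (Equiv.ext h)
      have hlt : pointwiseStabilizer G (l ++ [x]) < pointwiseStabilizer G l := by
        refine lt_of_le_of_ne
          (fun k hk => (mem_pointwiseStabilizer_append_singleton.1 hk).1) fun e => hx ?_
        rw [← e] at hg
        exact (mem_pointwiseStabilizer_append_singleton.1 hg).2
      have hcard : Nat.card (pointwiseStabilizer G (l ++ [x])) < n := by
        rw [← hn]
        exact Set.Finite.card_lt_card (Set.toFinite _) hlt
      obtain ⟨l', h'⟩ := ih _ hcard (hl.append_singleton ⟨g, hg, hx⟩) rfl
      exact ⟨x :: l', by simpa using h'⟩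

/-- The first sequence thins out to an irredundant base of length at most `l.length`. The second
extends to one strictly longer than `l'`, because its stabilizer is not yet trivial. -/
theorem not_isIBIS_of_length_le [Finite α] {l l' : List α} (h : pointwiseStabilizer G l = ⊥)
    (h1 : IsIrredundant G l') (h2 : pointwiseStabilizer G l' ≠ ⊥) (hlen : l.length ≤ l'.length) :
    ¬ IsIBIS G := by
  intro hG
  obtain ⟨b, hb, hbl⟩ := exists_isIrredundantBase_length_le h
  obtain ⟨c, hc⟩ := h1.exists_isIrredundantBase
  have h3 := hG b _ hb hc
  rw [List.length_append] at h3
  have h4 : c = [] := List.length_eq_zero_iff.1 (by omega)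
  rw [h4, List.append_nil] at hc
  exact h2 hc.1

end IrredundantSequences

/-! ### Non-singular points as vectors of norm one -/

section NonsingularPoints

variable {F V : Type*} [Field F] [Finite F] [CharP F 2] [AddCommGroup V] [Module F V]
  {Q : QuadraticForm F V}

theorem exists_mul_self_eq (c : F) : ∃ a : F, a * a = c := by
  obtain ⟨a, ha⟩ := FiniteField.isSquare_of_char_two (ringChar.eq F 2) c
  exact ⟨a, ha.symm⟩

theorem exists_smul_quadraticForm_eq_one {v : V} (hv : Q v ≠ 0) : ∃ c : F, c ≠ 0 ∧ Q (c • v) = 1 := by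
  obtain ⟨a, ha⟩ := exists_mul_self_eq (Q v)⁻¹
  refine ⟨a, fun h => ?_, by rw [quadraticForm_smul, ha, inv_mul_cancel₀ hv]⟩
  rw [h, mul_zero] at ha
  exact inv_ne_zero hv ha.symm

theorem mul_self_eq_one_iff_charTwo {a : F} : a * a = 1 ↔ a = 1 := by
  rw [mul_self_eq_one_iff, CharTwo.neg_eq, or_self]

theorem exists_mem_quadraticForm_eq_one (p : NS₁ Q) : ∃ v ∈ p.1, Q v = 1 := by
  obtain ⟨v, hv, hQv⟩ := p.2.2
  obtain ⟨c, -, hc⟩ := exists_smul_quadraticForm_eq_one hQv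
  exact ⟨c • v, p.1.smul_mem c hv, hc⟩

/-- The vector `v` with `Q v = 1` in a non-singular point. -/
noncomputable def normVec (p : NS₁ Q) : V := (exists_mem_quadraticForm_eq_one p).choose

theorem normVec_mem (p : NS₁ Q) : normVec p ∈ p.1 :=
  (exists_mem_quadraticForm_eq_one p).choose_spec.1

@[simp]
theorem quadraticForm_normVec (p : NS₁ Q) : Q (normVec p) = 1 :=
  (exists_mem_quadraticForm_eq_one p).choose_spec.2

theorem quadraticForm_normVec_ne_zero (p : NS₁ Q) : Q (normVec p) ≠ 0 := by
  rw [quadraticForm_normVec]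
  exact one_ne_zero

theorem ne_zero_of_quadraticForm_ne_zero {v : V} (h : Q v ≠ 0) : v ≠ 0 := fun e =>
  h (by rw [e, QuadraticMap.map_zero])

theorem normVec_ne_zero (p : NS₁ Q) : normVec p ≠ 0 :=
  ne_zero_of_quadraticForm_ne_zero (quadraticForm_normVec_ne_zero p)

/-- The scalar relating two such vectors has square one, hence equals one in characteristic two.
This uniqueness turns stabilizers of points into fixers of vectors. -/
theorem eq_normVec {p : NS₁ Q} {v : V} (hv : v ∈ p.1) (h : Q v = 1) : v = normVec p := by
  obtain ⟨c, hc⟩ := exists_smul_eq_of_finrank_eq_one p.2.1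
    (x := ⟨normVec p, normVec_mem p⟩) (fun e => normVec_ne_zero p (congrArg Subtype.val e)) ⟨v, hv⟩
  have hc' : c • normVec p = v := congrArg Subtype.val hc
  rw [← hc', quadraticForm_smul, quadraticForm_normVec, mul_one, mul_self_eq_one_iff_charTwo] at h
  rw [← hc', h, one_smul]

theorem coe_eq_span_normVec (p : NS₁ Q) : p.1 = Submodule.span F {normVec p} := by
  have h : Module.finrank F (Submodule.span F {normVec p}) = 1 :=
    finrank_span_singleton (normVec_ne_zero p)
  have : FiniteDimensional F p.1 := Module.finite_of_finrank_eq_succ p.2.1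
  exact (Submodule.eq_of_le_of_finrank_eq ((Submodule.span_singleton_le_iff_mem _ _).2
    (normVec_mem p)) (h.trans p.2.1.symm)).symm

theorem normVec_injective : Function.Injective (normVec : NS₁ Q → V) := fun p p' h =>
  Subtype.ext (by rw [coe_eq_span_normVec p, h, ← coe_eq_span_normVec])

/-- The non-singular point spanned by a non-singular vector. -/
def nsPoint (v : V) (hv : Q v ≠ 0) : NS₁ Q :=
  ⟨Submodule.span F {v}, finrank_span_singleton (ne_zero_of_quadraticForm_ne_zero hv), v,
    Submodule.mem_span_singleton_self v, hv⟩

theorem normVec_nsPoint {v : V} (hv : Q v ≠ 0) (h : Q v = 1) : normVec (nsPoint v hv) = v :=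
  (eq_normVec (Submodule.mem_span_singleton_self v) h).symm

theorem exists_normVec_eq {v : V} (h : Q v = 1) : ∃ p : NS₁ Q, normVec p = v :=
  ⟨nsPoint v (h ▸ one_ne_zero), normVec_nsPoint _ h⟩

theorem exists_normVec_eq_smul {v : V} (h : Q v ≠ 0) :
    ∃ (p : NS₁ Q) (c : F), c ≠ 0 ∧ normVec p = c • v := by
  obtain ⟨c, hc, hQ⟩ := exists_smul_quadraticForm_eq_one h
  obtain ⟨p, hp⟩ := exists_normVec_eq hQ
  exact ⟨p, c, hc, hp⟩

instance [FiniteDimensional F V] : Finite (NS₁ Q) := by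
  have : Finite V := Module.finite_of_finite F
  exact Finite.of_injective _ normVec_injective

/-- The permutation of the non-singular points induced by an isometry. -/
abbrev nsPerm (Q : QuadraticForm F V) : isometryGroup Q →* Equiv.Perm (NS₁ Q) :=
  MulAction.toPermHom (isometryGroup Q) (NS₁ Q)

theorem normVec_nsPerm (g : isometryGroup Q) (p : NS₁ Q) :
    normVec (nsPerm Q g p) = g.1 (normVec p) :=
  (eq_normVec (Submodule.mem_map_of_mem (normVec_mem p))
    (by rw [g.2, quadraticForm_normVec])).symm

theorem nsPerm_apply_eq_iff {g : isometryGroup Q} {p p' : NS₁ Q} :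
    nsPerm Q g p = p' ↔ g.1 (normVec p) = normVec p' := by
  rw [← normVec_nsPerm, normVec_injective.eq_iff]

theorem nsPerm_apply_self_iff {g : isometryGroup Q} {p : NS₁ Q} :
    nsPerm Q g p = p ↔ normVec p ∈ fixedSpace g := by
  rw [nsPerm_apply_eq_iff, mem_fixedSpace]

theorem mem_omegaPerm {g : Equiv.Perm (NS₁ Q)} :
    g ∈ omegaPerm Q ↔ ∃ h ∈ omegaGroup Q, nsPerm Q h = g := Subgroup.mem_map

/-- The span of a sequence of non-singular points. -/
def nsSpan (l : List (NS₁ Q)) : Submodule F V := Submodule.span F {v | ∃ p ∈ l, normVec p = v}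

theorem normVec_mem_nsSpan {l : List (NS₁ Q)} {p : NS₁ Q} (hp : p ∈ l) : normVec p ∈ nsSpan l :=
  Submodule.subset_span ⟨p, hp, rfl⟩

theorem nsSpan_le_iff {l : List (NS₁ Q)} {W : Submodule F V} :
    nsSpan l ≤ W ↔ ∀ p ∈ l, normVec p ∈ W := by
  rw [nsSpan, Submodule.span_le]
  constructor
  · exact fun h p hp => h ⟨p, hp, rfl⟩
  · rintro h v ⟨p, hp, rfl⟩
    exact h p hp

@[simp]
theorem nsSpan_nil : nsSpan ([] : List (NS₁ Q)) = ⊥ :=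
  le_bot_iff.1 (nsSpan_le_iff.2 fun p hp => by simp at hp)

theorem nsSpan_append_singleton (l : List (NS₁ Q)) (p : NS₁ Q) :
    nsSpan (l ++ [p]) = nsSpan l ⊔ Submodule.span F {normVec p} := by
  apply le_antisymm
  · rw [nsSpan_le_iff]
    intro x hx
    rcases List.mem_append.1 hx with hx | hx
    · exact Submodule.mem_sup_left (normVec_mem_nsSpan hx)
    · rw [List.mem_singleton.1 hx]
      exact Submodule.mem_sup_right (Submodule.mem_span_singleton_self _)
  · refine sup_le (nsSpan_le_iff.2 fun x hx => normVec_mem_nsSpan (List.mem_append_left _ hx)) ?_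
    rw [Submodule.span_singleton_le_iff_mem]
    exact normVec_mem_nsSpan (by simp)

theorem finrank_nsSpan_append_singleton [FiniteDimensional F V] {l : List (NS₁ Q)} {p : NS₁ Q}
    (h : normVec p ∉ nsSpan l) :
    Module.finrank F (nsSpan (l ++ [p])) = Module.finrank F (nsSpan l) + 1 := by
  rw [nsSpan_append_singleton, finrank_sup_span_singleton_of_notMem h]

theorem nsPerm_fixes_iff {g : isometryGroup Q} {l : List (NS₁ Q)} :
    (∀ p ∈ l, nsPerm Q g p = p) ↔ nsSpan l ≤ fixedSpace g := by
  rw [nsSpan_le_iff]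
  exact forall₂_congr fun p _ => nsPerm_apply_self_iff

theorem mem_pointwiseStabilizer_omegaPerm {l : List (NS₁ Q)} {g : Equiv.Perm (NS₁ Q)} :
    g ∈ pointwiseStabilizer (omegaPerm Q) l ↔
      ∃ h ∈ omegaGroup Q, nsSpan l ≤ fixedSpace h ∧ nsPerm Q h = g := by
  rw [mem_pointwiseStabilizer, mem_omegaPerm]
  constructor
  · rintro ⟨⟨h, hh, rfl⟩, h2⟩
    exact ⟨h, hh, nsPerm_fixes_iff.1 h2, rfl⟩
  · rintro ⟨h, hh, h2, rfl⟩
    exact ⟨⟨h, hh, rfl⟩, nsPerm_fixes_iff.2 h2⟩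

end NonsingularPoints

/-! ### Non-singular vectors span, and the action is faithful -/

section NonsingularSpan

variable {F V : Type*} [Field F] [AddCommGroup V] [Module F V] [FiniteDimensional F V]
  {Q : QuadraticForm F V}

theorem exists_hyperplane_of_lt {W K : Submodule F V} (h : W < K) :
    ∃ H, W ≤ H ∧ H < K ∧ Module.finrank F H + 1 = Module.finrank F K := by
  obtain ⟨x, hxK, hxW⟩ := SetLike.exists_of_lt h
  obtain ⟨f, hfx, hf⟩ := Submodule.exists_le_ker_of_notMem hxW
  have hx : x ∉ K ⊓ LinearMap.ker f := fun hx => hfx hx.2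
  have hK : K ⊓ LinearMap.ker f ⊔ Submodule.span F {x} = K := by
    apply le_antisymm (sup_le inf_le_left ((Submodule.span_singleton_le_iff_mem _ _).2 hxK))
    intro y hy
    rw [← sub_add_cancel y ((f y / f x) • x)]
    refine Submodule.add_mem_sup ⟨K.sub_mem hy (K.smul_mem _ hxK), ?_⟩
      (Submodule.smul_mem _ _ (Submodule.mem_span_singleton_self x))
    change f _ = 0
    rw [map_sub, map_smul, smul_eq_mul, div_mul_cancel₀ _ hfx, sub_self]
  refine ⟨K ⊓ LinearMap.ker f, le_inf h.le hf, lt_of_le_of_ne inf_le_left fun e => ?_, ?_⟩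
  · exact hx (by rw [e]; exact hxK)
  · rw [← finrank_sup_span_singleton_of_notMem hx, hK]

variable [CharP F 2]

/-- The vector `x + y` also lies outside `W`, so both `x` and `x + y` are singular. Thus `Q` is
additive on `W`. -/
theorem quadraticForm_eq_polarBilin_of_singular_outside {W K : Submodule F V} (hWK : W ≤ K)
    (h : ∀ x ∈ K, x ∉ W → Q x = 0) {x : V} (hx : x ∈ K) (hxW : x ∉ W) {y : V} (hy : y ∈ W) :
    Q y = Q.polarBilin x y := by
  have h1 := h (x + y) (K.add_mem hx (hWK hy)) fun h2 => hxW (by simpa using W.sub_mem h2 hy)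
  rw [quadraticForm_add, h x hx hxW, zero_add] at h1
  linear_combination h1 - Q.polarBilin x y * two_eq_zero_of_charP_two F

/-- If all non-singular vectors of `K` lie in the proper subspace `W`, then `W` is totally
isotropic for the polar form. -/
theorem polarBilin_eq_zero_of_singular_outside {W K : Submodule F V} (hWK : W < K)
    (h : ∀ x ∈ K, x ∉ W → Q x = 0) {y z : V} (hy : y ∈ W) (hz : z ∈ W) :
    Q.polarBilin y z = 0 := by
  obtain ⟨x, hxK, hxW⟩ := SetLike.exists_of_lt hWK
  have h1 := quadraticForm_add (Q := Q) y z
  rw [quadraticForm_eq_polarBilin_of_singular_outside hWK.le h hxK hxW hy,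
    quadraticForm_eq_polarBilin_of_singular_outside hWK.le h hxK hxW hz,
    quadraticForm_eq_polarBilin_of_singular_outside hWK.le h hxK hxW (W.add_mem hy hz),
    map_add] at h1
  exact left_eq_add.1 h1

theorem two_mul_finrank_le_of_isotropic (hQ : Q.polarBilin.Nondegenerate) {W : Submodule F V}
    (h : ∀ y ∈ W, ∀ z ∈ W, Q.polarBilin y z = 0) :
    2 * Module.finrank F W ≤ Module.finrank F V := by
  have h1 : W ≤ LinearMap.BilinForm.orthogonal Q.polarBilin W := fun z hz =>
    mem_orthogonal_polarBilin.2 fun y hy => h y hy z hz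
  have h2 := Submodule.finrank_mono h1
  rw [LinearMap.BilinForm.finrank_orthogonal hQ] at h2
  omega

/-- The non-singular vectors span the whole space. -/
theorem exists_notMem_quadraticForm_ne_zero (hQ : Q.polarBilin.Nondegenerate)
    (hd : 3 ≤ Module.finrank F V) {W : Submodule F V} (hW : W ≠ ⊤) : ∃ x, x ∉ W ∧ Q x ≠ 0 := by
  obtain ⟨H, hWH, hH, hf⟩ := exists_hyperplane_of_lt hW.lt_top
  by_contra! h
  have h1 := two_mul_finrank_le_of_isotropic hQ fun y hy z hz =>
    polarBilin_eq_zero_of_singular_outside hH (fun x _ hx => h x fun hxW => hx (hWH hxW)) hy hz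
  rw [finrank_top] at hf
  omega

variable [Finite F]

theorem exists_normVec_notMem (hQ : Q.polarBilin.Nondegenerate) (hd : 3 ≤ Module.finrank F V)
    {W : Submodule F V} (hW : W ≠ ⊤) : ∃ p : NS₁ Q, normVec p ∉ W := by
  obtain ⟨x, hx, hQx⟩ := exists_notMem_quadraticForm_ne_zero hQ hd hW
  obtain ⟨p, c, hc, hp⟩ := exists_normVec_eq_smul hQx
  exact ⟨p, fun h => hx ((W.smul_mem_iff hc).1 (hp ▸ h))⟩

theorem span_range_normVec (hQ : Q.polarBilin.Nondegenerate) (hd : 3 ≤ Module.finrank F V) :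
    Submodule.span F (Set.range (normVec : NS₁ Q → V)) = ⊤ := by
  by_contra h
  obtain ⟨p, hp⟩ := exists_normVec_notMem hQ hd h
  exact hp (Submodule.subset_span ⟨p, rfl⟩)

theorem nsPerm_injective (hQ : Q.polarBilin.Nondegenerate) (hd : 3 ≤ Module.finrank F V) :
    Function.Injective (nsPerm Q) := by
  rw [injective_iff_map_eq_one]
  intro g hg
  have h : (⊤ : Submodule F V) ≤ fixedSpace g := by
    rw [← span_range_normVec hQ hd, Submodule.span_le]
    rintro _ ⟨p, rfl⟩
    exact nsPerm_apply_self_iff.1 (by rw [hg]; rfl)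
  exact isometry_ext fun x => mem_fixedSpace.1 (h Submodule.mem_top)

theorem nsPerm_mem_omegaPerm_iff (hQ : Q.polarBilin.Nondegenerate) (hd : 3 ≤ Module.finrank F V)
    {g : isometryGroup Q} : nsPerm Q g ∈ omegaPerm Q ↔ g ∈ omegaGroup Q := by
  rw [mem_omegaPerm]
  constructor
  · rintro ⟨h, hh, e⟩
    rwa [← nsPerm_injective hQ hd e]
  · exact fun h => ⟨g, h, rfl⟩

/-- A sequence of points spanning a hyperplane has trivial stabilizer in `Ω`. -/
theorem pointwiseStabilizer_omegaPerm_eq_bot (hQ : Q.polarBilin.Nondegenerate)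
    {l : List (NS₁ Q)} (h : Module.finrank F V ≤ Module.finrank F (nsSpan l) + 1) :
    pointwiseStabilizer (omegaPerm Q) l = ⊥ := by
  rw [eq_bot_iff]
  intro g hg
  obtain ⟨k, hk, hl, rfl⟩ := mem_pointwiseStabilizer_omegaPerm.1 hg
  rw [eq_one_of_mem_omegaGroup_of_finrank_fixedSpace hQ hk
    (h.trans (Nat.add_le_add_right (Submodule.finrank_mono hl) 1)), map_one]
  exact Subgroup.one_mem _

end NonsingularSpan

/-! ### Vectors with prescribed polar products -/

section DualVectors

variable {F V : Type*} [Field F] [AddCommGroup V] [Module F V] [FiniteDimensional F V]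
  {Q : QuadraticForm F V}

theorem exists_polarBilin_eq_dual (hQ : Q.polarBilin.Nondegenerate) (f : V →ₗ[F] F) :
    ∃ x, ∀ y, Q.polarBilin x y = f y := by
  refine ⟨(LinearMap.BilinForm.toDual Q.polarBilin hQ).symm f, fun y => ?_⟩
  exact LinearMap.BilinForm.apply_toDual_symm_apply f y

theorem exists_polarBilin_eq (hQ : Q.polarBilin.Nondegenerate) {ι : Type*} {v : ι → V}
    (hv : LinearIndependent F v) (c : ι → F) : ∃ x, ∀ i, Q.polarBilin x (v i) = c i := by
  obtain ⟨f, hf⟩ := LinearMap.exists_extend ((Module.Basis.span hv).constr F c)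
  obtain ⟨x, hx⟩ := exists_polarBilin_eq_dual hQ f
  refine ⟨x, fun i => ?_⟩
  rw [hx]
  have h := LinearMap.congr_fun hf (Module.Basis.span hv i)
  rw [Module.Basis.constr_basis, LinearMap.comp_apply, Submodule.subtype_apply,
    Module.Basis.span_apply] at h
  exact h

end DualVectors

/-! ### Long irredundant sequences inside a hyperplane orthogonal to a non-singular point -/

section OrthogonalSequences

variable {F V : Type*} [Field F] [Finite F] [CharP F 2] [AddCommGroup V] [Module F V] [FiniteDimensional F V]
  {Q : QuadraticForm F V}

/-- A reflection in a vector orthogonal to `W` but not to `x` moves `x`. If the vector found is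
singular, adding `w` repairs this. The reflection in `w` fixes `W` and `x`, so it corrects the
parity at no cost. -/
theorem exists_mem_omegaGroup_moving_of_orthogonal (hQ : Q.polarBilin.Nondegenerate)
    {W : Submodule F V} {w x : V} (hw : w ∈ W) (hQw : Q w ≠ 0)
    (hW : ∀ y ∈ W, Q.polarBilin w y = 0) (hwx : Q.polarBilin w x = 0) (hx : x ∉ W) :
    ∃ g ∈ omegaGroup Q, W ≤ fixedSpace g ∧ g.1 x ≠ x := by
  obtain ⟨a, ha, hax, haW⟩ : ∃ a, Q a ≠ 0 ∧ Q.polarBilin a x ≠ 0 ∧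
      ∀ y ∈ W, Q.polarBilin a y = 0 := by
    obtain ⟨u, hu, hux⟩ := exists_mem_orthogonal_polarBilin_ne_zero hQ hx
    rw [mem_orthogonal_polarBilin] at hu
    have hu' : ∀ y ∈ W, Q.polarBilin u y = 0 := fun y hy => by rw [polarBilin_comm, hu y hy]
    by_cases h : Q u = 0
    · refine ⟨u + w, ?_, ?_, fun y hy => ?_⟩
      · rwa [quadraticForm_add, h, hu' w hw, zero_add, add_zero]
      · rwa [map_add, LinearMap.add_apply, hwx, add_zero]
      · rw [map_add, LinearMap.add_apply, hW y hy, hu' y hy, add_zero]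
    · exact ⟨u, h, hux, hu'⟩
  refine ⟨reflIsom a ha * reflIsom w hQw, reflIsom_mul_reflIsom_mem_omegaGroup hQ ha hQw,
    fun y hy => ?_, ?_⟩
  · rw [mem_fixedSpace, isometry_mul_apply, reflIsom_apply_of_orthogonal hQw (hW y hy),
      reflIsom_apply_of_orthogonal ha (haW y hy)]
  · rw [isometry_mul_apply, reflIsom_apply_of_orthogonal hQw hwx, Ne,
      reflIsom_apply_eq_self_iff ha]
    exact hax

theorem exists_mem_omegaGroup_moving (hQ : Q.polarBilin.Nondegenerate)
    (hd : 3 ≤ Module.finrank F V) {w : V} (hQw : Q w ≠ 0) : ∃ g ∈ omegaGroup Q, g.1 w ≠ w := by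
  obtain ⟨z, hz⟩ := exists_polarBilin_ne_zero hQ (ne_zero_of_quadraticForm_ne_zero hQw)
  obtain ⟨a, ha, hQa⟩ := exists_notMem_quadraticForm_ne_zero hQ hd
    (W := LinearMap.ker (Q.polarBilin w)) fun h => hz (by
      rw [← LinearMap.mem_ker, h]; exact Submodule.mem_top)
  refine ⟨reflIsom a hQa * reflIsom w hQw, reflIsom_mul_reflIsom_mem_omegaGroup hQ hQa hQw, ?_⟩
  rw [isometry_mul_apply, reflIsom_apply_of_orthogonal hQw (polarBilin_self w), Ne,
    reflIsom_apply_eq_self_iff hQa, polarBilin_comm]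
  exact ha

/-- An independent sequence of points containing `p₀`, in the hyperplane orthogonal to `p₀`, whose
Gram matrix has entries `0` and `1`. -/
structure IsOrthoSeq (p₀ : NS₁ Q) (l : List (NS₁ Q)) : Prop where
  mem : p₀ ∈ l
  orth : ∀ p ∈ l, Q.polarBilin (normVec p₀) (normVec p) = 0
  finrank_eq : Module.finrank F (nsSpan l) = l.length
  gram : ∀ p ∈ l, ∀ p' ∈ l, Q.polarBilin (normVec p) (normVec p') = 0 ∨
    Q.polarBilin (normVec p) (normVec p') = 1
  irredundant : IsIrredundant (omegaPerm Q) l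

theorem polarBilin_eq_zero_of_mem_nsSpan {p₀ : NS₁ Q} {l : List (NS₁ Q)}
    (h : ∀ p ∈ l, Q.polarBilin (normVec p₀) (normVec p) = 0) {y : V} (hy : y ∈ nsSpan l) :
    Q.polarBilin (normVec p₀) y = 0 :=
  (nsSpan_le_iff (W := LinearMap.ker (Q.polarBilin (normVec p₀)))).2 h hy

theorem linearIndependent_of_finrank_nsSpan {l : List (NS₁ Q)}
    (h : Module.finrank F (nsSpan l) = l.length) :
    LinearIndependent F (fun i : Fin l.length => normVec l[i]) := by
  rw [linearIndependent_iff_card_eq_finrank_span, Fintype.card_fin]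
  refine h.symm.trans ?_
  have e : {v | ∃ p ∈ l, normVec p = v} = Set.range (fun i : Fin l.length => normVec l[i]) := by
    ext v
    constructor
    · rintro ⟨p, hp, rfl⟩
      obtain ⟨i, hi, rfl⟩ := List.getElem_of_mem hp
      exact ⟨⟨i, hi⟩, rfl⟩
    · rintro ⟨i, rfl⟩
      exact ⟨_, List.getElem_mem _, rfl⟩
  rw [Set.finrank, nsSpan, e]

theorem isOrthoSeq_singleton (hQ : Q.polarBilin.Nondegenerate)
    (hd : 3 ≤ Module.finrank F V) (p₀ : NS₁ Q) : IsOrthoSeq p₀ [p₀] where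
  mem := List.mem_singleton_self p₀
  orth p hp := by rw [List.mem_singleton.1 hp, polarBilin_self]
  finrank_eq := by
    have h := finrank_nsSpan_append_singleton (l := []) (p := p₀)
      (by simpa using normVec_ne_zero p₀)
    rw [nsSpan_nil, finrank_bot] at h
    exact h
  gram p hp p' hp' := by
    rw [List.mem_singleton.1 hp, List.mem_singleton.1 hp', polarBilin_self]
    exact Or.inl rfl
  irredundant := by
    refine isIrredundant_nil.append_singleton (x := p₀) ?_
    obtain ⟨g, hg, hne⟩ := exists_mem_omegaGroup_moving hQ hd (quadraticForm_normVec_ne_zero p₀)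
    refine ⟨nsPerm Q g, ⟨⟨g, hg, rfl⟩, fun x hx => by simp at hx⟩, ?_⟩
    rwa [Ne, nsPerm_apply_eq_iff]

theorem IsOrthoSeq.exists_append_singleton (hQ : Q.polarBilin.Nondegenerate) {p₀ : NS₁ Q}
    {l : List (NS₁ Q)} (hl : IsOrthoSeq p₀ l) (hlen : l.length + 1 < Module.finrank F V) :
    ∃ p, IsOrthoSeq p₀ (l ++ [p]) := by
  set w := normVec p₀ with hw
  have hwW : w ∈ nsSpan l := normVec_mem_nsSpan hl.mem
  have hWw : ∀ y ∈ nsSpan l, Q.polarBilin w y = 0 := fun y hy =>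
    polarBilin_eq_zero_of_mem_nsSpan hl.orth hy
  obtain ⟨x, hxw, hx01, hx⟩ : ∃ x, Q.polarBilin w x = 0 ∧
      (∀ p ∈ l, Q.polarBilin x (normVec p) = 0 ∨ Q.polarBilin x (normVec p) = 1) ∧
      x ∉ nsSpan l := by
    -- Otherwise `nsSpan l` contains every vector orthogonal to `w` whose products with `l` are `0`
    -- or `1`. Such vectors span the hyperplane orthogonal to `w`: subtract multiples of the dual
    -- vectors `X j`, noting that the coefficient at `p₀` vanishes. Then `l` would have at least `d
    -- - 1` members.
    by_contra! H
    have hind := linearIndependent_of_finrank_nsSpan hl.finrank_eq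
    have hX : ∀ j : Fin l.length, ∃ x, ∀ i : Fin l.length,
        Q.polarBilin x (normVec l[i]) = if i = j then 1 else 0 := fun j =>
      exists_polarBilin_eq hQ hind _
    choose X hX using hX
    have hlt : LinearMap.ker (Q.polarBilin w) ≤ nsSpan l := by
      intro y hy
      have h1 : ∀ j : Fin l.length, Q.polarBilin (normVec l[j]) y • X j ∈ nsSpan l := by
        intro j
        by_cases hj : l[j] = p₀
        · rw [hj, ← hw, LinearMap.mem_ker.1 hy, zero_smul]
          exact Submodule.zero_mem _
        · refine Submodule.smul_mem _ _ (H _ ?_ ?_)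
          · obtain ⟨i, hi, hi'⟩ := List.getElem_of_mem hl.mem
            have h := hX j ⟨i, hi⟩
            rw [if_neg fun e => hj (by rw [← e]; exact hi')] at h
            rw [hw, ← hi', polarBilin_comm]
            exact h
          · intro p hp
            obtain ⟨i, hi, hi'⟩ := List.getElem_of_mem hp
            have h := hX j ⟨i, hi⟩
            change Q.polarBilin (X j) (normVec l[i]) = _ at h
            rw [← hi', h]
            split_ifs
            · exact Or.inr rfl
            · exact Or.inl rfl
      have h2 : ∀ p ∈ l, Q.polarBilin
          (y - ∑ j : Fin l.length, Q.polarBilin (normVec l[j]) y • X j) (normVec p) = 0 := by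
        intro p hp
        obtain ⟨i, hi, rfl⟩ := List.getElem_of_mem hp
        have h3 : ∀ j, Q.polarBilin (X j) (normVec l[i]) = if (⟨i, hi⟩ : Fin l.length) = j
          then 1 else 0 := fun j => hX j ⟨i, hi⟩
        simp only [map_sub, LinearMap.sub_apply, map_sum, LinearMap.sum_apply, map_smul,
          LinearMap.smul_apply, smul_eq_mul, h3, mul_ite, mul_one, mul_zero, Finset.sum_ite_eq,
          Finset.mem_univ, if_true]
        rw [polarBilin_comm y]
        exact sub_self _
      have h4 := H _ (by rw [polarBilin_comm]; exact h2 _ hl.mem) fun p hp => Or.inl (h2 p hp)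
      rw [← sub_add_cancel y (∑ j : Fin l.length, Q.polarBilin (normVec l[j]) y • X j)]
      exact Submodule.add_mem _ h4 (Submodule.sum_mem _ fun j _ => h1 j)
    have h5 := Submodule.finrank_mono hlt
    have h6 := LinearMap.finrank_range_add_finrank_ker (Q.polarBilin w)
    have h7 := Submodule.finrank_le (LinearMap.range (Q.polarBilin w))
    rw [Module.finrank_self] at h7
    rw [hl.finrank_eq] at h5
    omega
  -- Adding `c • w` normalizes the value of `Q` and leaves all products with `l` unchanged.
  obtain ⟨c, hc⟩ := exists_mul_self_eq (1 + Q x)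
  have hQ1 : Q (x + c • w) = 1 := by
    rw [quadraticForm_add, quadraticForm_smul, hc, map_smul, polarBilin_comm x, hxw, hw,
      quadraticForm_normVec, smul_zero]
    linear_combination Q x * two_eq_zero_of_charP_two F
  obtain ⟨p, hp⟩ := exists_normVec_eq hQ1
  have hpl : ∀ p' ∈ l, Q.polarBilin (normVec p) (normVec p') = Q.polarBilin x (normVec p') := by
    intro p' hp'
    rw [hp, map_add, LinearMap.add_apply, map_smul, LinearMap.smul_apply, hl.orth p' hp', smul_zero,
      add_zero]
  have hpW : normVec p ∉ nsSpan l := by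
    intro h
    apply hx
    rw [hp] at h
    simpa using Submodule.sub_mem _ h (Submodule.smul_mem _ c hwW)
  have hwp : Q.polarBilin w (normVec p) = 0 := by
    rw [polarBilin_comm, hpl p₀ hl.mem, polarBilin_comm, hxw]
  refine ⟨p, ⟨List.mem_append_left _ hl.mem, ?_, ?_, ?_, ?_⟩⟩
  · intro p' hp'
    rcases List.mem_append.1 hp' with h | h
    · exact hl.orth p' h
    · rw [List.mem_singleton.1 h]
      exact hwp
  · rw [finrank_nsSpan_append_singleton hpW, hl.finrank_eq, List.length_append,
      List.length_singleton]
  · intro p' hp' p'' hp''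
    rcases List.mem_append.1 hp' with h | h <;> rcases List.mem_append.1 hp'' with h' | h'
    · exact hl.gram p' h p'' h'
    · rw [List.mem_singleton.1 h', polarBilin_comm, hpl p' h]
      exact hx01 p' h
    · rw [List.mem_singleton.1 h, hpl p'' h']
      exact hx01 p'' h'
    · rw [List.mem_singleton.1 h, List.mem_singleton.1 h', polarBilin_self]
      exact Or.inl rfl
  · refine hl.irredundant.append_singleton ?_
    obtain ⟨g, hg, h1, h2⟩ := exists_mem_omegaGroup_moving_of_orthogonal hQ hwW
      (quadraticForm_normVec_ne_zero p₀) hWw hwp hpW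
    refine ⟨nsPerm Q g, mem_pointwiseStabilizer_omegaPerm.2 ⟨g, hg, h1, rfl⟩, ?_⟩
    rwa [Ne, nsPerm_apply_eq_iff]

theorem exists_isOrthoSeq (hQ : Q.polarBilin.Nondegenerate) (hd : 3 ≤ Module.finrank F V)
    (p₀ : NS₁ Q) {n : ℕ} (hn : 1 ≤ n) (hnd : n + 1 ≤ Module.finrank F V) :
    ∃ l, IsOrthoSeq p₀ l ∧ l.length = n := by
  induction n, hn using Nat.le_induction with
  | base => exact ⟨[p₀], isOrthoSeq_singleton hQ hd p₀, rfl⟩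
  | succ n hn ih =>
    obtain ⟨l, hl, hlen⟩ := ih (by omega)
    obtain ⟨p, hp⟩ := hl.exists_append_singleton hQ (by omega)
    exact ⟨_, hp, by simp [hlen]⟩

end OrthogonalSequences

/-! ### Fixers of subspaces in `Ω` when the field has at least four elements -/

section LargeFields

variable {F V : Type*} [Field F] [AddCommGroup V] [Module F V] {Q : QuadraticForm F V}

theorem exists_ne_three [Finite F] (hF : 4 ≤ Nat.card F) (a b c : F) :
    ∃ t : F, t ≠ a ∧ t ≠ b ∧ t ≠ c := by
  classical
  have := Fintype.ofFinite F
  have h : (({a, b, c} : Finset F)).card < Fintype.card F :=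
    lt_of_le_of_lt Finset.card_le_three (by rw [← Nat.card_eq_fintype_card]; omega)
  obtain ⟨t, ht⟩ := Finset.exists_mem_notMem_of_card_lt_card (s := {a, b, c}) (t := Finset.univ) h
  refine ⟨t, ?_⟩
  simpa using ht

/-- As a function of `t`, `Q (x + t • y)` is a polynomial of degree at most two with constant term
`Q x ≠ 0`. It cannot vanish at the three distinct non-zero values `1`, `a`, `b`. -/
theorem exists_smul_add_nonsingular [Finite F] (hF : 4 ≤ Nat.card F) {x : V} (hx : Q x ≠ 0)
    (y : V) : ∃ t : F, t ≠ 0 ∧ Q (x + t • y) ≠ 0 := by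
  by_contra! h
  obtain ⟨a, ha0, ha1, -⟩ := exists_ne_three hF 0 1 1
  obtain ⟨b, hb0, hb1, hba⟩ := exists_ne_three hF 0 1 a
  have e1 := h 1 one_ne_zero
  have e2 := h a ha0
  have e3 := h b hb0
  rw [quadraticForm_add, quadraticForm_smul, map_smul, smul_eq_mul] at e1 e2 e3
  have f1 : (a - 1) * (Q.polarBilin x y + (a + 1) * Q y) = 0 := by linear_combination e2 - e1
  have f2 : (b - 1) * (Q.polarBilin x y + (b + 1) * Q y) = 0 := by linear_combination e3 - e1
  have g1 := (mul_eq_zero.1 f1).resolve_left (sub_ne_zero.2 ha1)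
  have g2 := (mul_eq_zero.1 f2).resolve_left (sub_ne_zero.2 hb1)
  have g3 : (b - a) * Q y = 0 := by linear_combination g2 - g1
  have g4 := (mul_eq_zero.1 g3).resolve_left (sub_ne_zero.2 hba)
  rw [g4, mul_zero, add_zero] at g1
  rw [g4, g1] at e1
  exact hx (by linear_combination e1)

variable [FiniteDimensional F V]

theorem exists_mem_notMem_span_singleton {U : Submodule F V} (hU : 2 ≤ Module.finrank F U)
    (x : V) : ∃ y ∈ U, y ∉ Submodule.span F {x} := by
  by_contra! h
  have h1 := Submodule.finrank_mono (show U ≤ Submodule.span F {x} from h)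
  have h2 := finrank_span_le_card (R := F) ({x} : Set V)
  simp at h2
  omega

variable [CharP F 2]

theorem reflIsom_apply_ne_reflIsom_apply {a b z : V} (ha : Q a ≠ 0) (hb : Q b ≠ 0)
    (haz : Q.polarBilin a z ≠ 0) (hab : a ∉ Submodule.span F {b}) :
    (reflIsom b hb).1 z ≠ (reflIsom a ha).1 z := by
  rw [reflIsom_apply, reflIsom_apply]
  intro h
  have h2 := add_left_cancel h
  have h3 : ((Q a)⁻¹ * Q.polarBilin a z) ≠ 0 := mul_ne_zero (inv_ne_zero ha) haz
  apply hab
  rw [← Submodule.smul_mem_iff _ h3, ← h2]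
  exact Submodule.smul_mem _ _ (Submodule.mem_span_singleton_self b)

theorem reflIsom_mul_reflIsom_apply_ne {a b z : V} (ha : Q a ≠ 0) (hb : Q b ≠ 0)
    (haz : Q.polarBilin a z ≠ 0) (hab : a ∉ Submodule.span F {b}) :
    (reflIsom a ha * reflIsom b hb).1 z ≠ z := by
  intro h
  apply reflIsom_apply_ne_reflIsom_apply ha hb haz hab
  conv_rhs => rw [← h]
  rw [← isometry_mul_apply, ← mul_assoc, reflIsom_mul_self, one_mul]

theorem le_fixedSpace_reflIsom_mul_reflIsom {W : Submodule F V} {a b : V} (ha : Q a ≠ 0)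
    (hb : Q b ≠ 0) (haW : a ∈ LinearMap.BilinForm.orthogonal Q.polarBilin W)
    (hbW : b ∈ LinearMap.BilinForm.orthogonal Q.polarBilin W) :
    W ≤ fixedSpace (reflIsom a ha * reflIsom b hb) := by
  rw [mem_orthogonal_polarBilin] at haW hbW
  intro w hw
  rw [mem_fixedSpace, isometry_mul_apply,
    reflIsom_apply_of_orthogonal hb (by rw [polarBilin_comm, hbW w hw]),
    reflIsom_apply_of_orthogonal ha (by rw [polarBilin_comm, haW w hw])]

/-- The pointwise stabilizer in `Ω` of a subspace of codimension at least two is non-trivial if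
the field has at least four elements. -/
theorem exists_mem_omegaGroup_ne_one [Finite F] (hQ : Q.polarBilin.Nondegenerate)
    (hF : 4 ≤ Nat.card F) {W : Submodule F V}
    (hW : Module.finrank F W + 2 ≤ Module.finrank F V) :
    ∃ g ∈ omegaGroup Q, W ≤ fixedSpace g ∧ g ≠ 1 := by
  set U := LinearMap.BilinForm.orthogonal Q.polarBilin W with hU
  have hUd : 2 ≤ Module.finrank F U := by
    rw [hU, LinearMap.BilinForm.finrank_orthogonal hQ]
    omega
  by_cases hs : ∀ u ∈ U, Q u = 0
  · obtain ⟨e, he, he0⟩ := exists_mem_notMem_span_singleton hUd 0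
    obtain ⟨f, hf, hfe⟩ := exists_mem_notMem_span_singleton hUd e
    rw [Submodule.span_zero_singleton, Submodule.mem_bot] at he0
    have hef : Q.polarBilin e f = 0 := by
      have h := hs (e + f) (U.add_mem he hf)
      rwa [quadraticForm_add, hs e he, hs f hf, zero_add, zero_add] at h
    refine ⟨siegel e f (hs e he) (hs f hf) hef, siegel_mem_omegaGroup hQ _ _ _, fun w hw => ?_, ?_⟩
    · rw [hU, mem_orthogonal_polarBilin] at he hf
      rw [mem_fixedSpace, siegel_apply, polarBilin_comm e, polarBilin_comm f, he w hw, hf w hw]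
      simp
    · intro h
      obtain ⟨z, hz⟩ := exists_polarBilin_ne_zero hQ he0
      have h1 := siegel_apply (hs e he) (hs f hf) hef z
      rw [h] at h1
      have h2 : z = z + (Q.polarBilin e z • f + Q.polarBilin f z • e) := by
        rw [← add_assoc]
        exact h1
      have h3 := eq_neg_of_add_eq_zero_left (left_eq_add.1 h2)
      apply hfe
      rw [← Submodule.smul_mem_iff _ hz, h3]
      exact Submodule.neg_mem _ (Submodule.smul_mem _ _ (Submodule.mem_span_singleton_self e))
  · push Not at hs
    obtain ⟨x, hx, hQx⟩ := hs
    obtain ⟨y, hy, hyx⟩ := exists_mem_notMem_span_singleton hUd x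
    -- A second non-singular direction in `U` gives a non-trivial product of two reflections. This
    -- is where `q ≥ 4` enters: over two elements `U` may be a hyperbolic plane with a single
    -- non-singular vector.
    obtain ⟨t, ht, hb⟩ := exists_smul_add_nonsingular hF hQx y
    have hbx : x + t • y ∉ Submodule.span F {x} := by
      intro h
      apply hyx
      rw [← Submodule.smul_mem_iff _ ht]
      simpa using Submodule.sub_mem _ h (Submodule.mem_span_singleton_self x)
    obtain ⟨z, -, hz⟩ := exists_mem_orthogonal_polarBilin_ne_zero hQ hbx
    rw [polarBilin_comm] at hz
    refine ⟨_, reflIsom_mul_reflIsom_mem_omegaGroup hQ hb hQx,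
      le_fixedSpace_reflIsom_mul_reflIsom hb hQx (U.add_mem hx (U.smul_mem t hy)) hx, fun h => ?_⟩
    apply reflIsom_mul_reflIsom_apply_ne hb hQx hz hbx
    rw [h]
    rfl

theorem finrank_span_pair_le (x y : V) : Module.finrank F (Submodule.span F {x, y}) ≤ 2 := by
  classical
  have h := finrank_span_finset_le_card (R := F) ({x, y} : Finset V)
  rw [Set.finrank, Finset.coe_pair] at h
  exact h.trans Finset.card_le_two

/-- If the orthogonal complement of the pair were totally singular, it would be contained in its own
orthogonal, the span of `x` and `y`. As `d ≥ 4`, the two would coincide, against `Q x ≠ 0`. The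
reflection in such a `w` fixes both vectors, so it adjusts parity inside the stabilizer of a pair.
-/
theorem exists_orthogonal_pair_nonsingular (hQ : Q.polarBilin.Nondegenerate)
    (hd : 4 ≤ Module.finrank F V) {x : V} (hx : Q x ≠ 0) (y : V) :
    ∃ w ∈ LinearMap.BilinForm.orthogonal Q.polarBilin (Submodule.span F {x, y}), Q w ≠ 0 := by
  by_contra! hs
  set W := Submodule.span F {x, y} with hW
  set U := LinearMap.BilinForm.orthogonal Q.polarBilin W with hU
  have hle : U ≤ W := by
    rw [← LinearMap.BilinForm.orthogonal_orthogonal hQ isRefl_polarBilin W]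
    intro v hv
    rw [mem_orthogonal_polarBilin]
    intro u hu
    have h := hs (u + v) (U.add_mem hu hv)
    rwa [quadraticForm_add, hs u hu, hs v hv, zero_add, zero_add] at h
  have h1 := finrank_span_pair_le (F := F) x y
  have h2 : U = W := by
    apply Submodule.eq_of_le_of_finrank_le hle
    rw [hU, LinearMap.BilinForm.finrank_orthogonal hQ]
    rw [hW]
    omega
  exact hx (hs x (h2 ▸ Submodule.subset_span (by simp)))

/-- The points fixed by the stabilizer in `Ω` of two non-singular points lie on their line. -/
theorem mem_span_pair_of_fixed [Finite F] (hQ : Q.polarBilin.Nondegenerate)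
    (hd : 4 ≤ Module.finrank F V) (hF : 4 ≤ Nat.card F) {x y z : V} (hx : Q x ≠ 0)
    (hz : ∀ g ∈ omegaGroup Q, g.1 x = x → g.1 y = y → g.1 z = z) :
    z ∈ Submodule.span F {x, y} := by
  by_contra hzW
  have hfix : ∀ g ∈ omegaGroup Q, Submodule.span F {x, y} ≤ fixedSpace g → g.1 z = z := by
    intro g hg hW
    exact hz g hg (mem_fixedSpace.1 (hW (Submodule.subset_span (by simp))))
      (mem_fixedSpace.1 (hW (Submodule.subset_span (by simp))))
  obtain ⟨x₀, hx₀, hQx₀⟩ := exists_orthogonal_pair_nonsingular hQ hd hx y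
  obtain ⟨u, hu, huz⟩ := exists_mem_orthogonal_polarBilin_ne_zero hQ hzW
  have h1 := finrank_span_pair_le (F := F) x y
  set W := Submodule.span F {x, y} with hW
  set U := LinearMap.BilinForm.orthogonal Q.polarBilin W with hU
  have hUd : 2 ≤ Module.finrank F U := by
    rw [hU, LinearMap.BilinForm.finrank_orthogonal hQ]
    omega
  -- For such `a`, `b` the product of the two reflections lies in `Ω`, fixes `x` and `y`, and moves
  -- `z`. The known vector `x₀` serves as `b` or `a` according to whether it is orthogonal to `z`.
  obtain ⟨a, ha, hQa, b, hb, hQb, haz, hab⟩ : ∃ a ∈ U, ∃ (_ : Q a ≠ 0), ∃ b ∈ U, ∃ (_ : Q b ≠ 0),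
      Q.polarBilin a z ≠ 0 ∧ a ∉ Submodule.span F {b} := by
    by_cases h0 : Q.polarBilin x₀ z = 0
    · obtain ⟨t, ht, hQt⟩ := exists_smul_add_nonsingular hF hQx₀ u
      have h2 : Q.polarBilin (x₀ + t • u) z ≠ 0 := by
        rw [map_add, map_smul, LinearMap.add_apply, LinearMap.smul_apply, h0, zero_add]
        exact mul_ne_zero ht huz
      refine ⟨_, U.add_mem hx₀ (U.smul_mem t hu), hQt, x₀, hx₀, hQx₀, h2, fun h => h2 ?_⟩
      obtain ⟨c, hc⟩ := Submodule.mem_span_singleton.1 h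
      rw [← hc, map_smul, LinearMap.smul_apply, h0, smul_zero]
    · obtain ⟨v, hv, hvx⟩ := exists_mem_notMem_span_singleton hUd x₀
      obtain ⟨t, ht, hQt⟩ := exists_smul_add_nonsingular hF hQx₀ v
      refine ⟨x₀, hx₀, hQx₀, _, U.add_mem hx₀ (U.smul_mem t hv), hQt, h0, fun h => hvx ?_⟩
      obtain ⟨c, hc⟩ := Submodule.mem_span_singleton.1 h
      have hc0 : c ≠ 0 := fun e => by
        rw [e, zero_smul] at hc
        exact hQx₀ (by rw [← hc, QuadraticMap.map_zero])
      rw [← Submodule.smul_mem_iff _ (mul_ne_zero hc0 ht)]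
      have : (c * t) • v = (1 - c) • x₀ := by
        rw [sub_smul, one_smul, mul_smul, eq_sub_iff_add_eq, add_comm, ← smul_add, hc]
      rw [this]
      exact Submodule.smul_mem _ _ (Submodule.mem_span_singleton_self x₀)
  exact reflIsom_mul_reflIsom_apply_ne hQa hQb haz hab (hfix _
    (reflIsom_mul_reflIsom_mem_omegaGroup hQ hQa hQb)
    (le_fixedSpace_reflIsom_mul_reflIsom hQa hQb ha hb))

end LargeFields

/-! ### Bases of `Ω` over large fields -/

section OmegaIBIS

variable {F V : Type*} [Field F] [Finite F] [CharP F 2] [AddCommGroup V] [Module F V]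
  [FiniteDimensional F V] {Q : QuadraticForm F V}

/-- The stabilizer of a sequence fixes its whole span, so a point that it moves lies outside the
span. -/
theorem IsIrredundant.finrank_nsSpan {l : List (NS₁ Q)} (hl : IsIrredundant (omegaPerm Q) l) :
    Module.finrank F (nsSpan l) = l.length := by
  induction l using List.reverseRecOn with
  | nil => rw [nsSpan_nil, finrank_bot, List.length_nil]
  | append_singleton l x ih =>
    have h1 := hl.take l.length
    rw [List.take_left' rfl] at h1
    obtain ⟨g, hg, hne⟩ := hl l.length (by simp)
    rw [List.take_left' rfl] at hg
    obtain ⟨k, hk, hle, rfl⟩ := mem_pointwiseStabilizer_omegaPerm.1 hg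
    have hx : normVec x ∉ nsSpan l := by
      intro h
      apply hne
      rw [nsPerm_apply_self_iff]
      simpa using hle h
    rw [finrank_nsSpan_append_singleton hx, ih h1, List.length_append, List.length_singleton]

/-- After `d - 1` independent points the stabilizer is trivial and nothing more can be moved. With
fewer points the span has codimension at least two and a non-trivial fixer. -/
theorem length_of_isIrredundantBase_omegaPerm (hQ : Q.polarBilin.Nondegenerate)
    (hd : 3 ≤ Module.finrank F V) (hF : 4 ≤ Nat.card F) {l : List (NS₁ Q)}
    (hl : IsIrredundantBase (omegaPerm Q) l) : l.length = Module.finrank F V - 1 := by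
  have h1 : IsIrredundant (omegaPerm Q) l := hl.2
  apply le_antisymm
  · by_contra! hlt
    have h2 := (h1.take (Module.finrank F V - 1)).finrank_nsSpan
    rw [List.length_take, min_eq_left hlt.le] at h2
    have h3 := pointwiseStabilizer_omegaPerm_eq_bot hQ
      (l := l.take (Module.finrank F V - 1)) (by omega)
    obtain ⟨g, hg, hne⟩ := h1 _ hlt
    rw [h3, Subgroup.mem_bot] at hg
    rw [hg] at hne
    exact hne rfl
  · by_contra! hlt
    obtain ⟨g, hg, hle, hne⟩ := exists_mem_omegaGroup_ne_one hQ hF (W := nsSpan l)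
      (by rw [h1.finrank_nsSpan]; omega)
    have h2 : nsPerm Q g ∈ pointwiseStabilizer (omegaPerm Q) l :=
      mem_pointwiseStabilizer_omegaPerm.2 ⟨g, hg, hle, rfl⟩
    rw [hl.1, Subgroup.mem_bot] at h2
    exact hne (nsPerm_injective hQ hd (by rw [h2, map_one]))

end OmegaIBIS

/-! ### The normalizer of `Ω` permutes the point reflections -/

section PointReflections

theorem perm_inv_apply_self {α : Type*} (g : Equiv.Perm α) (x : α) : g⁻¹ (g x) = x :=
  g.symm_apply_apply x

variable {F V : Type*} [Field F] [Finite F] [CharP F 2] [AddCommGroup V] [Module F V]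
  {Q : QuadraticForm F V}

/-- The value of the polar form on the normalized vectors of two non-singular points. -/
noncomputable def nsGram (p x : NS₁ Q) : F := Q.polarBilin (normVec p) (normVec x)

theorem nsGram_comm (p x : NS₁ Q) : nsGram p x = nsGram x p := polarBilin_comm _ _

@[simp]
theorem nsGram_self (p : NS₁ Q) : nsGram p p = 0 := polarBilin_self _

theorem nsGram_nsPerm (h : isometryGroup Q) (p x : NS₁ Q) :
    nsGram (nsPerm Q h p) (nsPerm Q h x) = nsGram p x := by
  rw [nsGram, normVec_nsPerm, normVec_nsPerm, isometry_polarBilin, nsGram]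

/-- The reflection in a non-singular point. -/
noncomputable def pointRefl (p : NS₁ Q) : isometryGroup Q :=
  reflIsom (normVec p) (quadraticForm_normVec_ne_zero p)

theorem pointRefl_apply (p : NS₁ Q) (x : V) :
    (pointRefl p).1 x = x + Q.polarBilin (normVec p) x • normVec p := by
  rw [pointRefl, reflIsom_apply, quadraticForm_normVec, inv_one, one_mul]

/-- The permutation induced by the reflection in a non-singular point. -/
noncomputable def nsRefl (p : NS₁ Q) : Equiv.Perm (NS₁ Q) := nsPerm Q (pointRefl p)

theorem normVec_nsRefl (p x : NS₁ Q) :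
    normVec (nsRefl p x) = normVec x + nsGram p x • normVec p := by
  rw [nsRefl, normVec_nsPerm, pointRefl_apply, nsGram]

theorem nsRefl_apply_eq_self_iff {p x : NS₁ Q} : nsRefl p x = x ↔ nsGram p x = 0 := by
  rw [← normVec_injective.eq_iff, normVec_nsRefl, add_eq_left, smul_eq_zero,
    or_iff_left (normVec_ne_zero p)]

theorem nsGram_nsRefl (p x y : NS₁ Q) :
    nsGram p (nsRefl x y) = nsGram p y + nsGram x y * nsGram p x := by
  rw [nsGram, normVec_nsRefl, map_add, map_smul, smul_eq_mul]
  rfl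

theorem nsRefl_mul_self (p : NS₁ Q) : nsRefl p * nsRefl p = 1 := by
  rw [nsRefl, ← map_mul, pointRefl, reflIsom_mul_self, map_one]

theorem nsRefl_apply_nsRefl (p x : NS₁ Q) : nsRefl p (nsRefl p x) = x :=
  congrArg (fun f : Equiv.Perm (NS₁ Q) => f x) (nsRefl_mul_self p)

theorem nsPerm_apply_nsRefl {h : isometryGroup Q} {p : NS₁ Q} (hp : nsPerm Q h p = p) (x : NS₁ Q) :
    nsPerm Q h (nsRefl p x) = nsRefl p (nsPerm Q h x) := by
  apply normVec_injective
  rw [normVec_nsPerm, normVec_nsRefl, map_add, map_smul, normVec_nsRefl, normVec_nsPerm,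
    nsPerm_apply_eq_iff.1 hp]
  congr 2
  conv_rhs => rw [← hp]
  rw [nsGram_nsPerm]

variable [FiniteDimensional F V]

/-- The reflection in `p` is not in `Ω`, but multiplying by the reflection in a vector orthogonal to
`p` and `y` puts it there. So each single value of the reflection is attained by the stabilizer of
`p` in `Ω`, with an element depending on `y`. -/
theorem exists_mem_omegaGroup_eq_nsRefl (hQ : Q.polarBilin.Nondegenerate)
    (hd : 4 ≤ Module.finrank F V) (p y : NS₁ Q) :
    ∃ h ∈ omegaGroup Q, nsPerm Q h p = p ∧ nsPerm Q h y = nsRefl p y := by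
  obtain ⟨w, hw, hQw⟩ := exists_orthogonal_pair_nonsingular hQ hd
    (quadraticForm_normVec_ne_zero p) (normVec y)
  rw [mem_orthogonal_span_polarBilin] at hw
  have h1 : Q.polarBilin w (normVec p) = 0 := by rw [polarBilin_comm, hw _ (by simp)]
  have h2 : Q.polarBilin w (normVec y) = 0 := by rw [polarBilin_comm, hw _ (by simp)]
  refine ⟨pointRefl p * reflIsom w hQw, reflIsom_mul_reflIsom_mem_omegaGroup hQ _ _, ?_, ?_⟩
  · rw [nsPerm_apply_eq_iff, isometry_mul_apply, reflIsom_apply_of_orthogonal hQw h1,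
      pointRefl_apply, polarBilin_self, zero_smul, add_zero]
  · rw [nsPerm_apply_eq_iff, isometry_mul_apply, reflIsom_apply_of_orthogonal hQw h2,
      nsRefl, normVec_nsPerm]

/-- A point other than `p` is moved by the stabilizer of `p` in `Ω`. -/
theorem eq_of_fixed_by_stabilizer (hQ : Q.polarBilin.Nondegenerate)
    (hd : 4 ≤ Module.finrank F V) {p x : NS₁ Q}
    (h : ∀ g ∈ omegaGroup Q, nsPerm Q g p = p → nsPerm Q g x = x) : x = p := by
  by_cases h0 : nsGram p x = 0
  · by_contra hne
    obtain ⟨g, hg, hW, hgx⟩ := exists_mem_omegaGroup_moving_of_orthogonal hQ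
      (Submodule.mem_span_singleton_self (normVec p)) (quadraticForm_normVec_ne_zero p)
      (fun y hy => by
        obtain ⟨c, rfl⟩ := Submodule.mem_span_singleton.1 hy
        rw [map_smul, polarBilin_self, smul_zero]) h0
      (fun hx => hne (normVec_injective (eq_normVec (coe_eq_span_normVec p ▸ hx)
        (quadraticForm_normVec x))))
    exact hgx (nsPerm_apply_eq_iff.1 (h g hg (nsPerm_apply_self_iff.2
      (hW (Submodule.mem_span_singleton_self _)))))
  · obtain ⟨k, hk, hkp, hkx⟩ := exists_mem_omegaGroup_eq_nsRefl hQ hd p x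
    rw [h k hk hkp] at hkx
    exact absurd (nsRefl_apply_eq_self_iff.1 hkx.symm) h0

theorem exists_conj_of_mem_normalizer {g : Equiv.Perm (NS₁ Q)}
    (hg : g ∈ Subgroup.normalizer (omegaPerm Q : Set _)) {h : isometryGroup Q} (hh : h ∈ omegaGroup Q) :
    ∃ k ∈ omegaGroup Q, ∀ x, nsPerm Q k (g x) = g (nsPerm Q h x) := by
  obtain ⟨k, hk, e⟩ := mem_omegaPerm.1 ((Subgroup.mem_normalizer_iff.1 hg _).1
    (mem_omegaPerm.2 ⟨h, hh, rfl⟩))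
  refine ⟨k, hk, fun x => ?_⟩
  rw [e]
  simp

/-- Everything in `Ω` fixing `p` and `y` fixes `nsRefl p y`. Normalizing elements transport this
property, so the image lies on the line of `g p` and `g y`, with the same Gram value against `g p`
as `g y`. The norm condition then leaves the two listed candidates, apart from the orthogonal case,
which needs an extra argument. -/
theorem conj_nsRefl_apply (hQ : Q.polarBilin.Nondegenerate) (hd : 4 ≤ Module.finrank F V)
    (hF : 4 ≤ Nat.card F) {g : Equiv.Perm (NS₁ Q)} (hg : g ∈ Subgroup.normalizer (omegaPerm Q : Set _))
    (p y : NS₁ Q) : g (nsRefl p y) = g y ∨ g (nsRefl p y) = nsRefl (g p) (g y) := by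
  by_cases hyp : y = p
  · left
    rw [nsRefl_apply_eq_self_iff.2 (by rw [hyp, nsGram_self])]
  obtain ⟨h, hh, hp, hy⟩ := exists_mem_omegaGroup_eq_nsRefl hQ hd p y
  obtain ⟨k, hk, hkg⟩ := exists_conj_of_mem_normalizer hg hh
  set z := g (nsRefl p y) with hz
  have hkp : nsPerm Q k (g p) = g p := by rw [hkg, hp]
  have hky : nsPerm Q k (g y) = z := by rw [hkg, hy]
  have hgram : nsGram (g p) z = nsGram (g p) (g y) := by
    rw [← hky]
    conv_lhs => rw [← hkp]
    rw [nsGram_nsPerm]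
  have hline : normVec z ∈ Submodule.span F {normVec (g p), normVec (g y)} := by
    apply mem_span_pair_of_fixed hQ hd hF (quadraticForm_normVec_ne_zero _)
    intro m hm hm1 hm2
    obtain ⟨m', hm', hmg⟩ := exists_conj_of_mem_normalizer (Subgroup.inv_mem _ hg) hm
    have e1 : ∀ x, nsPerm Q m' x = g⁻¹ (nsPerm Q m (g x)) := fun x => by
      have h := hmg (g x)
      rwa [perm_inv_apply_self] at h
    have h1 : nsPerm Q m' p = p := by
      rw [e1, nsPerm_apply_eq_iff.2 hm1, perm_inv_apply_self]
    have h2 : nsPerm Q m' y = y := by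
      rw [e1, nsPerm_apply_eq_iff.2 hm2, perm_inv_apply_self]
    have h3 := nsPerm_apply_nsRefl h1 y
    rw [h2, e1, Equiv.Perm.inv_eq_iff_eq] at h3
    exact nsPerm_apply_eq_iff.1 h3
  obtain ⟨a, b, hab⟩ := Submodule.mem_span_pair.1 hline
  have hQz := quadraticForm_normVec z
  rw [← hab, quadraticForm_add, quadraticForm_smul, quadraticForm_smul, quadraticForm_normVec,
    quadraticForm_normVec, map_smul, map_smul, LinearMap.smul_apply, smul_eq_mul, smul_eq_mul] at hQz
  rw [nsGram, ← hab, map_add, map_smul, map_smul, polarBilin_self, smul_zero, zero_add,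
    smul_eq_mul] at hgram
  change b * nsGram (g p) (g y) = nsGram (g p) (g y) at hgram
  change _ + b * (a * nsGram (g p) (g y)) = _ at hQz
  by_cases hβ : nsGram (g p) (g y) = 0
  · left
    -- When `g p` and `g y` are orthogonal, the norm only gives `a + b = 1`. The element `k` also
    -- maps `z` back to `g y`; comparing the two relations forces `b = 1`, since otherwise `g y = g
    -- p`.
    have hab1 : a = 1 + b := by
      have h1 : (a + b) * (a + b) = 1 := by
        linear_combination hQz - b * a * hβ + a * b * two_eq_zero_of_charP_two F
      rw [mul_self_eq_one_iff_charTwo] at h1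
      linear_combination h1 - b * two_eq_zero_of_charP_two F
    have hback : nsPerm Q k z = g y := by
      rw [hz, hkg, nsPerm_apply_nsRefl hp, hy, nsRefl_apply_nsRefl]
    have h2 : normVec (g y) = a • normVec (g p) + b • normVec z := by
      rw [nsPerm_apply_eq_iff] at hback hkp hky
      rw [← hback]
      conv_lhs => rw [← hab]
      rw [map_add, map_smul, map_smul, hkp, hky]
    rw [← hab, hab1] at h2
    have h3 : ((1 + b) * (1 + b)) • normVec (g y) = ((1 + b) * (1 + b)) • normVec (g p) := by
      have e2 : (1 + b) * (1 + b) = 1 + b * b := by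
        linear_combination b * two_eq_zero_of_charP_two F
      conv_lhs => rw [e2, add_smul, one_smul]
      conv_lhs => arg 1; rw [h2]
      rw [smul_add, ← add_assoc, smul_smul, smul_smul, ← add_smul, add_assoc,
        module_add_self F, add_zero]
      congr 1
      ring
    by_cases hb : b = 1
    · apply normVec_injective
      rw [← hab, hab1, hb, CharTwo.add_self_eq_zero, zero_smul, zero_add, one_smul]
    · have h4 : 1 + b ≠ 0 := fun h => hb (by
        linear_combination h - two_eq_zero_of_charP_two F)
      have h5 := smul_right_injective V (mul_ne_zero h4 h4) h3
      exact absurd (g.injective (normVec_injective h5)) hyp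
  -- Off the orthogonal case the Gram value fixes `b`, and the norm leaves a quadratic equation for
  -- `a` with roots `0` and `nsGram (g p) (g y)`.
  · have hb : b = 1 := mul_right_cancel₀ hβ (by rw [hgram, one_mul])
    rw [hb] at hQz hab
    have h1 : a * (a + nsGram (g p) (g y)) = 0 := by linear_combination hQz
    rcases mul_eq_zero.1 h1 with h2 | h2
    · left
      apply normVec_injective
      rw [← hab, h2, zero_smul, zero_add, one_smul]
    · right
      apply normVec_injective
      rw [← hab, normVec_nsRefl, one_smul, add_comm]
      congr 2
      linear_combination h2 - nsGram (g p) (g y) * two_eq_zero_of_charP_two F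

/-- The normalizer of `Ω` permutes the reflections as it permutes the points. -/
theorem apply_nsRefl_of_mem_normalizer (hQ : Q.polarBilin.Nondegenerate)
    (hd : 4 ≤ Module.finrank F V) (hF : 4 ≤ Nat.card F) {g : Equiv.Perm (NS₁ Q)}
    (hg : g ∈ Subgroup.normalizer (omegaPerm Q : Set _)) (p y : NS₁ Q) :
    g (nsRefl p y) = nsRefl (g p) (g y) := by
  rcases conj_nsRefl_apply hQ hd hF hg p y with h | h
  · rw [h]
    -- The dichotomy for `g⁻¹` rules out that `g` turns a moved point into a fixed one or
    -- conversely.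
    rcases conj_nsRefl_apply hQ hd hF (Subgroup.inv_mem _ hg) (g p) (g y) with h2 | h2
    · exact (g⁻¹.injective h2).symm
    · rw [perm_inv_apply_self, perm_inv_apply_self, Equiv.Perm.inv_eq_iff_eq] at h2
      rw [h2, h]
  · exact h

theorem nsGram_eq_zero_iff_of_mem_normalizer (hQ : Q.polarBilin.Nondegenerate)
    (hd : 4 ≤ Module.finrank F V) (hF : 4 ≤ Nat.card F) {g : Equiv.Perm (NS₁ Q)}
    (hg : g ∈ Subgroup.normalizer (omegaPerm Q : Set _)) (p y : NS₁ Q) :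
    nsGram (g p) (g y) = 0 ↔ nsGram p y = 0 := by
  rw [← nsRefl_apply_eq_self_iff, ← apply_nsRefl_of_mem_normalizer hQ hd hF hg,
    g.injective.eq_iff, nsRefl_apply_eq_self_iff]

end PointReflections

/-! ### Gram-preserving permutations are isometries -/

section GramPreserving

variable {F V : Type*} [Field F] [Finite F] [CharP F 2] [AddCommGroup V] [Module F V]
  [FiniteDimensional F V] {Q : QuadraticForm F V}

theorem eq_zero_of_polarBilin_normVec (hQ : Q.polarBilin.Nondegenerate)
    (hd : 3 ≤ Module.finrank F V) {v : V} (h : ∀ p : NS₁ Q, Q.polarBilin v (normVec p) = 0) :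
    v = 0 := by
  have h1 : (⊤ : Submodule F V) ≤ LinearMap.ker (Q.polarBilin v) := by
    rw [← span_range_normVec hQ hd, Submodule.span_le]
    rintro _ ⟨p, rfl⟩
    exact h p
  exact hQ.1 v fun y => h1 Submodule.mem_top

/-- A permutation of the non-singular points preserving the Gram function is induced by an
isometry. -/
theorem exists_nsPerm_eq_of_nsGram_eq (hQ : Q.polarBilin.Nondegenerate)
    (hd : 3 ≤ Module.finrank F V) {g : Equiv.Perm (NS₁ Q)}
    (hg : ∀ p x, nsGram (g p) (g x) = nsGram p x) : ∃ h, nsPerm Q h = g := by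
  set L : (NS₁ Q →₀ F) →ₗ[F] V := Finsupp.linearCombination F normVec with hL
  set L' : (NS₁ Q →₀ F) →ₗ[F] V := Finsupp.linearCombination F (fun p => normVec (g p)) with hL'
  have hLs : Function.Surjective L := by
    rw [← LinearMap.range_eq_top, hL, Finsupp.range_linearCombination, span_range_normVec hQ hd]
  have hLs' : Function.Surjective L' := by
    rw [← LinearMap.range_eq_top, hL', Finsupp.range_linearCombination, ← span_range_normVec hQ hd]
    congr 1
    exact g.surjective.range_comp normVec
  have hpair : ∀ f x, Q.polarBilin (L' f) (normVec (g x)) = Q.polarBilin (L f) (normVec x) := by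
    intro f x
    induction f using Finsupp.induction_linear with
    | zero => simp
    | add f₁ f₂ h₁ h₂ => rw [map_add, map_add, map_add, map_add, LinearMap.add_apply,
        LinearMap.add_apply, h₁, h₂]
    | single p c =>
      rw [hL, hL', Finsupp.linearCombination_single, Finsupp.linearCombination_single, map_smul,
        map_smul, LinearMap.smul_apply, LinearMap.smul_apply]
      congr 1
      exact hg p x
  -- A linear relation among the spanning vectors is detected by pairing with all of them, so it
  -- depends on the Gram function only. Hence the assignment on points extends linearly.
  have hker : LinearMap.ker L = LinearMap.ker L' := by
    ext f
    rw [LinearMap.mem_ker, LinearMap.mem_ker]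
    constructor
    · intro h
      apply eq_zero_of_polarBilin_normVec hQ hd
      intro p
      obtain ⟨x, rfl⟩ := g.surjective p
      rw [hpair, h, map_zero, LinearMap.zero_apply]
    · intro h
      apply eq_zero_of_polarBilin_normVec hQ hd
      intro p
      rw [← hpair, h, map_zero, LinearMap.zero_apply]
  set T : V ≃ₗ[F] V := (L.quotKerEquivOfSurjective hLs).symm.trans
    ((Submodule.quotEquivOfEq _ _ hker).trans (L'.quotKerEquivOfSurjective hLs')) with hT
  have hTL : ∀ f, T (L f) = L' f := by
    intro f
    have h1 : (L.quotKerEquivOfSurjective hLs).symm (L f) = (LinearMap.ker L).mkQ f := by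
      rw [LinearEquiv.symm_apply_eq]
      rfl
    rw [hT, LinearEquiv.trans_apply, h1]
    rfl
  have hpair' : ∀ f₁ f₂, Q.polarBilin (L' f₁) (L' f₂) = Q.polarBilin (L f₁) (L f₂) := by
    intro f₁ f₂
    induction f₂ using Finsupp.induction_linear with
    | zero => simp
    | add f₂ f₃ h₂ h₃ => rw [map_add, map_add, map_add, map_add, h₂, h₃]
    | single p c =>
      conv_lhs => rw [hL', Finsupp.linearCombination_single, map_smul, hpair]
      conv_rhs => rw [hL, Finsupp.linearCombination_single, map_smul]
  have hQT : ∀ v, Q (T v) = Q v := by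
    intro v
    obtain ⟨f, rfl⟩ := hLs v
    rw [hTL]
    induction f using Finsupp.induction_linear with
    | zero => simp
    | add f₁ f₂ h₁ h₂ => rw [map_add L', map_add L, quadraticForm_add, quadraticForm_add, h₁, h₂, hpair']
    | single p c =>
      rw [hL, hL', Finsupp.linearCombination_single, Finsupp.linearCombination_single,
        quadraticForm_smul, quadraticForm_smul, quadraticForm_normVec, quadraticForm_normVec]
  refine ⟨⟨T, hQT⟩, Equiv.ext fun p => ?_⟩
  rw [nsPerm_apply_eq_iff]
  have h := hTL (Finsupp.single p 1)
  rw [hL, hL', Finsupp.linearCombination_single, Finsupp.linearCombination_single, one_smul,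
    one_smul] at h
  exact h

end GramPreserving

/-! ### Transitivity on pairs, and the field endomorphism of a normalizing element -/

section FieldAutomorphism

variable {F V : Type*} [Field F] [Finite F] [CharP F 2] [AddCommGroup V] [Module F V]
  [FiniteDimensional F V] {Q : QuadraticForm F V}

theorem quadraticForm_normVec_add (p k : NS₁ Q) : Q (normVec p + normVec k) = nsGram p k := by
  rw [quadraticForm_add, quadraticForm_normVec, quadraticForm_normVec, nsGram,
    CharTwo.add_self_eq_zero, zero_add]

/-- The reflection in `p + k` interchanges `p` and `k`. -/
theorem nsPerm_reflIsom_add {p k : NS₁ Q} (h : Q (normVec p + normVec k) ≠ 0) :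
    nsPerm Q (reflIsom _ h) p = k := by
  rw [nsPerm_apply_eq_iff, reflIsom_apply, quadraticForm_normVec_add, map_add,
    LinearMap.add_apply, polarBilin_self, zero_add, polarBilin_comm]
  change _ + ((nsGram p k)⁻¹ * nsGram p k) • _ = _
  rw [quadraticForm_normVec_add] at h
  rw [inv_mul_cancel₀ h, one_smul, ← add_assoc, module_add_self F, zero_add]

/-- A vector space is not the union of two proper subspaces. -/
theorem exists_polarBilin_ne_zero_ne_zero {K : Submodule F V} {f f' : V →ₗ[F] F}
    (hf : ∃ a ∈ K, f a ≠ 0) (hf' : ∃ b ∈ K, f' b ≠ 0) : ∃ w ∈ K, f w ≠ 0 ∧ f' w ≠ 0 := by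
  obtain ⟨a, haK, ha⟩ := hf
  obtain ⟨b, hbK, hb⟩ := hf'
  by_cases h1 : f' a = 0
  · by_cases h2 : f b = 0
    · refine ⟨a + b, K.add_mem haK hbK, ?_, ?_⟩
      · rwa [map_add, h2, add_zero]
      · rwa [map_add, h1, zero_add]
    · exact ⟨b, hbK, h2, hb⟩
  · exact ⟨a, haK, ha, h1⟩

/-- Non-orthogonal points are interchanged by the reflection in the sum of their vectors. Orthogonal
ones become non-orthogonal after a reflection in some `w` orthogonal to neither. Parity is corrected
by the reflection in `p`, which fixes `p`. -/
theorem exists_mem_omegaGroup_apply_eq (hQ : Q.polarBilin.Nondegenerate) (hF : 4 ≤ Nat.card F)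
    (p k : NS₁ Q) : ∃ h ∈ omegaGroup Q, nsPerm Q h p = k := by
  suffices H : ∃ h, nsPerm Q h p = k by
    obtain ⟨h, hh⟩ := H
    by_cases hΩ : h ∈ omegaGroup Q
    · exact ⟨h, hΩ, hh⟩
    · refine ⟨h * pointRefl p, mul_mem_omegaGroup_of_notMem hQ hΩ
        (reflIsom_notMem_omegaGroup hQ _), ?_⟩
      rw [map_mul, Equiv.Perm.mul_apply]
      change nsPerm Q h (nsRefl p p) = k
      rwa [nsRefl_apply_eq_self_iff.2 (nsGram_self p)]
  by_cases h0 : nsGram p k = 0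
  swap
  · exact ⟨_, nsPerm_reflIsom_add (by rwa [quadraticForm_normVec_add])⟩
  obtain ⟨w, hQw, hwp, hwk⟩ : ∃ w, Q w ≠ 0 ∧ Q.polarBilin w (normVec p) ≠ 0 ∧
      Q.polarBilin w (normVec k) ≠ 0 := by
    obtain ⟨a, ha⟩ := exists_polarBilin_ne_zero hQ (normVec_ne_zero p)
    obtain ⟨b, hb⟩ := exists_polarBilin_ne_zero hQ (normVec_ne_zero k)
    obtain ⟨w, -, h1, h2⟩ := exists_polarBilin_ne_zero_ne_zero (K := ⊤)
      ⟨a, Submodule.mem_top, ha⟩ ⟨b, Submodule.mem_top, hb⟩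
    rw [polarBilin_comm] at h1 h2
    by_cases hw : Q w = 0
    · obtain ⟨t, ht0, ht, -⟩ := exists_ne_three hF 0 (Q.polarBilin w (normVec p)) 0
      refine ⟨w + t • normVec p, ?_, ?_, ?_⟩
      · rw [quadraticForm_add, quadraticForm_smul, hw, quadraticForm_normVec, map_smul,
          smul_eq_mul]
        have : (0 : F) + t * t * 1 + t * Q.polarBilin w (normVec p) =
          t * (t - Q.polarBilin w (normVec p)) := by
            linear_combination t * Q.polarBilin w (normVec p) * two_eq_zero_of_charP_two F
        rw [this]
        exact mul_ne_zero ht0 (sub_ne_zero.2 ht)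
      · rwa [map_add, map_smul, LinearMap.add_apply, LinearMap.smul_apply, polarBilin_self,
          smul_zero, add_zero]
      · rw [map_add, map_smul, LinearMap.add_apply, LinearMap.smul_apply]
        change _ + t • nsGram p k ≠ 0
        rwa [h0, smul_zero, add_zero]
    · exact ⟨w, hw, h1, h2⟩
  have h1 : Q (normVec (nsPerm Q (reflIsom w hQw) p) + normVec k) ≠ 0 := by
    rw [quadraticForm_normVec_add, nsGram, normVec_nsPerm, reflIsom_apply, map_add,
      LinearMap.add_apply, map_smul, LinearMap.smul_apply]
    change nsGram p k + _ ≠ 0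
    rw [h0, zero_add]
    exact mul_ne_zero (mul_ne_zero (inv_ne_zero hQw) hwp) hwk
  refine ⟨reflIsom _ h1 * reflIsom w hQw, ?_⟩
  rw [map_mul, Equiv.Perm.mul_apply, nsPerm_reflIsom_add]

/-- The same device is carried out with reflections in vectors orthogonal to `p`; equal Gram values
make the sum of `x` and `y` such a vector. -/
theorem exists_mem_omegaGroup_apply_eq_of_nsGram_eq (hQ : Q.polarBilin.Nondegenerate)
    (hd : 4 ≤ Module.finrank F V) (hF : 4 ≤ Nat.card F) {p x y : NS₁ Q}
    (h0 : nsGram p x ≠ 0) (hxy : nsGram p y = nsGram p x) :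
    ∃ h ∈ omegaGroup Q, nsPerm Q h p = p ∧ nsPerm Q h x = y := by
  suffices H : ∃ h, nsPerm Q h p = p ∧ nsPerm Q h x = y by
    obtain ⟨h, hhp, hhx⟩ := H
    by_cases hΩ : h ∈ omegaGroup Q
    · exact ⟨h, hΩ, hhp, hhx⟩
    · obtain ⟨w, hw, hQw⟩ := exists_orthogonal_pair_nonsingular hQ hd
        (quadraticForm_normVec_ne_zero p) (normVec x)
      rw [mem_orthogonal_span_polarBilin] at hw
      refine ⟨h * reflIsom w hQw, mul_mem_omegaGroup_of_notMem hQ hΩ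
        (reflIsom_notMem_omegaGroup hQ _), ?_, ?_⟩
      · rw [map_mul, Equiv.Perm.mul_apply, nsPerm_apply_eq_iff.2
          (reflIsom_apply_of_orthogonal hQw (by rw [polarBilin_comm, hw _ (by simp)])), hhp]
      · rw [map_mul, Equiv.Perm.mul_apply, nsPerm_apply_eq_iff.2
          (reflIsom_apply_of_orthogonal hQw (by rw [polarBilin_comm, hw _ (by simp)])), hhx]
  have key : ∀ {x y : NS₁ Q}, nsGram p y = nsGram p x → nsGram x y ≠ 0 →
      ∃ h, nsPerm Q h p = p ∧ nsPerm Q h x = y := by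
    intro x y hxy h
    have h1 : Q (normVec x + normVec y) ≠ 0 := by rwa [quadraticForm_normVec_add]
    refine ⟨_, nsPerm_apply_eq_iff.2 (reflIsom_apply_of_orthogonal h1 ?_),
      nsPerm_reflIsom_add h1⟩
    rw [polarBilin_comm, map_add]
    change nsGram p x + nsGram p y = 0
    rw [hxy, CharTwo.add_self_eq_zero]
  by_cases hβ : nsGram x y = 0
  swap
  · exact key hxy hβ
  obtain ⟨w, hQw, hwp, hwx, hwy⟩ : ∃ w, Q w ≠ 0 ∧ Q.polarBilin w (normVec p) = 0 ∧
      Q.polarBilin w (normVec x) ≠ 0 ∧ Q.polarBilin w (normVec y) ≠ 0 := by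
    have hne : ∀ z : NS₁ Q, nsGram p z ≠ 0 → ∃ a ∈ LinearMap.BilinForm.orthogonal Q.polarBilin
        (Submodule.span F {normVec p}), Q.polarBilin (normVec z) a ≠ 0 := by
      intro z hz
      have hzp : normVec z ∉ Submodule.span F {normVec p} := by
        intro h
        obtain ⟨c, hc⟩ := Submodule.mem_span_singleton.1 h
        apply hz
        rw [nsGram, ← hc, map_smul, polarBilin_self, smul_zero]
      obtain ⟨u, hu, huz⟩ := exists_mem_orthogonal_polarBilin_ne_zero hQ hzp
      exact ⟨u, hu, by rwa [polarBilin_comm]⟩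
    obtain ⟨w, hwp, h1, h2⟩ := exists_polarBilin_ne_zero_ne_zero (hne x h0)
      (hne y (by rwa [hxy]))
    rw [mem_orthogonal_span_polarBilin] at hwp
    replace hwp : Q.polarBilin w (normVec p) = 0 := by
      rw [polarBilin_comm, hwp _ (by simp)]
    rw [polarBilin_comm] at h1 h2
    by_cases hw : Q w = 0
    · obtain ⟨t, ht0, htx, hty⟩ := exists_ne_three hF 0
        (Q.polarBilin w (normVec x) / nsGram p x) (Q.polarBilin w (normVec y) / nsGram p x)
      have hval : ∀ z : NS₁ Q, nsGram p z = nsGram p x →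
          t ≠ Q.polarBilin w (normVec z) / nsGram p x →
          Q.polarBilin (w + t • normVec p) (normVec z) ≠ 0 := by
        intro z hz ht h
        apply ht
        rw [map_add, map_smul, LinearMap.add_apply, LinearMap.smul_apply, smul_eq_mul] at h
        change _ + t * nsGram p z = 0 at h
        rw [eq_div_iff h0, ← hz]
        linear_combination h - Q.polarBilin w (normVec z) * two_eq_zero_of_charP_two F
      refine ⟨w + t • normVec p, ?_, ?_, hval x rfl htx, hval y hxy hty⟩
      · rw [quadraticForm_add, quadraticForm_smul, hw, quadraticForm_normVec, map_smul, hwp,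
          smul_zero, zero_add, mul_one, add_zero]
        exact mul_ne_zero ht0 ht0
      · rw [map_add, map_smul, LinearMap.add_apply, LinearMap.smul_apply, polarBilin_self,
          smul_zero, add_zero, hwp]
    · exact ⟨w, hw, hwp, h1, h2⟩
  have hp : nsPerm Q (reflIsom w hQw) p = p :=
    nsPerm_apply_eq_iff.2 (reflIsom_apply_of_orthogonal hQw hwp)
  obtain ⟨h, hhp, hhx⟩ := key (x := nsPerm Q (reflIsom w hQw) x) (y := y)
    (by
      rw [hxy]
      conv_rhs => rw [← hp]
      rw [nsGram_nsPerm])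
    (by
      rw [nsGram, normVec_nsPerm, reflIsom_apply, map_add, LinearMap.add_apply, map_smul,
        LinearMap.smul_apply]
      change nsGram x y + _ ≠ 0
      rw [hβ, zero_add]
      exact mul_ne_zero (mul_ne_zero (inv_ne_zero hQw) hwx) hwy)
  refine ⟨h * reflIsom w hQw, ?_, ?_⟩
  · rw [map_mul, Equiv.Perm.mul_apply, hp, hhp]
  · rw [map_mul, Equiv.Perm.mul_apply, hhx]

/-- `Ω` is transitive on pairs of non-orthogonal points with given Gram value. -/
theorem exists_mem_omegaGroup_pair (hQ : Q.polarBilin.Nondegenerate)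
    (hd : 4 ≤ Module.finrank F V) (hF : 4 ≤ Nat.card F) {p x k y : NS₁ Q}
    (h0 : nsGram p x ≠ 0) (h : nsGram k y = nsGram p x) :
    ∃ h ∈ omegaGroup Q, nsPerm Q h p = k ∧ nsPerm Q h x = y := by
  obtain ⟨h₁, hh₁, hp⟩ := exists_mem_omegaGroup_apply_eq hQ hF p k
  have h1 : nsGram k (nsPerm Q h₁ x) = nsGram p x := by rw [← hp, nsGram_nsPerm]
  obtain ⟨h₂, hh₂, hk, hx⟩ := exists_mem_omegaGroup_apply_eq_of_nsGram_eq hQ hd hF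
    (p := k) (x := nsPerm Q h₁ x) (y := y) (by rwa [h1]) (by rw [h1, h])
  refine ⟨h₂ * h₁, Subgroup.mul_mem _ hh₂ hh₁, ?_, ?_⟩
  · rw [map_mul, Equiv.Perm.mul_apply, hp, hk]
  · rw [map_mul, Equiv.Perm.mul_apply, hx]

/-- A vector with the right product exists by non-degeneracy. Adding a multiple of a non-singular
vector orthogonal to it and to `p` corrects its norm. -/
theorem exists_nsGram_eq (hQ : Q.polarBilin.Nondegenerate) (hd : 4 ≤ Module.finrank F V)
    (p : NS₁ Q) (a : F) : ∃ x, nsGram p x = a := by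
  obtain ⟨z, hz⟩ := exists_polarBilin_ne_zero hQ (normVec_ne_zero p)
  obtain ⟨y, hy⟩ : ∃ y, Q.polarBilin (normVec p) y = a :=
    ⟨(a / Q.polarBilin (normVec p) z) • z, by rw [map_smul, smul_eq_mul, div_mul_cancel₀ _ hz]⟩
  obtain ⟨w, hw, hQw⟩ := exists_orthogonal_pair_nonsingular hQ hd
    (quadraticForm_normVec_ne_zero p) y
  rw [mem_orthogonal_span_polarBilin] at hw
  obtain ⟨t, ht⟩ := exists_mul_self_eq ((1 - Q y) / Q w)
  obtain ⟨x, hx⟩ := exists_normVec_eq (Q := Q) (v := y + t • w) (by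
    rw [quadraticForm_add, quadraticForm_smul, ht, map_smul, hw _ (by simp), smul_zero,
      div_mul_cancel₀ _ hQw]
    ring)
  exact ⟨x, by rw [nsGram, hx, map_add, map_smul, hw _ (by simp), smul_zero, add_zero, hy]⟩

theorem exists_nsGram_eq_of_ne_zero (hQ : Q.polarBilin.Nondegenerate)
    (hd : 4 ≤ Module.finrank F V) {p x : NS₁ Q} (h0 : nsGram p x ≠ 0) (b c : F) :
    ∃ y, nsGram p y = c ∧ nsGram x y = b := by
  have h0' : Q.polarBilin (normVec p) (normVec x) ≠ 0 := h0
  set v := (b / nsGram p x) • normVec p + (c / nsGram p x) • normVec x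
  have hpv : Q.polarBilin (normVec p) v = c := by
    rw [map_add, map_smul, map_smul, polarBilin_self, smul_zero, zero_add, smul_eq_mul]
    exact div_mul_cancel₀ _ h0
  have hxv : Q.polarBilin (normVec x) v = b := by
    rw [map_add, map_smul, map_smul, polarBilin_self, smul_zero, add_zero, smul_eq_mul,
      polarBilin_comm]
    exact div_mul_cancel₀ _ h0
  obtain ⟨w, hw, hQw⟩ := exists_orthogonal_pair_nonsingular hQ hd
    (quadraticForm_normVec_ne_zero p) (normVec x)
  rw [mem_orthogonal_polarBilin] at hw
  have hwp := hw (normVec p) (Submodule.subset_span (by simp))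
  have hwx := hw (normVec x) (Submodule.subset_span (by simp))
  have hwv := hw v (Submodule.add_mem _ (Submodule.smul_mem _ _ (Submodule.subset_span (by simp)))
    (Submodule.smul_mem _ _ (Submodule.subset_span (by simp))))
  obtain ⟨t, ht⟩ := exists_mul_self_eq ((1 - Q v) / Q w)
  obtain ⟨y, hy⟩ := exists_normVec_eq (Q := Q) (v := v + t • w) (by
    rw [quadraticForm_add, quadraticForm_smul, ht, map_smul, hwv, smul_zero,
      div_mul_cancel₀ _ hQw]
    ring)
  refine ⟨y, ?_, ?_⟩
  · rw [nsGram, hy, map_add, map_smul, hwp, smul_zero, add_zero, hpv]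
  · rw [nsGram, hy, map_add, map_smul, hwx, smul_zero, add_zero, hxv]

theorem exists_nsGram_triple (hQ : Q.polarBilin.Nondegenerate)
    (hd : 4 ≤ Module.finrank F V) (p₀ : NS₁ Q) {a b c : F} (h : a ≠ 0 ∨ b ≠ 0 ∨ c ≠ 0) :
    ∃ p x y : NS₁ Q, nsGram p x = a ∧ nsGram x y = b ∧ nsGram p y = c := by
  rcases h with h | h | h
  · obtain ⟨x, hx⟩ := exists_nsGram_eq hQ hd p₀ a
    obtain ⟨y, h1, h2⟩ := exists_nsGram_eq_of_ne_zero hQ hd (hx ▸ h) b c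
    exact ⟨p₀, x, y, hx, h2, h1⟩
  · obtain ⟨x, hx⟩ := exists_nsGram_eq hQ hd p₀ b
    obtain ⟨y, h1, h2⟩ := exists_nsGram_eq_of_ne_zero hQ hd (hx ▸ h) c a
    exact ⟨y, p₀, x, by rw [nsGram_comm, h1], hx, by rw [nsGram_comm, h2]⟩
  · obtain ⟨x, hx⟩ := exists_nsGram_eq hQ hd p₀ c
    obtain ⟨y, h1, h2⟩ := exists_nsGram_eq_of_ne_zero hQ hd (hx ▸ h) b a
    exact ⟨p₀, y, x, h1, by rw [nsGram_comm, h2], hx⟩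

/-- An element of the normalizer of `Ω` changes the Gram function by a field endomorphism. -/
theorem exists_ringHom_of_mem_normalizer (hQ : Q.polarBilin.Nondegenerate)
    (hd : 4 ≤ Module.finrank F V) (hF : 4 ≤ Nat.card F) {g : Equiv.Perm (NS₁ Q)}
    (hg : g ∈ Subgroup.normalizer (omegaPerm Q : Set _)) :
    ∃ σ : F →+* F, ∀ p x, nsGram (g p) (g x) = σ (nsGram p x) := by
  obtain ⟨p₀, -⟩ := exists_normVec_notMem hQ (by omega) (W := ⊥)
    (fun h => by
      have h2 := finrank_bot F V
      rw [h, finrank_top] at h2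
      omega)
  -- The new Gram value depends only on the old one: `Ω` is transitive on pairs with a given
  -- non-zero value, and orthogonality is preserved.
  have h1 : ∀ t, ∃ s, ∀ p x, nsGram p x = t → nsGram (g p) (g x) = s := by
    intro t
    by_cases ht : t = 0
    · exact ⟨0, fun p x h =>
        (nsGram_eq_zero_iff_of_mem_normalizer hQ hd hF hg p x).2 (h.trans ht)⟩
    · obtain ⟨x₀, hx₀⟩ := exists_nsGram_eq hQ hd p₀ t
      refine ⟨nsGram (g p₀) (g x₀), fun p x h => ?_⟩
      obtain ⟨k, hk, rfl, rfl⟩ := exists_mem_omegaGroup_pair hQ hd hF (hx₀ ▸ ht)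
        (h.trans hx₀.symm)
      obtain ⟨m, hm, hmg⟩ := exists_conj_of_mem_normalizer hg hk
      rw [← hmg, ← hmg, nsGram_nsPerm]
  choose σ hσ using h1
  have h0 : σ 0 = 0 := by rw [← hσ 0 p₀ p₀ (nsGram_self _), nsGram_self]
  -- The formula `nsGram_nsRefl` encodes addition and multiplication together. Since `g` respects
  -- reflections and all triples of Gram values not all zero occur, `σ` inherits both.
  have key : ∀ a b c, σ (a + b * c) = σ a + σ b * σ c := by
    intro a b c
    by_cases h : a ≠ 0 ∨ b ≠ 0 ∨ c ≠ 0
    · have h' : c ≠ 0 ∨ b ≠ 0 ∨ a ≠ 0 := by tauto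
      obtain ⟨p, x, y, hpx, hxy, hpy⟩ := exists_nsGram_triple hQ hd p₀ h'
      have h2 := nsGram_nsRefl (g p) (g x) (g y)
      rw [← apply_nsRefl_of_mem_normalizer hQ hd hF hg, hσ _ _ _ hpx, hσ _ _ _ hxy, hσ _ _ _ hpy,
        hσ _ _ _ (nsGram_nsRefl p x y), hpx, hxy, hpy] at h2
      exact h2
    · push Not at h
      rw [h.1, h.2.1, h.2.2, mul_zero, add_zero, h0, mul_zero, add_zero]
  have h1 : σ 1 = 1 := by
    have h2 := key 0 1 1
    rw [zero_add, one_mul, h0, zero_add] at h2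
    obtain ⟨x, hx⟩ := exists_nsGram_eq hQ hd p₀ 1
    have h3 : σ 1 ≠ 0 := by
      rw [← hσ 1 p₀ x hx, Ne, nsGram_eq_zero_iff_of_mem_normalizer hQ hd hF hg, hx]
      exact one_ne_zero
    exact mul_left_cancel₀ h3 (by rw [mul_one]; exact h2.symm)
  have hmul : ∀ a b, σ (a * b) = σ a * σ b := by
    intro a b
    have h2 := key 0 a b
    rwa [zero_add, h0, zero_add] at h2
  have hadd : ∀ a b, σ (a + b) = σ a + σ b := by
    intro a b
    have h2 := key a b 1
    rwa [mul_one, h1, mul_one] at h2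
  exact ⟨RingHom.mk' ⟨⟨σ, h1⟩, hmul⟩ hadd, fun p x => hσ _ p x rfl⟩

end FieldAutomorphism

/-! ### Endomorphisms of finite fields of characteristic two -/

section FiniteFieldEndomorphisms

variable {F : Type*} [Field F] [Finite F] [CharP F 2]

theorem exists_ringHom_apply_eq_pow (σ : F →+* F) : ∃ n : ℕ, ∀ c, σ c = c ^ 2 ^ n := by
  let _ : Algebra (ZMod 2) F := ZMod.algebra F 2
  let τ : F →ₐ[ZMod 2] F := AlgHom.mk σ fun r => congrArg (fun f : ZMod 2 →+* F => f r)
    (Subsingleton.elim (σ.comp (algebraMap (ZMod 2) F)) (algebraMap (ZMod 2) F))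
  obtain ⟨n, hn⟩ := (FiniteField.bijective_frobeniusAlgHom_pow (ZMod 2) F).2 τ
  refine ⟨n, fun c => ?_⟩
  have h : (FiniteField.frobeniusAlgHom (ZMod 2) F ^ (n : ℕ)) c = τ c := by rw [← hn]
  change τ c = _
  rw [← h]
  have h2 : ∀ m : ℕ, (FiniteField.frobeniusAlgHom (ZMod 2) F ^ m) c = c ^ 2 ^ m := by
    intro m
    induction m with
    | zero => simp
    | succ m ih =>
      rw [pow_succ', AlgHom.mul_apply, ih, FiniteField.frobeniusAlgHom_apply, ZMod.card,
        ← pow_mul, pow_succ]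
  exact h2 n

/-- `σ` is a power of the Frobenius map, so `σ c + c` telescopes with `a = c + c ^ 2 + ... + c ^ 2 ^
(n - 1)`. -/
theorem exists_artinSchreier_eq (σ : F →+* F) (c : F) : ∃ a : F, a * a + a = σ c + c := by
  obtain ⟨n, hn⟩ := exists_ringHom_apply_eq_pow σ
  rw [hn]
  clear hn
  induction n with
  | zero => exact ⟨0, by rw [pow_zero, pow_one, CharTwo.add_self_eq_zero]; ring⟩
  | succ n ih =>
    obtain ⟨a, ha⟩ := ih
    refine ⟨c ^ 2 ^ n + a, ?_⟩
    rw [pow_succ 2 n, pow_mul]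
    linear_combination ha + (c ^ 2 ^ n * a + c ^ 2 ^ n) * two_eq_zero_of_charP_two F

/-- Any generator of the cyclic group `Fˣ` serves. -/
theorem exists_forall_ringHom_eq_id (F : Type*) [Field F] [Finite F] :
    ∃ θ : F, θ ≠ 0 ∧ ∀ σ : F →+* F, σ θ = θ → ∀ c, σ c = c := by
  obtain ⟨u, hu⟩ := IsCyclic.exists_generator (α := Fˣ)
  refine ⟨u, u.ne_zero, fun σ hσ c => ?_⟩
  by_cases hc : c = 0
  · rw [hc, map_zero]
  · obtain ⟨n, hn⟩ := Subgroup.mem_zpowers_iff.1 (hu (Units.mk0 c hc))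
    have h : c = (u : F) ^ n := by
      rw [← Units.val_zpow_eq_zpow_val, hn, Units.val_mk0]
    rw [h, map_zpow₀, hσ]

end FiniteFieldEndomorphisms

/-! ### Semilinear permutations fixing an orthogonal sequence -/

section SemilinearPermutation

variable {F V : Type*} [Field F] [Finite F] [CharP F 2] [AddCommGroup V] [Module F V]
  [FiniteDimensional F V] {Q : QuadraticForm F V}

/-- If two families of vectors, the first of them a basis, are related by the field endomorphism
`σ`, then there is a permutation of the non-singular points changing the Gram function by `σ` and
mapping the points of the first family to those of the second. -/
theorem exists_perm_of_semilinear (hQ : Q.polarBilin.Nondegenerate)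
    (hd : 3 ≤ Module.finrank F V) {ι : Type*} [Fintype ι] (σ : F →+* F) (b : Module.Basis ι F V)
    (b' : ι → V) (h1 : ∀ i, Q (b' i) = σ (Q (b i)))
    (h2 : ∀ i j, Q.polarBilin (b' i) (b' j) = σ (Q.polarBilin (b i) (b j))) :
    ∃ s : Equiv.Perm (NS₁ Q), (∀ p x, nsGram (s p) (s x) = σ (nsGram p x)) ∧
      ∀ p i, normVec p = b i → normVec (s p) = b' i := by
  classical
  set T : V → V := fun v => ∑ i, σ (b.repr v i) • b' i with hT
  have hsum : ∀ (c e : ι → F) (s s' : Finset ι),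
      Q.polarBilin (∑ i ∈ s, σ (c i) • b' i) (∑ i ∈ s', σ (e i) • b' i) =
        σ (Q.polarBilin (∑ i ∈ s, c i • b i) (∑ i ∈ s', e i • b i)) := by
    intro c e s s'
    simp only [map_sum, map_smul, LinearMap.sum_apply, LinearMap.smul_apply, smul_eq_mul, h2,
      map_mul]
  have hQsum : ∀ (c : ι → F) (s : Finset ι),
      Q (∑ i ∈ s, σ (c i) • b' i) = σ (Q (∑ i ∈ s, c i • b i)) := by
    intro c s
    induction s using Finset.induction_on with
    | empty => simp
    | insert a s ha ih =>
      have h3 := hsum c c {a} s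
      rw [Finset.sum_singleton, Finset.sum_singleton] at h3
      rw [Finset.sum_insert ha, Finset.sum_insert ha, quadraticForm_add, quadraticForm_add, ih, h3,
        quadraticForm_smul, quadraticForm_smul, h1]
      simp only [map_add, map_mul]
  have hQT : ∀ v, Q (T v) = σ (Q v) := by
    intro v
    rw [hT]
    change Q (∑ i, σ (b.repr v i) • b' i) = _
    rw [hQsum, b.sum_repr]
  have hBT : ∀ v w, Q.polarBilin (T v) (T w) = σ (Q.polarBilin v w) := by
    intro v w
    rw [hT]
    change Q.polarBilin (∑ i, σ (b.repr v i) • b' i) (∑ i, σ (b.repr w i) • b' i) = _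
    rw [hsum, b.sum_repr, b.sum_repr]
  have hex : ∀ p : NS₁ Q, ∃ p' : NS₁ Q, normVec p' = T (normVec p) := fun p =>
    exists_normVec_eq (by rw [hQT, quadraticForm_normVec, map_one])
  choose s hs using hex
  have hgram : ∀ p x, nsGram (s p) (s x) = σ (nsGram p x) := by
    intro p x
    rw [nsGram, hs, hs, hBT, nsGram]
  have hinj : Function.Injective s := by
    intro p x hpx
    apply normVec_injective
    rw [← sub_eq_zero]
    apply eq_zero_of_polarBilin_normVec hQ hd
    intro y
    rw [map_sub, LinearMap.sub_apply, sub_eq_zero]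
    apply σ.injective
    change σ (nsGram p y) = σ (nsGram x y)
    rw [← hgram, ← hgram, hpx]
  refine ⟨Equiv.ofBijective s (Finite.injective_iff_bijective.1 hinj), hgram, fun p i hp => ?_⟩
  change normVec (s p) = b' i
  rw [hs, hp, hT]
  change ∑ j, σ (b.repr (b i) j) • b' j = b' i
  rw [Finset.sum_eq_single i]
  · rw [b.repr_self, Finsupp.single_eq_same, map_one, one_smul]
  · intro j _ hj
    rw [b.repr_self, Finsupp.single_eq_of_ne hj, map_zero, zero_smul]
  · exact fun h => absurd (Finset.mem_univ i) h

/-- For every field endomorphism there is a permutation of the points inducing it and fixing all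
points of a given orthogonal sequence. -/
theorem IsOrthoSeq.exists_perm (hQ : Q.polarBilin.Nondegenerate)
    (hd : 3 ≤ Module.finrank F V) {p₀ : NS₁ Q} {l : List (NS₁ Q)} (hl : IsOrthoSeq p₀ l)
    (hlen : l.length + 1 = Module.finrank F V) (σ : F →+* F) :
    ∃ s : Equiv.Perm (NS₁ Q), (∀ p x, nsGram (s p) (s x) = σ (nsGram p x)) ∧ ∀ p ∈ l, s p = p := by
  classical
  have hind := linearIndependent_of_finrank_nsSpan hl.finrank_eq
  -- The vector `e` completes `l` to a basis in which all polar products are `0` or `1`, hence fixed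
  -- by `σ`. Only the value `Q e` may change.
  obtain ⟨e, he⟩ := exists_polarBilin_eq hQ hind fun i => if l[i] = p₀ then 1 else 0
  have he01 : ∀ p ∈ l, Q.polarBilin (normVec p) e = if p = p₀ then 1 else 0 := by
    intro p hp
    obtain ⟨i, hi, rfl⟩ := List.getElem_of_mem hp
    rw [polarBilin_comm]
    exact he ⟨i, hi⟩
  have hew : Q.polarBilin (normVec p₀) e = 1 := by rw [he01 _ hl.mem, if_pos rfl]
  set v : Option (Fin l.length) → V := fun o => o.elim e fun i => normVec l[i] with hv
  have hrange : Submodule.span F (Set.range fun i : Fin l.length => normVec l[i]) ≤ nsSpan l := by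
    rw [Submodule.span_le]
    rintro _ ⟨i, rfl⟩
    exact normVec_mem_nsSpan (List.getElem_mem _)
  have hvind : LinearIndependent F v := by
    rw [linearIndependent_option]
    refine ⟨hind, fun h => ?_⟩
    have h2 := polarBilin_eq_zero_of_mem_nsSpan hl.orth (hrange h)
    exact one_ne_zero (hew.symm.trans h2)
  set b := basisOfLinearIndependentOfCardEqFinrank hvind (by
    rw [Fintype.card_option, Fintype.card_fin, hlen]) with hb
  have hbv : ∀ o, b o = v o := fun o => by
    rw [hb, coe_basisOfLinearIndependentOfCardEqFinrank]
  -- `Q (e + c • normVec p₀) = Q e + c * c + c`, so solving this equation moves `Q e` to `σ (Q e)`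
  -- without touching the other products.
  obtain ⟨c, hc⟩ := exists_artinSchreier_eq σ (Q e)
  set v' : Option (Fin l.length) → V := fun o => o.elim (e + c • normVec p₀) fun i => normVec l[i]
    with hv'
  have hmem : ∀ i : Fin l.length, l[i] ∈ l := fun i => List.getElem_mem i.2
  have hσ01 : ∀ t : F, t = 0 ∨ t = 1 → σ t = t := by
    rintro t (rfl | rfl)
    · exact map_zero σ
    · exact map_one σ
  have hsn : ∀ i : Fin l.length, Q.polarBilin (normVec l[i]) (e + c • normVec p₀) =
      σ (Q.polarBilin (normVec l[i]) e) := by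
    intro i
    rw [map_add, map_smul, polarBilin_comm _ (normVec p₀), hl.orth _ (hmem i),
      smul_zero, add_zero, he01 _ (hmem i)]
    split_ifs
    · exact (map_one σ).symm
    · exact (map_zero σ).symm
  obtain ⟨s, hs1, hs2⟩ := exists_perm_of_semilinear hQ hd σ b v' (by
    rintro (_ | i)
    · rw [hbv]
      change Q (e + c • normVec p₀) = σ (Q e)
      rw [quadraticForm_add, quadraticForm_smul, quadraticForm_normVec, map_smul, polarBilin_comm,
        hew, smul_eq_mul]
      linear_combination hc + Q e * two_eq_zero_of_charP_two F
    · rw [hbv]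
      change Q (normVec l[i]) = σ (Q (normVec l[i]))
      rw [quadraticForm_normVec, map_one]) (by
    rintro (_ | i) (_ | j) <;> simp only [hbv]
    · change Q.polarBilin (e + c • normVec p₀) (e + c • normVec p₀) = σ (Q.polarBilin e e)
      rw [polarBilin_self, polarBilin_self, map_zero]
    · change Q.polarBilin (e + c • normVec p₀) (normVec l[j]) = σ (Q.polarBilin e (normVec l[j]))
      rw [polarBilin_comm, hsn, polarBilin_comm e]
    · exact hsn i
    · exact (hσ01 _ (hl.gram _ (hmem i) _ (hmem j))).symm)
  refine ⟨s, hs1, fun p hp => ?_⟩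
  obtain ⟨i, hi, rfl⟩ := List.getElem_of_mem hp
  exact normVec_injective (hs2 l[i] (some ⟨i, hi⟩) (hbv (some ⟨i, hi⟩)).symm)

end SemilinearPermutation

/-! ### Short sequences with prescribed span -/

section SpanningSequences

variable {F V : Type*} [Field F] [Finite F] [CharP F 2] [AddCommGroup V] [Module F V]
  [FiniteDimensional F V] {Q : QuadraticForm F V}

/-- An independent sequence of points in `K` extends to one of any length up to `dim K`, if the
non-singular vectors span `K`. -/
theorem exists_append_finrank_nsSpan {K : Submodule F V}
    (hK : ∀ W < K, ∃ x ∈ K, x ∉ W ∧ Q x ≠ 0) {l : List (NS₁ Q)} (hlK : nsSpan l ≤ K)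
    (hl : Module.finrank F (nsSpan l) = l.length) {n : ℕ} (hn : l.length ≤ n)
    (hnK : n ≤ Module.finrank F K) :
    ∃ l', (l ++ l').length = n ∧ nsSpan (l ++ l') ≤ K ∧ Module.finrank F (nsSpan (l ++ l')) = n := by
  induction n, hn using Nat.le_induction with
  | base => exact ⟨[], by simp, by rwa [List.append_nil], by rwa [List.append_nil]⟩
  | succ n hn ih =>
    obtain ⟨l', h1, h2, h3⟩ := ih (by omega)
    obtain ⟨x, hxK, hx, hQx⟩ := hK (nsSpan (l ++ l')) (lt_of_le_of_ne h2 fun e => by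
      rw [e] at h3
      omega)
    obtain ⟨p, c, hc, hp⟩ := exists_normVec_eq_smul hQx
    have hpl : normVec p ∉ nsSpan (l ++ l') := fun h => hx ((Submodule.smul_mem_iff _ hc).1 (hp ▸ h))
    refine ⟨l' ++ [p], ?_, ?_, ?_⟩
    · rw [← List.append_assoc, List.length_append, h1, List.length_singleton]
    · rw [← List.append_assoc, nsSpan_append_singleton]
      refine sup_le h2 ((Submodule.span_singleton_le_iff_mem _ _).2 ?_)
      rw [hp]
      exact K.smul_mem c hxK
    · rw [← List.append_assoc, finrank_nsSpan_append_singleton hpl, h3]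

theorem exists_nsSpan_eq {K : Submodule F V} (hK : ∀ W < K, ∃ x ∈ K, x ∉ W ∧ Q x ≠ 0) :
    ∃ l : List (NS₁ Q), l.length = Module.finrank F K ∧ nsSpan l = K := by
  obtain ⟨l, h1, h2, h3⟩ := exists_append_finrank_nsSpan hK (l := []) (by simp)
    (by rw [nsSpan_nil, finrank_bot, List.length_nil]) (Nat.zero_le _) le_rfl
  exact ⟨l, h1, Submodule.eq_of_le_of_finrank_eq h2 h3⟩

theorem exists_finrank_nsSpan_of_nsGram_ne_zero (hQ : Q.polarBilin.Nondegenerate)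
    (hd : 3 ≤ Module.finrank F V) {p x : NS₁ Q} (h : nsGram p x ≠ 0) {n : ℕ} (hn : 2 ≤ n)
    (hnd : n ≤ Module.finrank F V) :
    ∃ l : List (NS₁ Q), p ∈ l ∧ x ∈ l ∧ l.length = n ∧ Module.finrank F (nsSpan l) = n := by
  have h1 : Module.finrank F (nsSpan [p]) = 1 := by
    have h1 := finrank_nsSpan_append_singleton (l := []) (p := p)
      (by simpa using normVec_ne_zero p)
    rw [nsSpan_nil, finrank_bot] at h1
    exact h1
  have h2 : Module.finrank F (nsSpan [p, x]) = 2 := by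
    have h2 := finrank_nsSpan_append_singleton (l := [p]) (p := x) (by
      intro hx
      refine h (polarBilin_eq_zero_of_mem_nsSpan (l := [p]) (p₀ := p) (fun y hy => ?_) hx)
      rw [List.mem_singleton.1 hy, polarBilin_self])
    rw [h1] at h2
    exact h2
  obtain ⟨l', h3, -, h5⟩ := exists_append_finrank_nsSpan (K := (⊤ : Submodule F V))
    (fun W hW => (exists_notMem_quadraticForm_ne_zero hQ hd hW.ne).imp fun x hx =>
      ⟨Submodule.mem_top, hx⟩) (l := [p, x]) le_top h2 hn (by rwa [finrank_top])
  exact ⟨_, by simp, by simp, h3, h5⟩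

theorem IsOrthoSeq.exists_ne {p₀ : NS₁ Q} {l : List (NS₁ Q)} (hl : IsOrthoSeq p₀ l)
    (hlen : 2 ≤ l.length) : ∃ p ∈ l, p ≠ p₀ := by
  by_contra! h
  have h1 : nsSpan l ≤ Submodule.span F {normVec p₀} := nsSpan_le_iff.2 fun p hp => by
    rw [h p hp]
    exact Submodule.mem_span_singleton_self _
  have h2 := Submodule.finrank_mono h1
  rw [finrank_span_singleton (normVec_ne_zero p₀), hl.finrank_eq] at h2
  omega

theorem exists_nsPoint (hQ : Q.polarBilin.Nondegenerate) (hd : 3 ≤ Module.finrank F V) :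
    Nonempty (NS₁ Q) := by
  obtain ⟨p₀, -⟩ := exists_normVec_notMem hQ hd (W := ⊥) (fun h => by
    have h2 := finrank_bot F V
    rw [h, finrank_top] at h2
    omega)
  exact ⟨p₀⟩

/-- The sum of two distinct orthogonal vectors of norm one is singular. -/
theorem exists_singular_ne_zero (hQ : Q.polarBilin.Nondegenerate)
    (hd : 3 ≤ Module.finrank F V) : ∃ e : V, e ≠ 0 ∧ Q e = 0 := by
  obtain ⟨p₀⟩ := exists_nsPoint hQ hd
  obtain ⟨l, hl, hlen⟩ := exists_isOrthoSeq hQ hd p₀ (n := 2) (by omega) (by omega)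
  obtain ⟨p, hp, hne⟩ := hl.exists_ne hlen.ge
  refine ⟨normVec p₀ + normVec p, fun h => hne (normVec_injective ?_), ?_⟩
  · rw [← module_sub_eq_add F, sub_eq_zero] at h
    exact h.symm
  · rw [quadraticForm_normVec_add]
    exact hl.orth p hp

/-- An isometry fixing pointwise the hyperplane orthogonal to a singular vector is trivial. -/
theorem eq_one_of_singular_hyperplane_fixed (hQ : Q.polarBilin.Nondegenerate) {e : V}
    (hQe : Q e = 0) {g : isometryGroup Q}
    (hg : LinearMap.BilinForm.orthogonal Q.polarBilin (Submodule.span F {e}) ≤ fixedSpace g) :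
    g = 1 := by
  refine isometry_ext fun x => ?_
  change g.1 x = x
  by_cases hx : Q.polarBilin e x = 0
  · exact mem_fixedSpace.1 (hg (mem_orthogonal_span_polarBilin.2 fun w hw => by
      rw [Set.mem_singleton_iff.1 hw, hx]))
  -- Thus `g x = x + c • e`, and preserving `Q` gives `c * B(e, x) = 0`. A transvection with
  -- singular centre is not an isometry.
  · have h1 : g.1 x - x ∈ Submodule.span F {e} := by
      rw [← LinearMap.BilinForm.orthogonal_orthogonal hQ isRefl_polarBilin (Submodule.span F {e}),
        mem_orthogonal_polarBilin]
      intro w hw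
      rw [polarBilin_comm]
      exact polarBilin_sub_eq_zero_of_fixed (mem_fixedSpace.1 (hg hw)) x
    obtain ⟨c, hc⟩ := Submodule.mem_span_singleton.1 h1
    have h2 : g.1 x = c • e + x := by rw [hc, sub_add_cancel]
    have h3 := g.2 x
    rw [h2, quadraticForm_add, quadraticForm_smul, hQe, mul_zero, zero_add, map_smul,
      LinearMap.smul_apply, add_eq_left, smul_eq_mul, mul_eq_zero, or_iff_left hx] at h3
    rw [h2, h3, zero_smul, zero_add]

/-- The hyperplane is too large to be totally isotropic, so it contains a non-singular `x₁`. If `x₁`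
lies in `W`, adding a suitable multiple of a vector outside `W` leaves `W` and keeps it
non-singular. -/
theorem exists_mem_singular_hyperplane_nonsingular (hQ : Q.polarBilin.Nondegenerate)
    (hd : 4 ≤ Module.finrank F V) (hF : 4 ≤ Nat.card F) {e : V} (he : e ≠ 0) {W : Submodule F V}
    (hW : W < LinearMap.BilinForm.orthogonal Q.polarBilin (Submodule.span F {e})) :
    ∃ x ∈ LinearMap.BilinForm.orthogonal Q.polarBilin (Submodule.span F {e}), x ∉ W ∧ Q x ≠ 0 := by
  set K := LinearMap.BilinForm.orthogonal Q.polarBilin (Submodule.span F {e}) with hK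
  obtain ⟨x₀, hx₀, hx₀W⟩ := SetLike.exists_of_lt hW
  by_cases hQx₀ : Q x₀ = 0
  swap
  · exact ⟨x₀, hx₀, hx₀W, hQx₀⟩
  obtain ⟨x₁, hx₁, hQx₁⟩ : ∃ x ∈ K, Q x ≠ 0 := by
    by_contra! h
    have h1 := two_mul_finrank_le_of_isotropic hQ (W := K) fun y hy z hz => by
      have h1 := h (y + z) (K.add_mem hy hz)
      rwa [quadraticForm_add, h y hy, h z hz, zero_add, zero_add] at h1
    rw [hK, LinearMap.BilinForm.finrank_orthogonal hQ, finrank_span_singleton he] at h1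
    omega
  by_cases hx₁W : x₁ ∈ W
  swap
  · exact ⟨x₁, hx₁, hx₁W, hQx₁⟩
  obtain ⟨t, ht, hQt⟩ := exists_smul_add_nonsingular hF hQx₁ x₀
  refine ⟨_, K.add_mem hx₁ (K.smul_mem t hx₀), fun h => hx₀W ?_, hQt⟩
  rw [← Submodule.smul_mem_iff _ ht]
  simpa using W.sub_mem h hx₁W

end SpanningSequences

/-! ### Proper overgroups of `Ω` over large fields -/

section ProperOvergroups

variable {F V : Type*} [Field F] [Finite F] [CharP F 2] [AddCommGroup V] [Module F V]
  [FiniteDimensional F V] {Q : QuadraticForm F V} {G : Subgroup (Equiv.Perm (NS₁ Q))}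

/-- An overgroup of `Ω` containing some isometry outside `Ω` contains all isometries. -/
theorem nsPerm_mem_of_notMem_omegaGroup (hQ : Q.polarBilin.Nondegenerate) (hG : omegaPerm Q ≤ G)
    {h : isometryGroup Q} (hh : h ∉ omegaGroup Q) (hhG : nsPerm Q h ∈ G) (k : isometryGroup Q) :
    nsPerm Q k ∈ G := by
  by_cases hk : k ∈ omegaGroup Q
  · exact hG (mem_omegaPerm.2 ⟨k, hk, rfl⟩)
  · have h1 : k * h⁻¹ ∈ omegaGroup Q :=
      mul_mem_omegaGroup_of_notMem hQ hk fun h => hh (by simpa using Subgroup.inv_mem _ h)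
    have h2 := G.mul_mem (hG (mem_omegaPerm.2 ⟨_, h1, rfl⟩)) hhG
    rwa [← map_mul, inv_mul_cancel_right] at h2

theorem nsRefl_ne_one (hQ : Q.polarBilin.Nondegenerate) (hd : 4 ≤ Module.finrank F V)
    (p : NS₁ Q) : nsRefl p ≠ 1 := by
  intro h
  obtain ⟨x, hx⟩ := exists_nsGram_eq hQ hd p 1
  have h1 : nsRefl p x = x := by rw [h]; rfl
  rw [nsRefl_apply_eq_self_iff, hx] at h1
  exact one_ne_zero h1

theorem nsRefl_fixes {p₀ : NS₁ Q} {l : List (NS₁ Q)} (hl : IsOrthoSeq p₀ l) {p : NS₁ Q}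
    (hp : p ∈ l) : nsRefl p₀ p = p :=
  nsRefl_apply_eq_self_iff.2 (hl.orth p hp)

theorem pointwiseStabilizer_ne_bot_of_mem {α : Type*} {G : Subgroup (Equiv.Perm α)} {l : List α}
    {g : Equiv.Perm α} (hg : g ∈ pointwiseStabilizer G l) (h1 : g ≠ 1) :
    pointwiseStabilizer G l ≠ ⊥ := fun h => h1 (by rwa [h, Subgroup.mem_bot] at hg)

/-- An overgroup of `Ω` containing a permutation with associated field endomorphism `σ` contains
one that moreover fixes the points of a given orthogonal sequence. -/
theorem IsOrthoSeq.exists_mem_pointwiseStabilizer (hQ : Q.polarBilin.Nondegenerate)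
    (hd : 3 ≤ Module.finrank F V) (hG : omegaPerm Q ≤ G) {p₀ : NS₁ Q} {l : List (NS₁ Q)}
    (hl : IsOrthoSeq p₀ l) (hlen : l.length + 1 = Module.finrank F V) {g : Equiv.Perm (NS₁ Q)}
    (hg : g ∈ G) (σ : F →+* F) (hσ : ∀ p x, nsGram (g p) (g x) = σ (nsGram p x)) :
    ∃ s ∈ pointwiseStabilizer G l, ∀ p x, nsGram (s p) (s x) = σ (nsGram p x) := by
  obtain ⟨s, hs1, hs2⟩ := hl.exists_perm hQ hd hlen σ
  -- The permutation `s * g⁻¹` preserves Gram values. If the resulting isometry is outside `Ω`, the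
  -- reflection in `p₀`, which fixes `l`, corrects it.
  obtain ⟨h, hh⟩ := exists_nsPerm_eq_of_nsGram_eq hQ hd (g := s * g⁻¹) (fun p x => by
    rw [Equiv.Perm.mul_apply, Equiv.Perm.mul_apply, hs1, ← hσ]
    congr 1 <;> exact g.apply_symm_apply _)
  have hsg : nsPerm Q h * g = s := by rw [hh, inv_mul_cancel_right]
  by_cases hΩ : h ∈ omegaGroup Q
  · refine ⟨s, ⟨?_, hs2⟩, hs1⟩
    rw [← hsg]
    exact G.mul_mem (hG (mem_omegaPerm.2 ⟨h, hΩ, rfl⟩)) hg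
  · refine ⟨nsRefl p₀ * s, ⟨?_, fun p hp => ?_⟩, fun p x => ?_⟩
    · rw [← hsg, ← mul_assoc, nsRefl, ← map_mul]
      exact G.mul_mem (hG (mem_omegaPerm.2 ⟨_, mul_mem_omegaGroup_of_notMem hQ
        (reflIsom_notMem_omegaGroup hQ _) hΩ, rfl⟩)) hg
    · rw [Equiv.Perm.mul_apply, hs2 p hp, nsRefl_fixes hl hp]
    · rw [Equiv.Perm.mul_apply, Equiv.Perm.mul_apply, nsRefl, nsGram_nsPerm, hs1]

/-- Over a field with at least four elements, no proper overgroup of `Ω` in its normalizer is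
IBIS. -/
theorem not_isIBIS_of_ne_omegaPerm (hQ : Q.polarBilin.Nondegenerate)
    (hd : 4 ≤ Module.finrank F V) (hF : 4 ≤ Nat.card F) (hG : omegaPerm Q ≤ G)
    (hN : G ≤ Subgroup.normalizer (omegaPerm Q : Set _)) (hne : G ≠ omegaPerm Q) : ¬ IsIBIS G := by
  have hd3 : 3 ≤ Module.finrank F V := by omega
  obtain ⟨p₀⟩ := exists_nsPoint hQ hd3
  obtain ⟨l, hl, hlen⟩ := exists_isOrthoSeq hQ hd3 p₀ (n := Module.finrank F V - 1)
    (by omega) (by omega)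
  have hlG : IsIrredundant G l := hl.irredundant.mono hG
  obtain ⟨θ, hθ0, hθ⟩ := exists_forall_ringHom_eq_id F
  obtain ⟨q₀, hq₀⟩ := exists_nsGram_eq hQ hd p₀ θ
  -- Fixing two points whose Gram value is `θ` forces the field endomorphism to be trivial.
  have hlin : ∀ g ∈ G, g p₀ = p₀ → g q₀ = q₀ → ∃ h, nsPerm Q h = g := by
    intro g hg h1 h2
    obtain ⟨σ, hσ⟩ := exists_ringHom_of_mem_normalizer hQ hd hF (hN hg)
    have h3 := hσ p₀ q₀
    rw [h1, h2, hq₀] at h3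
    exact exists_nsPerm_eq_of_nsGram_eq hQ hd3 fun p x => by rw [hσ, hθ σ h3.symm]
  by_cases hA : ∃ g ∈ G, ∃ p x, nsGram (g p) (g x) ≠ nsGram p x
  · obtain ⟨g, hg, p, x, hpx⟩ := hA
    obtain ⟨σ, hσ⟩ := exists_ringHom_of_mem_normalizer hQ hd hF (hN hg)
    rw [hσ] at hpx
    set τ := nsGram p x
    obtain ⟨s, hs, hsσ⟩ := hl.exists_mem_pointwiseStabilizer hQ hd3 hG (by omega) hg σ hσ
    by_cases hR : ∃ h ∉ omegaGroup Q, nsPerm Q h ∈ G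
    · obtain ⟨h, hh, hhG⟩ := hR
      obtain ⟨k, hp, hq, hklen, hk⟩ := exists_finrank_nsSpan_of_nsGram_ne_zero hQ hd3
        (hq₀ ▸ hθ0) (n := Module.finrank F V) (by omega) le_rfl
      have hkbot : pointwiseStabilizer G k = ⊥ := by
        rw [eq_bot_iff]
        rintro g ⟨hgG, hgk⟩
        obtain ⟨m, rfl⟩ := hlin g hgG (hgk _ hp) (hgk _ hq)
        have h1 := Submodule.finrank_mono (nsPerm_fixes_iff.1 hgk)
        have h2 := residualRank_add_finrank_fixedSpace m
        rw [eq_one_of_residualRank_eq_zero (g := m) (by omega), map_one]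
        exact Subgroup.one_mem _
      obtain ⟨y, hy, hyp⟩ := hl.exists_ne (by omega)
      -- The point `z` is orthogonal to `p₀`, so the reflection in `p₀` still fixes it. Its Gram
      -- value with `y` is moved by `σ`, so `s` moves `z`. The sequence thus reaches length `d` with
      -- non-trivial stabilizer.
      obtain ⟨z, hz0, hzy⟩ : ∃ z, nsGram p₀ z = 0 ∧ nsGram y z = τ := by
        have hind : LinearIndependent F ![normVec p₀, normVec y] := by
          rw [LinearIndependent.pair_iff' (normVec_ne_zero p₀)]
          intro a ha
          exact hyp (normVec_injective (eq_normVec (coe_eq_span_normVec p₀ ▸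
            Submodule.mem_span_singleton.2 ⟨a, ha⟩) (quadraticForm_normVec y)))
        obtain ⟨v, hv⟩ := exists_polarBilin_eq hQ hind ![0, τ]
        have hv0 : Q.polarBilin v (normVec p₀) = 0 := hv 0
        have hv1 : Q.polarBilin v (normVec y) = τ := hv 1
        obtain ⟨c, hc⟩ := exists_mul_self_eq (1 - Q v)
        obtain ⟨z, hz⟩ := exists_normVec_eq (Q := Q) (v := v + c • normVec p₀) (by
          rw [quadraticForm_add, quadraticForm_smul, hc, map_smul, hv0, quadraticForm_normVec,
            smul_zero]
          ring)
        refine ⟨z, ?_, ?_⟩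
        · rw [nsGram, hz, polarBilin_comm, map_add, map_smul, LinearMap.add_apply,
            LinearMap.smul_apply, hv0, polarBilin_self, smul_zero, add_zero]
        · rw [nsGram, hz, polarBilin_comm, map_add, map_smul, LinearMap.add_apply,
            LinearMap.smul_apply, hv1, hl.orth y hy, smul_zero, add_zero]
      have hlong : IsIrredundant G (l ++ [z]) := hlG.append_singleton ⟨s, hs, fun hsz => hpx (by
        have h1 := hsσ y z
        rwa [hs.2 y hy, hsz, hzy, eq_comm] at h1)⟩
      refine not_isIBIS_of_length_le hkbot hlong (pointwiseStabilizer_ne_bot_of_mem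
        (g := nsRefl p₀) ⟨nsPerm_mem_of_notMem_omegaGroup hQ hG hh hhG _, fun w hw => ?_⟩
        (nsRefl_ne_one hQ hd p₀)) (by rw [List.length_append, List.length_singleton]; omega)
      rcases List.mem_append.1 hw with hw | hw
      · exact nsRefl_fixes hl hw
      · rw [List.mem_singleton.1 hw, nsRefl_apply_eq_self_iff, hz0]
    -- All isometries in `G` now lie in `Ω`, so `d - 1` points suffice for the short base, and `s`
    -- shows that `l` is not a base.
    · push Not at hR
      obtain ⟨k, hp, hq, hklen, hk⟩ := exists_finrank_nsSpan_of_nsGram_ne_zero hQ hd3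
        (hq₀ ▸ hθ0) (n := Module.finrank F V - 1) (by omega) (by omega)
      have hkbot : pointwiseStabilizer G k = ⊥ := by
        rw [eq_bot_iff]
        rintro g ⟨hgG, hgk⟩
        obtain ⟨m, rfl⟩ := hlin g hgG (hgk _ hp) (hgk _ hq)
        have hm : m ∈ omegaGroup Q := by
          by_contra hm
          exact hR m hm hgG
        have h1 := Submodule.finrank_mono (nsPerm_fixes_iff.1 hgk)
        rw [eq_one_of_mem_omegaGroup_of_finrank_fixedSpace hQ hm (by omega), map_one]
        exact Subgroup.one_mem _
      refine not_isIBIS_of_length_le hkbot hlG (pointwiseStabilizer_ne_bot_of_mem hs ?_) (by omega)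
      rintro rfl
      exact hpx (hsσ p x).symm
  · push Not at hA
    have hO : ∀ g ∈ G, ∃ h, nsPerm Q h = g := fun g hg =>
      exists_nsPerm_eq_of_nsGram_eq hQ hd3 (hA g hg)
    obtain ⟨g, hgG, hgΩ⟩ := SetLike.exists_of_lt (lt_of_le_of_ne hG hne.symm)
    obtain ⟨h, rfl⟩ := hO g hgG
    rw [nsPerm_mem_omegaPerm_iff hQ hd3] at hgΩ
    -- `G` now consists of isometries, some outside `Ω`. The hyperplane orthogonal to a singular
    -- vector has trivial fixer, whereas the one containing `l` is fixed by the reflection in `p₀`;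
    -- both sequences have length `d - 1`.
    obtain ⟨e, he, hQe⟩ := exists_singular_ne_zero hQ hd3
    obtain ⟨k, hklen, hk⟩ := exists_nsSpan_eq fun W hW =>
      exists_mem_singular_hyperplane_nonsingular hQ hd hF he hW
    have hkbot : pointwiseStabilizer G k = ⊥ := by
      rw [eq_bot_iff]
      rintro g ⟨hgG, hgk⟩
      obtain ⟨m, rfl⟩ := hO g hgG
      have h1 : m = 1 := eq_one_of_singular_hyperplane_fixed hQ hQe
        (by rw [← hk]; exact nsPerm_fixes_iff.1 hgk)
      rw [h1, map_one]
      exact Subgroup.one_mem _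
    rw [LinearMap.BilinForm.finrank_orthogonal hQ, finrank_span_singleton he] at hklen
    exact not_isIBIS_of_length_le hkbot hlG (pointwiseStabilizer_ne_bot_of_mem (g := nsRefl p₀)
      ⟨nsPerm_mem_of_notMem_omegaGroup hQ hG hgΩ hgG _, fun w hw => nsRefl_fixes hl hw⟩
      (nsRefl_ne_one hQ hd p₀)) (by omega)

end ProperOvergroups

theorem even_ncard_of_involution {α : Type*} [Finite α] {s : Set α} (f : α → α)
    (hf : ∀ x ∈ s, f x ∈ s) (hff : ∀ x ∈ s, f (f x) = x) (hne : ∀ x ∈ s, f x ≠ x) :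
    Even s.ncard := by
  classical
  have hs := Set.toFinite s
  have h := Finset.sum_involution (s := hs.toFinset) (f := fun _ => (1 : ZMod 2))
    (fun x _ => f x) (fun _ _ => by decide)
    (fun x hx _ => hne x (hs.mem_toFinset.1 hx))
    (fun x hx => hs.mem_toFinset.2 (hf x (hs.mem_toFinset.1 hx)))
    (fun x hx => hff x (hs.mem_toFinset.1 hx))
  rw [Finset.sum_const, nsmul_one, ZMod.natCast_eq_zero_iff_even] at h
  rwa [Set.ncard_eq_toFinset_card s hs]

/-! ### The field with two elements: suborbit parities -/

section BinaryField

variable {F V : Type*} [Field F] [Finite F] [CharP F 2] [AddCommGroup V] [Module F V]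
  [FiniteDimensional F V] {Q : QuadraticForm F V}

theorem eq_zero_or_one_of_card_lt (hF : Nat.card F < 4) (c : F) : c = 0 ∨ c = 1 := by
  classical
  by_contra! h
  have := Fintype.ofFinite F
  have h1 : ({0, 1, c, c + 1} : Finset F).card ≤ Fintype.card F := Finset.card_le_univ _
  rw [Finset.card_insert_of_notMem, Finset.card_insert_of_notMem, Finset.card_pair,
    ← Nat.card_eq_fintype_card] at h1
  · omega
  · exact fun h => one_ne_zero (left_eq_add.1 h)
  · simp only [Finset.mem_insert, Finset.mem_singleton, not_or]
    exact ⟨h.2.symm, fun e => h.1 (right_eq_add.1 e)⟩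
  · simp only [Finset.mem_insert, Finset.mem_singleton, not_or]
    refine ⟨zero_ne_one, h.1.symm, fun e => h.2 ?_⟩
    linear_combination - e - two_eq_zero_of_charP_two F

/-- The orbit of `x` under the stabilizer of `p` in `Ω`. -/
def omegaOrbit (p x : NS₁ Q) : Set (NS₁ Q) :=
  {y | ∃ h ∈ omegaGroup Q, nsPerm Q h p = p ∧ nsPerm Q h x = y}

/-- Consequently suborbit sizes are invariants of the normalizer. -/
theorem image_omegaOrbit {g : Equiv.Perm (NS₁ Q)}
    (hg : g ∈ Subgroup.normalizer (omegaPerm Q : Set _)) (p x : NS₁ Q) : g '' omegaOrbit p x = omegaOrbit (g p) (g x) := by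
  ext y
  constructor
  · rintro ⟨_, ⟨h, hh, hp, rfl⟩, rfl⟩
    obtain ⟨k, hk, hkg⟩ := exists_conj_of_mem_normalizer hg hh
    exact ⟨k, hk, by rw [hkg, hp], hkg x⟩
  · rintro ⟨h, hh, hp, rfl⟩
    obtain ⟨k, hk, hkg⟩ := exists_conj_of_mem_normalizer (Subgroup.inv_mem _ hg) hh
    have h1 : ∀ x, nsPerm Q k x = g⁻¹ (nsPerm Q h (g x)) := fun x => by
      have h := hkg (g x)
      rwa [perm_inv_apply_self] at h
    refine ⟨nsPerm Q k x, ⟨k, hk, ?_, rfl⟩, ?_⟩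
    · rw [h1, hp, perm_inv_apply_self]
    · rw [h1]
      exact g.apply_symm_apply _

/-- The reflection in `p` preserves the orbit, being matched there pointwise by elements of `Ω`
fixing `p`, and has no fixed point on it. -/
theorem ncard_omegaOrbit_even (hQ : Q.polarBilin.Nondegenerate) (hd : 4 ≤ Module.finrank F V)
    {p x : NS₁ Q} (h : nsGram p x ≠ 0) : Even (omegaOrbit p x).ncard := by
  have hgram : ∀ y ∈ omegaOrbit p x, nsGram p y ≠ 0 := by
    rintro _ ⟨k, hk, hp, rfl⟩
    conv_lhs => rw [← hp]
    rwa [nsGram_nsPerm]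
  refine even_ncard_of_involution (nsRefl p) (fun y hy => ?_) (fun y _ => nsRefl_apply_nsRefl p y)
    (fun y hy e => hgram y hy (nsRefl_apply_eq_self_iff.1 e))
  obtain ⟨m, hm, hmp, hmy⟩ := exists_mem_omegaGroup_eq_nsRefl hQ hd p y
  obtain ⟨k, hk, hp, rfl⟩ := hy
  refine ⟨m * k, Subgroup.mul_mem _ hm hk, ?_, ?_⟩
  · rw [map_mul, Equiv.Perm.mul_apply, hp, hmp]
  · rw [map_mul, Equiv.Perm.mul_apply, hmy]

theorem exists_orthogonal_polarBilin_ne_zero (hQ : Q.polarBilin.Nondegenerate) {p x : NS₁ Q}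
    (h : x ≠ p) : ∃ a ∈ LinearMap.BilinForm.orthogonal Q.polarBilin
      (Submodule.span F {normVec p}), Q.polarBilin (normVec x) a ≠ 0 := by
  have hx : normVec x ∉ Submodule.span F {normVec p} := fun hx =>
    h (normVec_injective (eq_normVec (coe_eq_span_normVec p ▸ hx) (quadraticForm_normVec x)))
  obtain ⟨u, hu, hux⟩ := exists_mem_orthogonal_polarBilin_ne_zero hQ hx
  exact ⟨u, hu, by rwa [polarBilin_comm]⟩

/-- The reflection in `p` fixes every point orthogonal to `p`, so it makes the reflection in a sum
`x + y` even. If `x` and `y` are orthogonal, an intermediate point `z` orthogonal to neither links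
them. -/
theorem omegaOrbit_eq (hQ : Q.polarBilin.Nondegenerate)
    {p x : NS₁ Q} (hxp : x ≠ p) (hx : nsGram p x = 0) :
    omegaOrbit p x = {y | nsGram p y = 0} \ {p} := by
  have key : ∀ {x y : NS₁ Q}, nsGram p x = 0 → nsGram p y = 0 → nsGram x y ≠ 0 →
      ∃ h ∈ omegaGroup Q, nsPerm Q h p = p ∧ nsPerm Q h x = y := by
    intro x y hx hy hxy
    have h1 : Q (normVec x + normVec y) ≠ 0 := by rwa [quadraticForm_normVec_add]
    refine ⟨reflIsom _ h1 * pointRefl p, reflIsom_mul_reflIsom_mem_omegaGroup hQ _ _, ?_, ?_⟩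
    · rw [map_mul, Equiv.Perm.mul_apply]
      change nsPerm Q _ (nsRefl p p) = p
      rw [nsRefl_apply_eq_self_iff.2 (nsGram_self p), nsPerm_apply_eq_iff]
      refine reflIsom_apply_of_orthogonal h1 ?_
      rw [polarBilin_comm, map_add]
      change nsGram p x + nsGram p y = 0
      rw [hx, hy, add_zero]
    · rw [map_mul, Equiv.Perm.mul_apply]
      change nsPerm Q _ (nsRefl p x) = y
      rw [nsRefl_apply_eq_self_iff.2 hx, nsPerm_reflIsom_add]
  ext y
  constructor
  · rintro ⟨h, hh, hp, rfl⟩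
    refine ⟨?_, fun e => hxp ?_⟩
    · change nsGram p _ = 0
      conv_lhs => rw [← hp]
      rwa [nsGram_nsPerm]
    · exact (nsPerm Q h).injective (Set.mem_singleton_iff.1 e |>.trans hp.symm)
  · rintro ⟨hy, hyp⟩
    by_cases hxy : nsGram x y = 0
    · obtain ⟨w, hw, h1, h2⟩ := exists_polarBilin_ne_zero_ne_zero
        (exists_orthogonal_polarBilin_ne_zero hQ hxp) (exists_orthogonal_polarBilin_ne_zero hQ hyp)
      have hpw : Q.polarBilin (normVec p) w = 0 :=
        mem_orthogonal_polarBilin.1 hw _ (Submodule.mem_span_singleton_self _)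
      obtain ⟨c, hc⟩ := exists_mul_self_eq (1 - Q w)
      obtain ⟨z, hz⟩ := exists_normVec_eq (Q := Q) (v := w + c • normVec p) (by
        rw [quadraticForm_add, quadraticForm_smul, hc, map_smul, polarBilin_comm w, hpw,
          quadraticForm_normVec, smul_zero]
        ring)
      have hpz : nsGram p z = 0 := by
        rw [nsGram, hz, map_add, map_smul, hpw, polarBilin_self, smul_zero, add_zero]
      have hval : ∀ u : NS₁ Q, nsGram p u = 0 → Q.polarBilin (normVec u) w ≠ 0 →
          nsGram u z ≠ 0 := by
        intro u hu huw
        rw [nsGram, hz, map_add, map_smul]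
        change _ + c • nsGram u p ≠ 0
        rwa [nsGram_comm, hu, smul_zero, add_zero]
      obtain ⟨k, hk, hkp, hkx⟩ := key hx hpz (hval x hx h1)
      obtain ⟨m, hm, hmp, hmz⟩ := key hpz hy (by rw [nsGram_comm]; exact hval y hy h2)
      refine ⟨m * k, Subgroup.mul_mem _ hm hk, ?_, ?_⟩
      · rw [map_mul, Equiv.Perm.mul_apply, hkp, hmp]
      · rw [map_mul, Equiv.Perm.mul_apply, hkx, hmz]
    · exact key hx hy hxy

/-- Sending `y` to the vector of norm one in `y + x + ⟨p⟩` is a fixed-point-free involution on all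
points orthogonal to `p`, including `p` itself. Removing `p` leaves an odd number. -/
theorem ncard_omegaOrbit_odd (hQ : Q.polarBilin.Nondegenerate)
    {p x : NS₁ Q} (hxp : x ≠ p) (hx : nsGram p x = 0) : Odd (omegaOrbit p x).ncard := by
  rw [omegaOrbit_eq hQ hxp hx]
  have hex : ∀ y : NS₁ Q, ∃ z : NS₁ Q, ∃ c : F, normVec z = normVec y + normVec x + c • normVec p ∨
      nsGram p y ≠ 0 := by
    intro y
    by_cases hy : nsGram p y = 0
    · obtain ⟨c, hc⟩ := exists_mul_self_eq (1 - Q (normVec y + normVec x))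
      obtain ⟨z, hz⟩ := exists_normVec_eq (Q := Q) (v := normVec y + normVec x + c • normVec p) (by
        rw [quadraticForm_add _ (c • normVec p), quadraticForm_smul, hc, map_smul,
          polarBilin_comm _ (normVec p), map_add (Q.polarBilin (normVec p))]
        change _ + _ + c • (nsGram p y + nsGram p x) = 1
        rw [hx, hy, quadraticForm_normVec, add_zero, smul_zero]
        ring)
      exact ⟨z, c, Or.inl hz⟩
    · exact ⟨p, 0, Or.inr hy⟩
  choose f c hf using hex
  have hf' : ∀ y, nsGram p y = 0 → normVec (f y) = normVec y + normVec x + c y • normVec p :=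
    fun y hy => (hf y).resolve_right (not_not.2 hy)
  have hf0 : ∀ y, nsGram p y = 0 → nsGram p (f y) = 0 := by
    intro y hy
    rw [nsGram, hf' y hy, map_add, map_add, map_smul, polarBilin_self, smul_zero, add_zero]
    change nsGram p y + nsGram p x = 0
    rw [hx, hy, add_zero]
  have h1 : Even {y | nsGram p y = 0}.ncard := by
    refine even_ncard_of_involution f hf0 (fun y hy => ?_) (fun y hy e => hxp ?_)
    · have h2 := hf' _ (hf0 y hy)
      rw [hf' y hy] at h2
      have h3 : normVec (f (f y)) = normVec y + (c y + c (f y)) • normVec p := by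
        rw [h2, add_smul]
        have : ∀ a b u v : V, a + b + u + b + v = a + (u + v) + (b + b) := fun a b u v => by abel
        rw [this, module_add_self F, add_zero]
      have h4 := quadraticForm_normVec (f (f y))
      rw [h3, quadraticForm_add, quadraticForm_smul, quadraticForm_normVec, quadraticForm_normVec,
        map_smul, polarBilin_comm] at h4
      change 1 + _ + _ • nsGram p y = 1 at h4
      rw [hy, smul_zero, add_zero, mul_one, add_eq_left, mul_self_eq_zero] at h4
      rw [h4, zero_smul, add_zero] at h3
      exact normVec_injective h3
    · have h2 := hf' y hy
      rw [e, add_assoc, left_eq_add] at h2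
      have h3 : normVec x = c y • normVec p := by
        rw [← module_sub_eq_add F, sub_eq_zero] at h2
        exact h2
      exact normVec_injective (eq_normVec (coe_eq_span_normVec p ▸
        Submodule.mem_span_singleton.2 ⟨_, h3.symm⟩) (quadraticForm_normVec x))
  have h2 := Set.ncard_sdiff_singleton_add_one (s := {y | nsGram p y = 0}) (a := p) (nsGram_self p)
    (Set.toFinite _)
  rw [← h2, Nat.even_add_one, Nat.not_even_iff_odd] at h1
  exact h1

/-- Over the field with two elements the normalizer of `Ω` preserves the Gram function. -/
theorem nsGram_eq_of_mem_normalizer (hQ : Q.polarBilin.Nondegenerate)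
    (hd : 4 ≤ Module.finrank F V) (hF : ∀ c : F, c = 0 ∨ c = 1) {g : Equiv.Perm (NS₁ Q)}
    (hg : g ∈ Subgroup.normalizer (omegaPerm Q : Set _)) (p x : NS₁ Q) :
    nsGram (g p) (g x) = nsGram p x := by
  have key : ∀ {g : Equiv.Perm (NS₁ Q)}, g ∈ Subgroup.normalizer (omegaPerm Q : Set _) →
      ∀ {p x}, nsGram p x = 0 → nsGram (g p) (g x) = 0 := by
    intro g hg p x h
    by_cases hxp : x = p
    · rw [hxp, nsGram_self]
    by_contra hne
    have h1 := ncard_omegaOrbit_odd hQ hxp h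
    have h2 := ncard_omegaOrbit_even hQ hd hne
    rw [← image_omegaOrbit hg, Set.ncard_image_of_injective _ g.injective] at h2
    exact Nat.not_even_iff_odd.2 h1 h2
  rcases hF (nsGram p x) with h | h
  · rw [h, key hg h]
  · rcases hF (nsGram (g p) (g x)) with h' | h'
    · have h1 := key (Subgroup.inv_mem _ hg) h'
      rw [perm_inv_apply_self, perm_inv_apply_self, h] at h1
      exact absurd h1 one_ne_zero
    · rw [h, h']

end BinaryField

/-! ### Socles, commutative quotients and centralizers -/

section SocleCentral

variable {G : Type*} [Group G]

theorem socle_normal : (socle G).Normal := Subgroup.sSup_normal _ fun _ hN => hN.1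

/-- If a homomorphism to a commutative group does not vanish at an element of the socle, then it
does not vanish at some central element. -/
theorem exists_central_of_mem_socle {A : Type*} [CommGroup A] (f : G →* A) {s : G}
    (hs : s ∈ socle G) (hfs : f s ≠ 1) : ∃ m, f m ≠ 1 ∧ ∀ g, g * m = m * g := by
  by_contra! h
  have hle : socle G ≤ f.ker := by
    refine sSup_le fun M hM => ?_
    have hMn : M.Normal := hM.1
    rcases hM.2.2 (M ⊓ f.ker) inferInstance inf_le_left with h1 | h1
    · intro m hm
      by_contra hfm
      obtain ⟨g, hg⟩ := h m hfm
      apply hg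
      -- Commutators vanish under `f`, so a minimal normal subgroup meeting the kernel trivially is
      -- central.
      have h2 : g * m * g⁻¹ * m⁻¹ ∈ M ⊓ f.ker := by
        refine ⟨M.mul_mem (hMn.conj_mem m hm g) (M.inv_mem hm), ?_⟩
        change f (g * m * g⁻¹ * m⁻¹) = 1
        rw [map_mul, map_mul, map_mul, map_inv, map_inv, mul_comm (f g),
          mul_inv_cancel_right, mul_inv_cancel]
      rw [h1, Subgroup.mem_bot, mul_inv_eq_one, mul_inv_eq_iff_eq_mul] at h2
      exact h2
    · exact inf_eq_left.1 h1
  exact hfs (hle hs)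

variable {α : Type*} {G : Subgroup (Equiv.Perm α)} {N : Subgroup (Equiv.Perm α)}

theorem le_of_map_socle_eq (hG : (socle G).map G.subtype = N) : N ≤ G := by
  rw [← hG]
  exact Subgroup.map_subtype_le _

theorem le_normalizer_of_map_socle_eq (hG : (socle G).map G.subtype = N) :
    G ≤ Subgroup.normalizer (N : Set _) := by
  have h := Subgroup.le_normalizer_map (H := socle G) G.subtype
  have h1 : Subgroup.normalizer (socle G : Set G) = ⊤ :=
    Subgroup.normalizer_eq_top_iff.2 socle_normal
  rw [h1, ← MonoidHom.range_eq_map, Subgroup.range_subtype, hG] at h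
  exact h

end SocleCentral

/-- Such an `m` maps `p` to a point fixed by the stabilizer of `p` in `Ω`, and `p` is the only one.
-/
theorem eq_one_of_forall_commute {F V : Type*} [Field F] [Finite F] [CharP F 2] [AddCommGroup V]
    [Module F V] [FiniteDimensional F V] {Q : QuadraticForm F V} (hQ : Q.polarBilin.Nondegenerate)
    (hd : 4 ≤ Module.finrank F V) {m : Equiv.Perm (NS₁ Q)}
    (hm : ∀ g ∈ omegaPerm Q, g * m = m * g) : m = 1 := by
  ext1 p
  change m p = p
  refine eq_of_fixed_by_stabilizer hQ hd fun g hg hgp => ?_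
  have h := Equiv.congr_fun (hm _ (mem_omegaPerm.2 ⟨g, hg, rfl⟩)) p
  rw [Equiv.Perm.mul_apply, Equiv.Perm.mul_apply, hgp] at h
  exact h

/-! ### Hyperbolic pairs -/

section HyperbolicPlane

variable {F V : Type*} [Field F] [Finite F] [CharP F 2] [AddCommGroup V] [Module F V]
  [FiniteDimensional F V] {Q : QuadraticForm F V} {e f : V}

/-- Two singular vectors with polar product one. -/
structure IsHyperbolicPair (Q : QuadraticForm F V) (e f : V) : Prop where
  left : Q e = 0
  right : Q f = 0
  polar : Q.polarBilin e f = 1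

theorem exists_isHyperbolicPair (hQ : Q.polarBilin.Nondegenerate)
    (hd : 3 ≤ Module.finrank F V) : ∃ e f, IsHyperbolicPair Q e f := by
  obtain ⟨e, he, hQe⟩ := exists_singular_ne_zero hQ hd
  obtain ⟨u, hu⟩ := exists_polarBilin_ne_zero hQ he
  obtain ⟨f, h1⟩ : ∃ f, Q.polarBilin e f = 1 :=
    ⟨(Q.polarBilin e u)⁻¹ • u, by rw [map_smul, smul_eq_mul, inv_mul_cancel₀ hu]⟩
  refine ⟨e, f + Q f • e, hQe, ?_, ?_⟩
  · rw [quadraticForm_add, quadraticForm_smul, map_smul, polarBilin_comm f, h1, hQe, smul_eq_mul]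
    linear_combination Q f * two_eq_zero_of_charP_two F
  · rw [map_add, map_smul, polarBilin_self, h1, smul_zero, add_zero]

namespace IsHyperbolicPair

theorem finrank_span (h : IsHyperbolicPair Q e f) :
    Module.finrank F (Submodule.span F {e, f}) = 2 := by
  have he : e ≠ 0 := by
    rintro rfl
    have h1 := h.polar
    rw [map_zero, LinearMap.zero_apply] at h1
    exact zero_ne_one h1
  have hf : f ∉ Submodule.span F {e} := by
    intro hf
    obtain ⟨c, rfl⟩ := Submodule.mem_span_singleton.1 hf
    have h1 := h.polar
    rw [map_smul, polarBilin_self, smul_zero] at h1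
    exact zero_ne_one h1
  rw [Set.pair_comm, Submodule.span_insert, sup_comm, finrank_sup_span_singleton_of_notMem hf,
    finrank_span_singleton he]

theorem quadraticForm_comb (h : IsHyperbolicPair Q e f) (a b : F) : Q (a • e + b • f) = a * b := by
  rw [quadraticForm_add, quadraticForm_smul, quadraticForm_smul, map_smul, map_smul,
    LinearMap.smul_apply, h.left, h.right, h.polar, smul_eq_mul, smul_eq_mul]
  ring

theorem add_notMem (h : IsHyperbolicPair Q e f) :
    e + f ∉ LinearMap.BilinForm.orthogonal Q.polarBilin (Submodule.span F {e, f}) := by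
  intro hm
  have h1 := mem_orthogonal_span_polarBilin.1 hm e (Set.mem_insert _ _)
  rw [map_add, polarBilin_self, h.polar, zero_add] at h1
  exact one_ne_zero h1

/-- Over the field with two elements, an isometry fixing the orthogonal complement of a hyperbolic
pair fixes the sum of the pair. -/
theorem apply_add (hQ : Q.polarBilin.Nondegenerate) (h : IsHyperbolicPair Q e f)
    (hF : ∀ c : F, c = 0 ∨ c = 1) {g : isometryGroup Q}
    (hg : LinearMap.BilinForm.orthogonal Q.polarBilin (Submodule.span F {e, f}) ≤ fixedSpace g) :
    e + f ∈ fixedSpace g := by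
  rw [mem_fixedSpace]
  have h1 : g.1 (e + f) ∈ Submodule.span F {e, f} := by
    rw [← LinearMap.BilinForm.orthogonal_orthogonal hQ isRefl_polarBilin (Submodule.span F {e, f}),
      mem_orthogonal_polarBilin]
    intro w hw
    rw [← mem_fixedSpace.1 (hg hw), isometry_polarBilin, polarBilin_comm]
    exact mem_orthogonal_polarBilin.1 hw _ (Submodule.add_mem _
      (Submodule.subset_span (Set.mem_insert _ _))
      (Submodule.subset_span (Set.mem_insert_of_mem _ rfl)))
  obtain ⟨a, b, hab⟩ := Submodule.mem_span_pair.1 h1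
  have h2 : Q (g.1 (e + f)) = Q (e + f) := g.2 _
  have h3 := h.quadraticForm_comb 1 1
  rw [one_smul, one_smul, mul_one] at h3
  rw [← hab, h.quadraticForm_comb, h3] at h2
  have ha : a = 1 := (hF a).resolve_left fun ha => by simp [ha] at h2
  have hb : b = 1 := (hF b).resolve_left fun hb => by simp [hb] at h2
  rw [← hab, ha, hb, one_smul, one_smul]

end IsHyperbolicPair

end HyperbolicPlane

/-- A fixed-point-free involution of six points is a product of three transpositions. -/
theorem sign_eq_neg_one_of_involutive {α : Type*} [Fintype α] [DecidableEq α] {σ : Equiv.Perm α}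
    (hσ : σ ^ 2 = 1) (hne : ∀ x, σ x ≠ x) (hcard : Nat.card α = 6) : Equiv.Perm.sign σ = -1 := by
  have h : Fintype.card (Function.fixedPoints σ) = 0 :=
    Fintype.card_eq_zero_iff.2 ⟨fun x => hne x.1 x.2⟩
  rw [Equiv.Perm.sign_of_pow_two_eq_one hσ, h, ← Nat.card_eq_fintype_card, hcard]
  rfl

/-! ### The exceptional four-dimensional binary space of plus type -/

section BinaryPlus

variable {F V : Type*} [Field F] [Finite F] [CharP F 2] [AddCommGroup V] [Module F V]
  [FiniteDimensional F V] {Q : QuadraticForm F V} {e f x h : V}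

/-- The vectors of a four-dimensional space written in terms of a hyperbolic pair and two vectors
orthogonal to it. -/
theorem IsHyperbolicPair.exists_coords (hef : IsHyperbolicPair Q e f)
    (hd : Module.finrank F V = 4)
    (hex : Q.polarBilin e x = 0) (hfx : Q.polarBilin f x = 0) (heh : Q.polarBilin e h = 0)
    (hfh : Q.polarBilin f h = 0) (hxh : Q.polarBilin x h = 1) :
    ∃ φ : (Fin 4 → F) ≃ₗ[F] V, ∀ t, φ t = t 0 • e + t 1 • f + t 2 • x + t 3 • h := by
  have hval : ∀ t, Fintype.linearCombination F ![e, f, x, h] t =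
      t 0 • e + t 1 • f + t 2 • x + t 3 • h := fun t => by
    rw [Fintype.linearCombination_apply, Fin.sum_univ_four]
    rfl
  have hinj : Function.Injective (Fintype.linearCombination F ![e, f, x, h]) := by
    rw [injective_iff_map_eq_zero]
    intro t ht
    rw [hval] at ht
    have key : ∀ w, Q.polarBilin w (t 0 • e + t 1 • f + t 2 • x + t 3 • h) = 0 := fun w => by
      rw [ht, map_zero]
    have h0 := key f
    have h1 := key e
    have h2 := key h
    have h3 := key x
    simp only [map_add, map_smul, smul_eq_mul, polarBilin_self, hef.polar, polarBilin_comm f e, hex,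
      hfx, heh, hfh, hxh, polarBilin_comm h e, polarBilin_comm h f, polarBilin_comm h x,
      polarBilin_comm x e, polarBilin_comm x f, mul_zero, mul_one, add_zero, zero_add] at h0 h1 h2 h3
    ext i
    fin_cases i
    · exact h0
    · exact h1
    · exact h2
    · exact h3
  exact ⟨LinearEquiv.ofInjectiveOfFinrankEq _ hinj (by rw [Module.finrank_fin_fun, hd]), hval⟩

/-- The non-singular points of a four-dimensional binary space of plus type. -/
theorem IsHyperbolicPair.card_NS₁ (hef : IsHyperbolicPair Q e f)
    (hF : ∀ c : F, c = 0 ∨ c = 1) (hd : Module.finrank F V = 4)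
    (hex : Q.polarBilin e x = 0) (hfx : Q.polarBilin f x = 0) (heh : Q.polarBilin e h = 0)
    (hfh : Q.polarBilin f h = 0) (hxh : Q.polarBilin x h = 1) (hx : Q x = 0) (hh : Q h = 1) :
    Nat.card (NS₁ Q) = 6 := by
  obtain ⟨φ, hφ⟩ := hef.exists_coords hd hex hfx heh hfh hxh
  have hQφ : ∀ t, Q (φ t) = t 0 * t 1 + t 2 * t 3 + t 3 * t 3 := by
    intro t
    rw [hφ, add_assoc, quadraticForm_add, hef.quadraticForm_comb, quadraticForm_add,
      quadraticForm_smul, quadraticForm_smul]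
    simp only [map_add, map_smul, smul_eq_mul, LinearMap.add_apply, LinearMap.smul_apply,
      hex, hfx, heh, hfh, hxh, hx, hh, mul_zero, mul_one, add_zero, zero_add]
    ring
  let ε : ZMod 2 ≃+* F := RingEquiv.ofBijective (ZMod.castHom dvd_rfl F)
    ⟨RingHom.injective _, fun c => by
      rcases hF c with rfl | rfl
      · exact ⟨0, map_zero _⟩
      · exact ⟨1, map_one _⟩⟩
  -- In coordinates the points are the solutions of one quadratic equation over `ZMod 2`, which are
  -- enumerated.
  have h1 : Nat.card {t : Fin 4 → ZMod 2 // t 0 * t 1 + t 2 * t 3 + t 3 * t 3 = 1} = 6 := by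
    rw [Nat.card_eq_fintype_card]
    decide
  rw [← h1]
  refine Nat.card_congr (Equiv.ofBijective
    (fun p => ⟨fun i => ε.symm (φ.symm (normVec p) i), ?_⟩) ⟨fun p p' hp => ?_, fun t => ?_⟩)
  · have h2 := hQφ (φ.symm (normVec p))
    rw [φ.apply_symm_apply, quadraticForm_normVec] at h2
    rw [← map_mul, ← map_mul, ← map_mul, ← map_add, ← map_add, ← h2, map_one]
  · refine normVec_injective (φ.symm.injective (funext fun i => ε.symm.injective ?_))
    exact congrFun (congrArg Subtype.val hp) i
  · obtain ⟨p, hp⟩ := exists_normVec_eq (Q := Q) (v := φ fun i => ε (t.1 i)) (by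
      rw [hQφ, ← map_mul, ← map_mul, ← map_mul, ← map_add, ← map_add, t.2, map_one])
    refine ⟨p, Subtype.ext (funext fun i => ?_)⟩
    change ε.symm (φ.symm (normVec p) i) = _
    rw [hp, φ.symm_apply_apply, ε.symm_apply_apply]

/-- A fixed vector is orthogonal to both `e` and `x`, hence lies in their span, which is totally
singular. -/
theorem IsHyperbolicPair.siegel_apply_ne (hef : IsHyperbolicPair Q e f)
    (hd : Module.finrank F V = 4)
    (hex : Q.polarBilin e x = 0) (hfx : Q.polarBilin f x = 0) (heh : Q.polarBilin e h = 0)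
    (hfh : Q.polarBilin f h = 0) (hxh : Q.polarBilin x h = 1) (hx : Q x = 0) (p : NS₁ Q) :
    nsPerm Q (siegel e x hef.left hx hex) p ≠ p := by
  rw [Ne, nsPerm_apply_eq_iff, siegel_apply, add_assoc, add_eq_left]
  intro h1
  obtain ⟨φ, hφ⟩ := hef.exists_coords hd hex hfx heh hfh hxh
  obtain ⟨t, ht⟩ := φ.surjective (normVec p)
  have hb : Q.polarBilin e (normVec p) = t 1 := by
    rw [← ht, hφ]
    simp only [map_add, map_smul, polarBilin_self, hef.polar, hex, heh, smul_eq_mul, mul_zero,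
      mul_one, zero_add, add_zero]
  have hk : Q.polarBilin x (normVec p) = t 3 := by
    rw [← ht, hφ]
    simp only [map_add, map_smul, polarBilin_self, polarBilin_comm x e, polarBilin_comm x f, hfx, hex,
      hxh, smul_eq_mul, mul_zero, mul_one, zero_add, add_zero]
  rw [hb, hk] at h1
  have h2 : φ ![t 3, 0, t 1, 0] = φ 0 := by
    rw [map_zero, ← h1, hφ]
    simp [add_comm]
  have h3 := φ.injective h2
  have ht3 : t 3 = 0 := congrFun h3 0
  have ht1 : t 1 = 0 := congrFun h3 2
  have h4 := quadraticForm_normVec p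
  rw [← ht, hφ, ht1, ht3, zero_smul, zero_smul, add_zero, add_zero, quadraticForm_add,
    quadraticForm_smul, quadraticForm_smul, hef.left, hx, map_smul, map_smul, LinearMap.smul_apply,
    hex] at h4
  simp at h4

/-- In a four-dimensional binary space of plus type `Ω` contains an odd permutation of the six
non-singular points, so it is not the socle of a permutation group. -/
theorem IsHyperbolicPair.map_socle_ne (hQ : Q.polarBilin.Nondegenerate)
    (hef : IsHyperbolicPair Q e f) (hF : ∀ c : F, c = 0 ∨ c = 1) (hd : Module.finrank F V = 4)
    (hex : Q.polarBilin e x = 0) (hfx : Q.polarBilin f x = 0) (hx : Q x = 0) (hx0 : x ≠ 0)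
    (G : Subgroup (Equiv.Perm (NS₁ Q))) : (socle G).map G.subtype ≠ omegaPerm Q := by
  classical
  intro hG
  have := Fintype.ofFinite (NS₁ Q)
  have hxW : x ∉ Submodule.span F {e, f} := by
    intro hxW
    obtain ⟨a, b, rfl⟩ := Submodule.mem_span_pair.1 hxW
    rw [map_add, map_smul, map_smul, polarBilin_self, hef.polar, smul_zero, zero_add, smul_eq_mul,
      mul_one] at hex
    rw [map_add, map_smul, map_smul, polarBilin_self, polarBilin_comm, hef.polar, smul_zero,
      add_zero, smul_eq_mul, mul_one] at hfx
    rw [hex, hfx, zero_smul, zero_smul, add_zero] at hx0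
    exact hx0 rfl
  obtain ⟨u, hu, hux⟩ := exists_mem_orthogonal_polarBilin_ne_zero hQ hxW
  have hux1 : Q.polarBilin x u = 1 := by
    rw [polarBilin_comm]
    exact (hF _).resolve_left hux
  rw [mem_orthogonal_span_polarBilin] at hu
  have heu := hu e (Set.mem_insert _ _)
  have hfu := hu f (Set.mem_insert_of_mem _ rfl)
  obtain ⟨h, heh, hfh, hxh, hh⟩ : ∃ h, Q.polarBilin e h = 0 ∧ Q.polarBilin f h = 0 ∧
      Q.polarBilin x h = 1 ∧ Q h = 1 := by
    refine ⟨u + (1 + Q u) • x, ?_, ?_, ?_, ?_⟩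
    · rw [map_add, map_smul, heu, hex, smul_zero, add_zero]
    · rw [map_add, map_smul, hfu, hfx, smul_zero, add_zero]
    · rw [map_add, map_smul, hux1, polarBilin_self, smul_zero, add_zero]
    · rw [quadraticForm_add, quadraticForm_smul, hx, map_smul, polarBilin_comm u, hux1, smul_eq_mul]
      linear_combination Q u * two_eq_zero_of_charP_two F
  set s := siegel e x hef.left hx hex with hs
  have hsign : Equiv.Perm.sign (nsPerm Q s) = -1 :=
    sign_eq_neg_one_of_involutive (by rw [pow_two, ← map_mul, siegel_mul_self, map_one])
      (hef.siegel_apply_ne hd hex hfx heh hfh hxh hx)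
      (hef.card_NS₁ hF hd hex hfx heh hfh hxh hx hh)
  have hsΩ : nsPerm Q s ∈ omegaPerm Q :=
    mem_omegaPerm.2 ⟨s, siegel_mem_omegaGroup hQ hef.left hx hex, rfl⟩
  rw [← hG] at hsΩ
  obtain ⟨s', hs', hs'e⟩ := Subgroup.mem_map.1 hsΩ
  -- The sign is non-trivial on the socle, which yields a central odd element of `G`. It centralizes
  -- `Ω`, so it must be the identity, a contradiction.
  obtain ⟨m, hm, hcomm⟩ := exists_central_of_mem_socle (Equiv.Perm.sign.comp G.subtype) hs' (by
    rw [MonoidHom.comp_apply, hs'e, hsign]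
    decide)
  have hm1 : (m : Equiv.Perm (NS₁ Q)) = 1 := eq_one_of_forall_commute hQ (by omega) fun g hg =>
    congrArg Subtype.val (hcomm ⟨g, le_of_map_socle_eq hG hg⟩)
  apply hm
  rw [MonoidHom.comp_apply, Subgroup.coe_subtype, hm1, map_one]

end BinaryPlus

/-! ### Groups with socle `Ω` over the field with two elements -/

section BinaryOvergroups

variable {F V : Type*} [Field F] [Finite F] [CharP F 2] [AddCommGroup V] [Module F V]
  [FiniteDimensional F V] {Q : QuadraticForm F V} {G : Subgroup (Equiv.Perm (NS₁ Q))} {e f : V}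

/-- Over the field with two elements `G` has irredundant bases of different sizes as soon as the
orthogonal complement of some hyperbolic pair is spanned by non-singular vectors. -/
theorem IsHyperbolicPair.not_isIBIS (hQ : Q.polarBilin.Nondegenerate)
    (hef : IsHyperbolicPair Q e f) (hd : 4 ≤ Module.finrank F V) (hF : ∀ c : F, c = 0 ∨ c = 1)
    (hK : ∀ W < LinearMap.BilinForm.orthogonal Q.polarBilin (Submodule.span F {e, f}),
      ∃ x ∈ LinearMap.BilinForm.orthogonal Q.polarBilin (Submodule.span F {e, f}),
        x ∉ W ∧ Q x ≠ 0)
    (hG : omegaPerm Q ≤ G) (hN : G ≤ Subgroup.normalizer (omegaPerm Q : Set _)) :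
    ¬ IsIBIS G := by
  have hd3 : 3 ≤ Module.finrank F V := by omega
  have hO : ∀ g ∈ G, ∃ h, nsPerm Q h = g := fun g hg =>
    exists_nsPerm_eq_of_nsGram_eq hQ hd3 (nsGram_eq_of_mem_normalizer hQ hd hF (hN hg))
  obtain ⟨p₀⟩ := exists_nsPoint hQ hd3
  obtain ⟨l, hl, hlen⟩ := exists_isOrthoSeq hQ hd3 p₀ (n := Module.finrank F V - 1)
    (by omega) (by omega)
  have hlG : IsIrredundant G l := hl.irredundant.mono hG
  obtain ⟨k, hklen, hk⟩ := exists_nsSpan_eq hK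
  rw [LinearMap.BilinForm.finrank_orthogonal hQ, hef.finrank_span] at hklen
  have hkdim : Module.finrank F (nsSpan k) = k.length := by
    rw [hk, LinearMap.BilinForm.finrank_orthogonal hQ, hef.finrank_span, hklen]
  -- The `d - 2` points of `k` fix an extra vector for free, so their fixer already fixes a
  -- hyperplane.
  have hfix : ∀ m : isometryGroup Q, nsSpan k ≤ fixedSpace m →
      nsSpan k ⊔ Submodule.span F {e + f} ≤ fixedSpace m := fun m hm =>
    sup_le hm ((Submodule.span_singleton_le_iff_mem _ _).2 (hef.apply_add hQ hF (hk ▸ hm)))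
  have hdim : Module.finrank F ↥(nsSpan k ⊔ Submodule.span F {e + f}) = k.length + 1 := by
    rw [finrank_sup_span_singleton_of_notMem (hk ▸ hef.add_notMem), hkdim]
  by_cases hR : ∃ h ∉ omegaGroup Q, nsPerm Q h ∈ G
  · obtain ⟨h, hh, hhG⟩ := hR
    have hsup : nsSpan k ⊔ Submodule.span F {e + f} ≠ ⊤ := by
      intro h
      rw [h, finrank_top] at hdim
      omega
    -- One more point outside that hyperplane makes the fixer in the full isometry group trivial,
    -- with `d - 1` points in all.
    obtain ⟨p, hp⟩ := exists_normVec_notMem hQ hd3 hsup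
    refine not_isIBIS_of_length_le (l := k ++ [p]) ?_ hlG (pointwiseStabilizer_ne_bot_of_mem
      (g := nsRefl p₀)
      ⟨nsPerm_mem_of_notMem_omegaGroup hQ hG hh hhG _, fun w hw => nsRefl_fixes hl hw⟩
      (nsRefl_ne_one hQ hd p₀)) (by rw [List.length_append, List.length_singleton]; omega)
    rw [eq_bot_iff]
    rintro g ⟨hgG, hgk⟩
    obtain ⟨m, rfl⟩ := hO g hgG
    have h1 := nsPerm_fixes_iff.1 hgk
    rw [nsSpan_append_singleton, sup_le_iff] at h1
    have h2 := Submodule.finrank_mono (sup_le (hfix m h1.1) h1.2)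
    rw [finrank_sup_span_singleton_of_notMem hp, hdim] at h2
    have h3 := residualRank_add_finrank_fixedSpace m
    rw [eq_one_of_residualRank_eq_zero (g := m) (by omega), map_one]
    exact Subgroup.one_mem _
  · push Not at hR
    -- Irredundance of `l` at its last point shows that its first `d - 2` points have non-trivial
    -- stabilizer, while `k` has the same length and trivial stabilizer in `Ω`.
    obtain ⟨g, hg, hne⟩ := hlG (Module.finrank F V - 2) (by omega)
    refine not_isIBIS_of_length_le (l := k) ?_ (hlG.take (Module.finrank F V - 2))
      (pointwiseStabilizer_ne_bot_of_mem hg (by rintro rfl; exact hne rfl))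
      (by rw [List.length_take]; omega)
    rw [eq_bot_iff]
    rintro g ⟨hgG, hgk⟩
    obtain ⟨m, rfl⟩ := hO g hgG
    have hm : m ∈ omegaGroup Q := by
      by_contra hm
      exact hR m hm hgG
    have h1 := Submodule.finrank_mono (hfix m (nsPerm_fixes_iff.1 hgk))
    rw [eq_one_of_mem_omegaGroup_of_finrank_fixedSpace hQ hm (by omega), map_one]
    exact Subgroup.one_mem _

/-- A permutation group with socle `Ω` over the field with two elements is not IBIS. -/
theorem not_isIBIS_of_binary (hQ : Q.polarBilin.Nondegenerate) (hd : 4 ≤ Module.finrank F V)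
    (hF : ∀ c : F, c = 0 ∨ c = 1) (hG : (socle G).map G.subtype = omegaPerm Q) : ¬ IsIBIS G := by
  obtain ⟨e, f, hef⟩ := exists_isHyperbolicPair hQ (by omega)
  set K := LinearMap.BilinForm.orthogonal Q.polarBilin (Submodule.span F {e, f}) with hKdef
  have hKdim : Module.finrank F K = Module.finrank F V - 2 := by
    rw [hKdef, LinearMap.BilinForm.finrank_orthogonal hQ, hef.finrank_span]
  have heK : ∀ w ∈ K, Q.polarBilin e w = 0 := fun w hw =>
    mem_orthogonal_span_polarBilin.1 hw _ (Set.mem_insert _ _)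
  have hfK : ∀ w ∈ K, Q.polarBilin f w = 0 := fun w hw =>
    mem_orthogonal_span_polarBilin.1 hw _ (Set.mem_insert_of_mem _ rfl)
  by_cases hK : ∀ W < K, ∃ x ∈ K, x ∉ W ∧ Q x ≠ 0
  · exact hef.not_isIBIS hQ hd hF hK (le_of_map_socle_eq hG) (le_normalizer_of_map_socle_eq hG)
  push Not at hK
  obtain ⟨W, hWK, hW⟩ := hK
  obtain ⟨H, hWH, hHK, hHdim⟩ := exists_hyperplane_of_lt hWK
  have hH : ∀ y ∈ H, ∀ z ∈ H, Q.polarBilin y z = 0 := fun y hy z hz =>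
    polarBilin_eq_zero_of_singular_outside hHK (fun x hx hxH => hW x hx fun h => hxH (hWH h)) hy hz
  have heH : e ∉ H := by
    intro he
    have h1 := hfK e (hHK.le he)
    rw [polarBilin_comm, hef.polar] at h1
    exact one_ne_zero h1
  -- This totally isotropic subspace has dimension `d - 2`, so `2 * (d - 2) ≤ d` and `d = 4`. A
  -- vector of `K` outside `H` is singular and non-zero, so the space is the exceptional one of plus
  -- type.
  have hiso := two_mul_finrank_le_of_isotropic hQ (W := H ⊔ Submodule.span F {e}) (by
    intro y hy z hz
    obtain ⟨y, hyH, _, hy', rfl⟩ := Submodule.mem_sup.1 hy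
    obtain ⟨a, rfl⟩ := Submodule.mem_span_singleton.1 hy'
    obtain ⟨z, hzH, _, hz', rfl⟩ := Submodule.mem_sup.1 hz
    obtain ⟨b, rfl⟩ := Submodule.mem_span_singleton.1 hz'
    simp only [map_add, map_smul, LinearMap.add_apply, LinearMap.smul_apply, hH y hyH z hzH,
      heK z (hHK.le hzH), polarBilin_comm y e, heK y (hHK.le hyH), polarBilin_self, smul_zero,
      add_zero])
  rw [finrank_sup_span_singleton_of_notMem heH] at hiso
  obtain ⟨x, hxK, hxH⟩ := SetLike.exists_of_lt hHK
  exact absurd hG (hef.map_socle_ne hQ hF (by omega) (heK x hxK) (hfK x hxK)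
    (hW x hxK fun h => hxH (hWH h)) (fun h => hxH (h ▸ H.zero_mem)) G)

end BinaryOvergroups

theorem proposition6p2 {F V : Type*} [Field F] [Finite F] [CharP F 2]
    [AddCommGroup V] [Module F V] [FiniteDimensional F V]
    (Q : QuadraticForm F V) (hQ : Q.polarBilin.Nondegenerate)
    (hd : 4 ≤ Module.finrank F V)
    (G : Subgroup (Equiv.Perm (NS₁ Q)))
    (hG : (socle G).map G.subtype = omegaPerm Q) :
    (IsIBIS G ↔ G = omegaPerm Q ∧ 4 ≤ Nat.card F) ∧
      (IsIBIS G → ∀ l : List (NS₁ Q), IsIrredundantBase G l →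
        l.length = Module.finrank F V - 1) := by
  have hcard : IsIBIS G → 4 ≤ Nat.card F := fun h => by
    by_contra hF
    exact not_isIBIS_of_binary hQ hd (eq_zero_or_one_of_card_lt (by omega)) hG h
  have heq : IsIBIS G → G = omegaPerm Q := fun h => by
    by_contra hne
    exact not_isIBIS_of_ne_omegaPerm hQ hd (hcard h) (le_of_map_socle_eq hG)
      (le_normalizer_of_map_socle_eq hG) hne h
  have hlen : G = omegaPerm Q → 4 ≤ Nat.card F → ∀ l : List (NS₁ Q), IsIrredundantBase G l →
      l.length = Module.finrank F V - 1 := fun h hF l hl =>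
    length_of_isIrredundantBase_omegaPerm hQ (by omega) hF (h ▸ hl)
  refine ⟨⟨fun h => ⟨heq h, hcard h⟩, fun h l l' hl hl' => ?_⟩, fun h => hlen (heq h) (hcard h)⟩
  rw [hlen h.1 h.2 l hl, hlen h.1 h.2 l' hl']
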